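/- **Language.** Formulas are built from countably many variables $x_n$, countably many parameters $p_n$ and $\bot$ by $\wedge,\vee,\to,\Box$; $\top:=\bot\to\bot$, $\boxdot A:=A\wedge\Box A$, empty conjunctions are $\top$ and empty disjunctions $\bot$. Atoms are variables and parameters, and $\mathsf{atomb}$ is the set of atoms, boxed formulas and $\bot$. $\mathsf{IPC}$ is intuitionistic propositional logic over this language. $\mathsf{iK4C_a}$ is axiomatized, with modus ponens, by all instances of the axioms of $\mathsf{IPC}$, $\Box(A\to B)\to(\Box A\to\Box B)$, $\Box A\to\Box\Box A$, $a\to\Box a$ ($a$ an atom), and the boxes of all these; $\mathsf{iGLC_a}$ has in addition $\Box(\Box A\to A)\to\Box A$ and its box. For a set $T$ of formulas, $T\vdash A$ means $A\in T$. **Formula classes.** $\mathsf{NI}$ is the closure of $\mathsf{atomb}$ under $\wedge,\vee$. $\mathsf{NNIL}$ is the least set containing $\mathsf{atomb}$, closed under $\wedge,\vee$, and containing $B\to C$ whenever $B\in\mathsf{NI}$, $C\in\mathsf{NNIL}$. The translation $(\cdot)^\Box$ is given by $x^\Box=\boxdot x$ for variables, $A^\Box=A$ if $A$ is a parameter, a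 boxed formula or $\bot$, it commutes with $\wedge,\vee$, and $(B\to C)^\Box=\boxdot(B^\Box\to C^\Box)$. $\mathsf{SNNIL}$ is the set of $\mathsf{NNIL}$ formulas of the form $B^\Box$. $\mathsf{SPN}$ is the set of $A\in\mathsf{SNNIL}$ that are $T$-prime: $T\vdash A\to(B\vee C)$ implies $T\vdash A\to B$ or $T\vdash A\to C$. $\Gamma^\vee$ is the set of disjunctions of nonempty finite subsets of $\Gamma$. **Relations.** $A\mid\!\approx^T_\Gamma B$ ($\Gamma$-preservativity over $T$) means: for all $E\in\Gamma$, $T\vdash E\to A$ implies $T\vdash E\to B$. $B$ is a $(\Gamma,T)$-greatest lower bound (glb) of $A$ if $B\in\Gamma$, $T\vdash B\to A$, and $T\vdash B'\to B$ for every $B'\in\Gamma$ with $T\vdash B'\to A$. $\mathsf{AR}^+_T(\mathsf{atomb})$ derives statements $A\rhd B$ from the axioms $A\rhd B$ (when $T\vdash A\to B$), $A\rhd\Box A$, and $$(B\to C)\rhd\bigvee_{i=1}^{n+m}\{B\}(E_i),\qquad B=\bigwedge_{i=1}^n(E_i\to F_i),\quad C=\bigvee_{i=n+1}^{n+m}E_i,$$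 where $\{B\}(E)$ is $E$ if $E\in\mathsf{atomb}$ and $B\to E$ otherwise, by the rules: $A\rhd B,\ A\rhd C\,/\,A\rhd B\wedge C$; $A\rhd B,\ B\rhd C\,/\,A\rhd C$; $B\rhd A,\ C\rhd A\,/\,B\vee C\rhd A$; and $A\rhd B\,/\,(C\to A)\rhd(C\to B)$ for $C\in\mathsf{atomb}$. **Models.** A Kripke model $(W,\preccurlyeq,\sqsubset,V)$ has $W\ne\emptyset$, a partial order $\preccurlyeq$, a relation $\sqsubset$ with $({\preccurlyeq};{\sqsubset})\subseteq{\sqsubset}$, and a $\preccurlyeq$-persistent valuation of atoms; forcing is intuitionistic along $\preccurlyeq$, with $w\Vdash\Box A$ iff $u\Vdash A$ for all $u\sqsupset w$; a formula is valid in the model if it is forced at all nodes. The model is rooted at $r$ if every node is $\succcurlyeq$ to $r$ or to some $\sqsubset$-successor of $r$. For finite families $\mathscr K,\mathscr K'$ of rooted models, $\sum(\mathscr K,\mathscr K')$ is their disjoint union with a fresh root $w_0$ added, which is $\preccurlyeq$-below the root of each $K\in\mathscr K$ (and all nodes above it) and $\sqsubset$-sees the $\sqsubset$-successors of the roots of members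 of $\mathscr K$ and the roots of members of $\mathscr K'$ together with their $\sqsubset$-successors; a variant is obtained by choosing the valuation at $w_0$. **Type $\sigma$.** A set $T$ of formulas is of type $\sigma$ if $T\supseteq\mathsf{iK4C_a}$, $T$ is closed under modus ponens and necessitation, and $T$ is sound and complete for some class $\mathscr M$ of rooted Kripke models such that * (extension property) for all finite families $\mathscr K,\mathscr K'$ from $\mathscr M$, every variant of $\sum(\mathscr K,\mathscr K')$ that is a Kripke model validating $a\to\Box a$ for all atoms $a$ belongs to $\mathscr M$; * (intuitionistic submodel property) whenever $K\in\mathscr M$ and $K'$ arises from $K$ by shrinking $\preccurlyeq$ to a smaller partial order, all point-generated submodels of $K'$ belong to $\mathscr M$. **Theorem.** $\mathsf{iK4C_a}$ and $\mathsf{iGLC_a}$ are of type $\sigma$. Every formula $A$ has an $(\mathsf{NNIL},\mathsf{IPC})$-glb $A^*$ (Visser's $\mathsf{NNIL}$ approximation, unique up to $\mathsf{IPC}$-equivalence), and $A^*$, and hence $(A^*)^\Box$, can be computed from $A$. For every $T$ of type $\sigma$: 1. For all $A,B$: $\mathsf{AR}^+_T(\mathsf{atomb})\vdash A\rhd B$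 iff $A\mid\!\approx^T_{\mathsf{SNNIL}}B$. 2. As binary relations on formulas, $\mathsf{AR}^+_T(\mathsf{atomb})={\mid\!\approx^T_{\mathsf{SNNIL}}}={\mid\!\approx^T_{\mathsf{SNNIL}^\vee}}={\mid\!\approx^T_{\mathsf{SPN}}}={\mid\!\approx^T_{\mathsf{SPN}^\vee}}$. 3. For every $A$ and every $(\mathsf{NNIL},\mathsf{IPC})$-glb $A^*$ of $A$, the formula $(A^*)^\Box$ is an $(\mathsf{SNNIL},T)$-glb of $A$. 4. If $T$ is decidable, then all the relations in 2 are decidable. -/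

import Mathlib

namespace SNNILPres

/-! ### The modal language -/

/-- Atomic propositions: countably many variables and countably many parameters. -/
inductive Atom : Type where
  | var (n : ℕ) : Atom
  | par (n : ℕ) : Atom

/-- The propositional modal language with `⊥, ∧, ∨, →, □` over variables and parameters. -/
inductive Form : Type where
  | bot : Form
  | atom (a : Atom) : Form
  | and (A B : Form) : Form
  | or (A B : Form) : Form
  | imp (A B : Form) : Form
  | box (A : Form) : Form

namespace Form

/-- `⊤ := ⊥ → ⊥`. -/
def top : Form := imp bot bot

/-- `⊡ A := A ∧ □ A`. -/
def boxdot (A : Form) : Form := and A (box A)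

/-- Conjunction of a finite list; the empty conjunction is `⊤`. -/
def conj : List Form → Form
  | [] => top
  | [A] => A
  | A :: B :: l => and A (conj (B :: l))

/-- Disjunction of a finite list; the empty disjunction is `⊥`. -/
def disj : List Form → Form
  | [] => bot
  | [A] => A
  | A :: B :: l => or A (disj (B :: l))

/-! A Gödel numbering: an explicit bijection between formulas and natural numbers, through which
computability and decidability are understood. -/

/-- The code of a formula. -/
def toNat : Form → ℕ
  | bot => 0
  | atom (Atom.var n) => 6 * n + 1
  | atom (Atom.par n) => 6 * n + 2
  | and A B => 6 * Nat.pair (toNat A) (toNat B) + 3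
  | or A B => 6 * Nat.pair (toNat A) (toNat B) + 4
  | imp A B => 6 * Nat.pair (toNat A) (toNat B) + 5
  | box A => 6 * toNat A + 6

/-- The formula with a given code. -/
def ofNat : ℕ → Form
  | 0 => bot
  | n + 1 =>
    let m := n / 6
    have hm : m < n + 1 := Nat.lt_succ_of_le (Nat.div_le_self n 6)
    have _h1 : m.unpair.1 < n + 1 := lt_of_le_of_lt m.unpair_left_le hm
    have _h2 : m.unpair.2 < n + 1 := lt_of_le_of_lt m.unpair_right_le hm
    match n % 6 with
    | 0 => atom (Atom.var m)
    | 1 => atom (Atom.par m)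
    | 2 => and (ofNat m.unpair.1) (ofNat m.unpair.2)
    | 3 => or (ofNat m.unpair.1) (ofNat m.unpair.2)
    | 4 => imp (ofNat m.unpair.1) (ofNat m.unpair.2)
    | _ => box (ofNat m)
decreasing_by all_goals first | exact _h1 | exact _h2 | exact hm

theorem ofNat_toNat (A : Form) : ofNat (toNat A) = A := by
  induction A with
  | bot => simp [toNat, ofNat]
  | atom a =>
    cases a with
    | var n => simp [toNat, ofNat]
    | par n =>
      have h1 : (6 * n + 1) / 6 = n := by omega
      have h2 : (6 * n + 1) % 6 = 1 := by omega
      simp [toNat, ofNat, h1, h2]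
  | and A B ihA ihB =>
    have h1 : (6 * Nat.pair (toNat A) (toNat B) + 2) / 6 = Nat.pair (toNat A) (toNat B) := by omega
    have h2 : (6 * Nat.pair (toNat A) (toNat B) + 2) % 6 = 2 := by omega
    simp [toNat, ofNat, h1, h2, ihA, ihB]
  | or A B ihA ihB =>
    have h1 : (6 * Nat.pair (toNat A) (toNat B) + 3) / 6 = Nat.pair (toNat A) (toNat B) := by omega
    have h2 : (6 * Nat.pair (toNat A) (toNat B) + 3) % 6 = 3 := by omega
    simp [toNat, ofNat, h1, h2, ihA, ihB]
  | imp A B ihA ihB =>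
    have h1 : (6 * Nat.pair (toNat A) (toNat B) + 4) / 6 = Nat.pair (toNat A) (toNat B) := by omega
    have h2 : (6 * Nat.pair (toNat A) (toNat B) + 4) % 6 = 4 := by omega
    simp [toNat, ofNat, h1, h2, ihA, ihB]
  | box A ihA =>
    have h1 : (6 * toNat A + 5) / 6 = toNat A := by omega
    have h2 : (6 * toNat A + 5) % 6 = 5 := by omega
    simp [toNat, ofNat, h1, h2, ihA]

theorem toNat_ofNat (n : ℕ) : toNat (ofNat n) = n := by
  induction n using Nat.strong_induction_on with
  | _ n ih =>
    cases n with
    | zero => simp [toNat, ofNat]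
    | succ n =>
      have hm : n / 6 < n + 1 := Nat.lt_succ_of_le (Nat.div_le_self n 6)
      have ih0 := ih _ hm
      have ih1 := ih _ (lt_of_le_of_lt (n / 6).unpair_left_le hm)
      have ih2 := ih _ (lt_of_le_of_lt (n / 6).unpair_right_le hm)
      have hdiv := Nat.div_add_mod n 6
      have hlt : n % 6 < 6 := Nat.mod_lt _ (by norm_num)
      rw [ofNat]
      generalize n % 6 = r at hdiv hlt
      interval_cases r <;> simp only [toNat, ih0, ih1, ih2, Nat.pair_unpair] <;> omega

/-- Formulas are in explicit bijection with the natural numbers. -/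
def equivNat : Form ≃ ℕ := ⟨toNat, ofNat, ofNat_toNat, toNat_ofNat⟩

instance : Denumerable Form := Denumerable.mk' equivNat

end Form

open Form

/-! ### Logics -/

/-- The set of formulas derivable from the axioms `Ax` by modus ponens. -/
inductive Deriv (Ax : Set Form) : Form → Prop
  | ax {A : Form} : A ∈ Ax → Deriv Ax A
  | mp {A B : Form} : Deriv Ax (imp A B) → Deriv Ax A → Deriv Ax B

/-- Axiom instances of intuitionistic propositional logic over the modal language. -/
inductive AxIPC : Form → Prop
  | k (A B : Form) : AxIPC (imp A (imp B A))
  | s (A B C : Form) :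
      AxIPC (imp (imp A (imp B C)) (imp (imp A B) (imp A C)))
  | andI (A B : Form) : AxIPC (imp A (imp B (and A B)))
  | andL (A B : Form) : AxIPC (imp (and A B) A)
  | andR (A B : Form) : AxIPC (imp (and A B) B)
  | orE (A B C : Form) :
      AxIPC (imp (imp A C) (imp (imp B C) (imp (or A B) C)))
  | orL (A B : Form) : AxIPC (imp A (or A B))
  | orR (A B : Form) : AxIPC (imp B (or A B))
  | exfalso (A : Form) : AxIPC (imp bot A)

/-- Instances of `K`, `4` and `C_a` (the latter comprises `C_p`), without outer boxes. -/
inductive AxK4Ca : Form → Prop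
  | k (A B : Form) : AxK4Ca (imp (box (imp A B)) (imp (box A) (box B)))
  | four (A : Form) : AxK4Ca (imp (box A) (box (box A)))
  | ca (a : Atom) : AxK4Ca (imp (atom a) (box (atom a)))

/-- Instances of Löb's axiom. -/
inductive AxL : Form → Prop
  | lob (A : Form) : AxL (imp (box (imp (box A) A)) (box A))

/-- The logic axiomatized by the formulas in `Ax` and their boxes, with modus ponens. -/
def logicOf (Ax : Form → Prop) : Set Form :=
  {A | Deriv {B | Ax B ∨ ∃ C, Ax C ∧ B = box C} A}

/-- Intuitionistic propositional logic over the modal language. -/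
def IPC : Set Form := {A | Deriv {B | AxIPC B} A}

/-- The logic `iK4C_a`. -/
def iK4Ca : Set Form := logicOf fun A => AxIPC A ∨ AxK4Ca A

/-- The logic `iGLC_a`. -/
def iGLCa : Set Form := logicOf fun A => AxIPC A ∨ AxK4Ca A ∨ AxL A

/-! ### Kripke models -/

/-- Kripke models for intuitionistic modal logic. -/
structure KModel where
  /-- the nodes -/
  W : Type
  /-- the intuitionistic relation -/
  le : W → W → Prop
  /-- the modal relation -/
  rel : W → W → Prop
  /-- the valuation -/
  val : W → Atom → Prop
  nonempty : Nonempty W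
  le_refl : ∀ w, le w w
  le_trans : ∀ u v w, le u v → le v w → le u w
  le_antisymm : ∀ u v, le u v → le v u → u = v
  val_mono : ∀ u v a, le u v → val u a → val v a
  le_rel : ∀ u v w, le u v → rel v w → rel u w

namespace KModel

/-- Forcing. -/
def forces (K : KModel) : K.W → Form → Prop
  | _, .bot => False
  | w, .atom a => K.val w a
  | w, .and A B => K.forces w A ∧ K.forces w B
  | w, .or A B => K.forces w A ∨ K.forces w B
  | w, .imp A B => ∀ u, K.le w u → K.forces u A → K.forces u B
  | w, .box A => ∀ u, K.rel w u → K.forces u A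

/-- Validity in a model: truth at all nodes. -/
def Valid (K : KModel) (A : Form) : Prop := ∀ w, K.forces w A

/-- `r` is a root: every node is `≼`-above `r` or above a `⊏`-successor of `r`. -/
def IsRoot (K : KModel) (r : K.W) : Prop :=
  ∀ w, ∃ u, (u = r ∨ K.rel r u) ∧ K.le u w

/-- The intuitionistic submodel of `K` given by a smaller partial order `le'`. -/
def withOrder (K : KModel) (le' : K.W → K.W → Prop) (hr : ∀ w, le' w w)
    (ht : ∀ u v w, le' u v → le' v w → le' u w) (hs : ∀ u v, le' u v → K.le u v) : KModel where
  W := K.W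
  le := le'
  rel := K.rel
  val := K.val
  nonempty := K.nonempty
  le_refl := hr
  le_trans := ht
  le_antisymm := fun u v h h' => K.le_antisymm u v (hs u v h) (hs v u h')
  val_mono := fun u v a h => K.val_mono u v a (hs u v h)
  le_rel := fun u v w h => K.le_rel u v w (hs u v h)

/-- `v` belongs to the smallest set of nodes that contains `w` and is closed under `≼` and `⊏`. -/
def Reach (K : KModel) (w v : K.W) : Prop :=
  Relation.ReflTransGen (fun x y => K.le x y ∨ K.rel x y) w v

end KModel

/-- Kripke models with a designated node, meant to be the root. -/
structure PModel extends KModel where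
  /-- the designated node -/
  root : W

/-- The submodel generated by a node `w`, with `w` as designated node. -/
def KModel.gen (K : KModel) (w : K.W) : PModel where
  W := {v : K.W // K.Reach w v}
  le u v := K.le u v
  rel u v := K.rel u v
  val u a := K.val u a
  nonempty := ⟨⟨w, Relation.ReflTransGen.refl⟩⟩
  le_refl u := K.le_refl u
  le_trans u v z := K.le_trans u v z
  le_antisymm u v h h' := Subtype.ext (K.le_antisymm u v h h')
  val_mono u v a := K.val_mono u v a
  le_rel u v z := K.le_rel u v z
  root := ⟨w, Relation.ReflTransGen.refl⟩

section Sum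

/-- Nodes of `∑(𝒦, 𝒦')`: a fresh root together with the disjoint union of all nodes. -/
inductive SumNode {m n : ℕ} (K : Fin m → PModel) (K' : Fin n → PModel) : Type where
  | fresh : SumNode K K'
  | left (i : Fin m) (w : (K i).W) : SumNode K K'
  | right (j : Fin n) (w : (K' j).W) : SumNode K K'

/-- The intuitionistic relation of `∑(𝒦, 𝒦')`: the fresh root lies below the models in `𝒦`. -/
inductive SumLe {m n : ℕ} (K : Fin m → PModel) (K' : Fin n → PModel) :
    SumNode K K' → SumNode K K' → Prop
  | fresh : SumLe K K' .fresh .fresh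
  | below (i : Fin m) (w : (K i).W) : (K i).le (K i).root w → SumLe K K' .fresh (.left i w)
  | left (i : Fin m) (u w : (K i).W) : (K i).le u w → SumLe K K' (.left i u) (.left i w)
  | right (j : Fin n) (u w : (K' j).W) : (K' j).le u w → SumLe K K' (.right j u) (.right j w)

/-- The modal relation of `∑(𝒦, 𝒦')`: the fresh root sees the roots of the models in `𝒦'` with
all their successors, and the successors of the roots of the models in `𝒦`. -/
inductive SumRel {m n : ℕ} (K : Fin m → PModel) (K' : Fin n → PModel) :
    SumNode K K' → SumNode K K' → Prop
  | belowLeft (i : Fin m) (w : (K i).W) :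
      (K i).rel (K i).root w → SumRel K K' .fresh (.left i w)
  | belowRight (j : Fin n) (w : (K' j).W) :
      w = (K' j).root ∨ (K' j).rel (K' j).root w → SumRel K K' .fresh (.right j w)
  | left (i : Fin m) (u w : (K i).W) : (K i).rel u w → SumRel K K' (.left i u) (.left i w)
  | right (j : Fin n) (u w : (K' j).W) : (K' j).rel u w → SumRel K K' (.right j u) (.right j w)

/-- The valuation of a variant of `∑(𝒦, 𝒦')`, with value `v` at the fresh root. -/
def sumVal {m n : ℕ} (K : Fin m → PModel) (K' : Fin n → PModel) (v : Atom → Prop) :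
    SumNode K K' → Atom → Prop
  | .fresh, a => v a
  | .left i w, a => (K i).val w a
  | .right j w, a => (K' j).val w a

/-- The variant of `∑(𝒦, 𝒦')` in which the fresh root has valuation `v`; the hypothesis says that
the valuation is persistent. -/
def sumVariant {m n : ℕ} (K : Fin m → PModel) (K' : Fin n → PModel) (v : Atom → Prop)
    (hv : ∀ a, v a → ∀ i, (K i).val (K i).root a) : PModel where
  W := SumNode K K'
  le := SumLe K K'
  rel := SumRel K K'
  val := sumVal K K' v
  nonempty := ⟨.fresh⟩
  le_refl w := by
    cases w with
    | fresh => exact .fresh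
    | left i w => exact .left i w w ((K i).le_refl w)
    | right j w => exact .right j w w ((K' j).le_refl w)
  le_trans u v w huv hvw := by
    cases huv with
    | fresh => exact hvw
    | below i x hx =>
      cases hvw with
      | left _ _ y hy => exact .below i y ((K i).le_trans _ _ _ hx hy)
    | left i x y hxy =>
      cases hvw with
      | left _ _ z hz => exact .left i x z ((K i).le_trans _ _ _ hxy hz)
    | right j x y hxy =>
      cases hvw with
      | right _ _ z hz => exact .right j x z ((K' j).le_trans _ _ _ hxy hz)
  le_antisymm u v huv hvu := by
    cases huv with
    | fresh => rfl
    | below i x hx => cases hvu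
    | left i x y hxy =>
      cases hvu with
      | left _ _ _ h => rw [(K i).le_antisymm _ _ hxy h]
    | right j x y hxy =>
      cases hvu with
      | right _ _ _ h => rw [(K' j).le_antisymm _ _ hxy h]
  val_mono u w a huw hu := by
    cases huw with
    | fresh => exact hu
    | below i x hx => exact (K i).val_mono _ _ a hx (hv a hu i)
    | left i x y hxy => exact (K i).val_mono _ _ a hxy hu
    | right j x y hxy => exact (K' j).val_mono _ _ a hxy hu
  le_rel u v w huv hvw := by
    cases huv with
    | fresh => exact hvw
    | below i x hx =>
      cases hvw with
      | left _ _ y hy => exact .belowLeft i y ((K i).le_rel _ _ _ hx hy)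
    | left i x y hxy =>
      cases hvw with
      | left _ _ z hz => exact .left i x z ((K i).le_rel _ _ _ hxy hz)
    | right j x y hxy =>
      cases hvw with
      | right _ _ z hz => exact .right j x z ((K' j).le_rel _ _ _ hxy hz)
  root := .fresh

end Sum

/-- `T` is sound and complete for the class `M`. -/
def SoundComplete (T : Set Form) (M : Set PModel) : Prop :=
  ∀ A, A ∈ T ↔ ∀ K ∈ M, K.Valid A

/-- Intuitionistic submodel property of a class of rooted models: the class contains the
point-generated submodels of all intuitionistic submodels of its members. -/
def IntSubmodelProperty (M : Set PModel) : Prop :=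
  ∀ K ∈ M, ∀ (le' : K.W → K.W → Prop) (hr : ∀ w, le' w w)
    (ht : ∀ u v w, le' u v → le' v w → le' u w) (hs : ∀ u v, le' u v → K.le u v) (w : K.W),
    (K.toKModel.withOrder le' hr ht hs).gen w ∈ M

/-- Extension property: for finite families `𝒦, 𝒦'` from `M`, every variant of `∑(𝒦, 𝒦')` that
is a Kripke model validating `C_a` belongs to `M`. -/
def ExtensionProperty (M : Set PModel) : Prop :=
  ∀ (m n : ℕ) (K : Fin m → PModel) (K' : Fin n → PModel), (∀ i, K i ∈ M) → (∀ j, K' j ∈ M) →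
    ∀ (v : Atom → Prop) (hv : ∀ a, v a → ∀ i, (K i).val (K i).root a),
      (∀ a, (sumVariant K K' v hv).Valid (imp (atom a) (box (atom a)))) →
        sumVariant K K' v hv ∈ M

/-- Logics of type `σ`. -/
structure TypeSigma (T : Set Form) : Prop where
  extends_iK4Ca : iK4Ca ⊆ T
  mp : ∀ A B, imp A B ∈ T → A ∈ T → B ∈ T
  nec : ∀ A, A ∈ T → box A ∈ T
  exists_class : ∃ M : Set PModel, (∀ K ∈ M, K.IsRoot K.root) ∧ SoundComplete T M ∧
    ExtensionProperty M ∧ IntSubmodelProperty M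

/-! ### Sets of formulas -/

/-- `atomb`: atoms, boxed formulas and `⊥`. -/
def atomb : Set Form := {A | A = bot ∨ (∃ a, A = atom a) ∨ ∃ B, A = box B}

/-- `NI`: no implications outside boxes. -/
inductive NI : Form → Prop
  | base {A : Form} : A ∈ atomb → NI A
  | and {A B : Form} : NI A → NI B → NI (and A B)
  | or {A B : Form} : NI A → NI B → NI (or A B)

/-- `NNIL`: no nested implications to the left (outside boxes). -/
inductive IsNNIL : Form → Prop
  | base {A : Form} : A ∈ atomb → IsNNIL A
  | and {A B : Form} : IsNNIL A → IsNNIL B → IsNNIL (and A B)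
  | or {A B : Form} : IsNNIL A → IsNNIL B → IsNNIL (or A B)
  | imp {A B : Form} : NI A → IsNNIL B → IsNNIL (imp A B)

/-- The set of `NNIL` formulas. -/
def NNIL : Set Form := {A | IsNNIL A}

/-- The translation `A ↦ A^□`. -/
def boxTr : Form → Form
  | .bot => bot
  | .atom (.var n) => boxdot (atom (.var n))
  | .atom (.par n) => atom (.par n)
  | .and A B => and (boxTr A) (boxTr B)
  | .or A B => or (boxTr A) (boxTr B)
  | .imp A B => boxdot (imp (boxTr A) (boxTr B))
  | .box A => box A

/-- Self-complete formulas. -/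
def SelfComplete : Set Form := {A | ∃ B, A = boxTr B}

/-- `T`-prime formulas. -/
def PrimeForm (T : Set Form) : Set Form :=
  {A | ∀ B C, imp A (or B C) ∈ T → imp A B ∈ T ∨ imp A C ∈ T}

/-- `SNNIL`. -/
def SNNIL : Set Form := SelfComplete ∩ NNIL

/-- `SPN`: the `T`-prime members of `SNNIL`. -/
def SPN (T : Set Form) : Set Form := SelfComplete ∩ PrimeForm T ∩ NNIL

/-- `Γ^∨`: disjunctions of nonempty finite subsets of `Γ`. -/
def vee (Γ : Set Form) : Set Form := {A | ∃ l : List Form, l ≠ [] ∧ (∀ B ∈ l, B ∈ Γ) ∧ A = disj l}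

/-! ### Preservativity, greatest lower bounds and the axiomatization -/

/-- Preservativity: every `E ∈ Γ` that `T`-proves `A` also `T`-proves `B`. -/
def Pres (T Γ : Set Form) (A B : Form) : Prop :=
  ∀ E ∈ Γ, imp E A ∈ T → imp E B ∈ T

/-- `B` is a greatest `(Γ, T)`-lower bound for `A`. -/
def IsGlb (Γ T : Set Form) (A B : Form) : Prop :=
  (B ∈ Γ ∧ imp B A ∈ T) ∧ ∀ B', B' ∈ Γ → imp B' A ∈ T → imp B' B ∈ T

open Classical in
/-- `{A}(B)_Δ`: it is `B` if `B ∈ Δ`, and `A → B` otherwise. -/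
noncomputable def curly (Δ : Set Form) (A B : Form) : Form :=
  if B ∈ Δ then B else imp A B

/-- `AR⁺_T(Δ) ⊢ A ▷ B`. In the rule `visser`, the list `ps` holds the pairs `(E_i, F_i)`
for `i ≤ n` and `cs` holds `E_{n+1}, …, E_{n+m}`. -/
inductive ARPlus (T Δ : Set Form) : Form → Form → Prop
  | ax {A B : Form} : imp A B ∈ T → ARPlus T Δ A B
  | conj {A B C : Form} : ARPlus T Δ A B → ARPlus T Δ A C → ARPlus T Δ A (and B C)
  | cut {A B C : Form} : ARPlus T Δ A B → ARPlus T Δ B C → ARPlus T Δ A C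
  | disj {A B C : Form} : ARPlus T Δ B A → ARPlus T Δ C A → ARPlus T Δ (or B C) A
  | mont {A B C : Form} : C ∈ Δ → ARPlus T Δ A B → ARPlus T Δ (imp C A) (imp C B)
  | visser (ps : List (Form × Form)) (cs : List Form) :
      ARPlus T Δ
        (imp (Form.conj (ps.map fun p => imp p.1 p.2)) (Form.disj cs))
        (Form.disj ((ps.map Prod.fst ++ cs).map
          (curly Δ (Form.conj (ps.map fun p => imp p.1 p.2)))))
  | le (A : Form) : ARPlus T Δ A (box A)

end SNNILPres

open SNNILPres

namespace SNNILPres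

open Form

/-! ### Derivability from a set of formulas and prime theories -/

/-! Everything runs through one formula: an `NNIL` approximation `D` of `A`. In `AR⁺` one derives `A
▷ D` and then `D ▷ D^□`, while `D^□` is an `SNNIL` formula that implies `A` over `T`. So if `A`
`SNNIL`-preserves `B`, then `T ⊢ D^□ → B` by testing with `E = D^□`, and `A ▷ D ▷ D^□ ▷ B`. With
soundness of `AR⁺` this gives completeness, the greatest lower bound, and the reduction of
preservativity to the single question whether `T ⊢ D^□ → B` (`TypeSigma.pres_iff_of_approx`).

Soundness is semantic. Nodes are replaced by the prime theories they force (`Points`), and the only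
structural input is `Gluing`: below finitely many points one can put a new point whose finitely many
relevant members of `atomb` are prescribed by a given point `w`, and where an implication holds once
it holds at the given points and materially at the new one. For `T` of type `σ` this is the
extension property (`gluing_nodeTheories`); for `IPC` it is the Aczel slash (`gluing_IPC`). An
`NNIL` formula true at `w` survives gluing below points above `w`, and this validates Visser's rule
(`visser_sound`). The disjunction rule needs more: an `NNIL` or `SNNIL` formula true at `w` has a
`T`-prime lower bound of the same kind true at `w` (`exists_prime_of_inherited`), because gluing
below two counterexamples refutes a disjunction. The same decomposition shows that `SPN` gives the
same relation as `SNNIL`. The axiom `A ▷ □A` is sound since self-complete formulas imply their boxes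
(`TypeSigma.box_boxTr`).

Approximations are built by `Approx`, whose steps are all both derivable in `AR⁺` and sound for
`NNIL`-preservativity over `IPC`. They exist for every formula by a terminating proof search on
sequents (`hasApprox_seq`), where Visser's rule handles the irreducible sequents. As `Approx` is
recursively enumerable and total, an approximation is found by unbounded search.

The two logics are of type `σ` by canonical models; for `iGLCa` the modal relation is cut down so
that it is conversely well-founded. -/

theorem Deriv.mono {S S' : Set Form} (h : S ⊆ S') {A : Form} (d : Deriv S A) : Deriv S' A := by
  induction d with
  | ax hA => exact .ax (h hA)
  | mp _ _ ih₁ ih₂ => exact .mp ih₁ ih₂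

/-- The axiom instances of `IPC` as a set. -/
def ipcAxioms : Set Form := {A | AxIPC A}

theorem Deriv.imp_self {S : Set Form} (hS : ipcAxioms ⊆ S) (A : Form) : Deriv S (imp A A) :=
  .mp (.mp (.ax (hS (.s A (imp A A) A))) (.ax (hS (.k A (imp A A))))) (.ax (hS (.k A A)))

/-- The deduction theorem. -/
theorem Deriv.deduction {S : Set Form} (hS : ipcAxioms ⊆ S) {A B : Form}
    (d : Deriv (insert A S) B) : Deriv S (imp A B) := by
  induction d with
  | @ax C hC =>
    rcases hC with rfl | hC
    · exact .imp_self hS _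
    · exact .mp (.ax (hS (.k C A))) (.ax hC)
  | @mp C D _ _ ih₁ ih₂ => exact .mp (.mp (.ax (hS (.s A C D))) ih₁) ih₂

/-- A set of formulas containing `IPC` and closed under modus ponens. -/
structure IsTheory (T : Set Form) : Prop where
  ipc : IPC ⊆ T
  mp : ∀ {A B}, imp A B ∈ T → A ∈ T → B ∈ T

theorem IsTheory.axioms {T : Set Form} (hT : IsTheory T) : ipcAxioms ⊆ T :=
  fun _ h => hT.ipc (.ax h)

theorem IsTheory.of_deriv {T S : Set Form} (hT : IsTheory T) (h : S ⊆ T) {A : Form}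
    (d : Deriv S A) : A ∈ T := by
  induction d with
  | ax hA => exact h hA
  | mp _ _ ih₁ ih₂ => exact hT.mp ih₁ ih₂

theorem isTheory_IPC : IsTheory IPC := ⟨fun _ h => h, fun h₁ h₂ => Deriv.mp h₁ h₂⟩

/-- Consistent theories extending `T` with the disjunction property. -/
structure IsPrimeTheory (T w : Set Form) : Prop where
  isTheory : IsTheory w
  subset : T ⊆ w
  bot : Form.bot ∉ w
  or : ∀ {A B}, Form.or A B ∈ w → A ∈ w ∨ B ∈ w

theorem Deriv.exists_of_sUnion {c : Set (Set Form)} (hc : IsChain (· ⊆ ·) c)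
    {A : Form} (d : Deriv (⋃₀ c) A) : ∃ S ∈ c, Deriv S A := by
  induction d with
  | ax hA =>
    obtain ⟨S, hS, hA⟩ := hA
    exact ⟨S, hS, .ax hA⟩
  | mp _ _ ih₁ ih₂ =>
    obtain ⟨S₁, h₁, d₁⟩ := ih₁
    obtain ⟨S₂, h₂, d₂⟩ := ih₂
    rcases hc.total h₁ h₂ with h | h
    · exact ⟨S₂, h₂, .mp (d₁.mono h) d₂⟩
    · exact ⟨S₁, h₁, .mp d₁ (d₂.mono h)⟩

/-- Lindenbaum's lemma. -/
theorem exists_isPrimeTheory {S : Set Form} (hS : ipcAxioms ⊆ S) {A : Form} (h : ¬ Deriv S A) :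
    ∃ w, IsPrimeTheory S w ∧ A ∉ w := by
  obtain ⟨w, hSw, hw⟩ := zorn_subset_nonempty {S' : Set Form | S ⊆ S' ∧ ¬ Deriv S' A}
    (fun c hc hchain _ => by
      refine ⟨⋃₀ c, ⟨?_, ?_⟩, fun s hs => Set.subset_sUnion_of_mem hs⟩
      · obtain ⟨s, hs⟩ := ‹c.Nonempty›
        exact (hc hs).1.trans (Set.subset_sUnion_of_mem hs)
      · intro d
        obtain ⟨s, hs, d⟩ := d.exists_of_sUnion hchain
        exact (hc hs).2 d) S ⟨subset_rfl, h⟩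
  have hax : ipcAxioms ⊆ w := hS.trans hSw
  have key : ∀ B, B ∉ w → Deriv w (imp B A) := by
    intro B hB
    by_contra hn
    have := hw.le_of_ge (y := insert B w)
      ⟨hSw.trans (Set.subset_insert _ _), fun d => hn (d.deduction hax)⟩ (Set.subset_insert _ _)
    exact hB (this (Set.mem_insert _ _))
  -- Maximality makes `w` deductively closed, since any formula outside `w` would imply `A`.
  have hcl : ∀ B, Deriv w B → B ∈ w := fun B d => by
    by_contra hB
    exact hw.prop.2 (.mp (key B hB) d)
  refine ⟨w, ⟨⟨fun B hB => hcl B (hB.mono hax), fun h₁ h₂ => hcl _ (.mp (.ax h₁) (.ax h₂))⟩, hSw,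
    fun hb => hw.prop.2 (.mp (.ax (hax (.exfalso A))) (.ax hb)), ?_⟩, fun hA => hw.prop.2 (.ax hA)⟩
  intro B C hBC
  by_contra! hn
  exact hw.prop.2 (.mp (.mp (.mp (.ax (hax (.orE B C A))) (key B hn.1)) (key C hn.2)) (.ax hBC))

/-- A family of sets of formulas that behaves like the nodes of a Kripke model which is sound
and complete for `T`. -/
structure Points (T : Set Form) (P : Set (Set Form)) : Prop where
  complete : ∀ {A}, (∀ w ∈ P, A ∈ w) → A ∈ T
  prime : ∀ {w}, w ∈ P → IsPrimeTheory T w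
  imp : ∀ {w}, w ∈ P → ∀ {A B}, (∀ u ∈ P, w ⊆ u → A ∈ u → B ∈ u) → imp A B ∈ w

/-- By Lindenbaum's lemma, provability in any theory can be checked pointwise at prime theories.
This replaces syntactic derivations throughout. -/
theorem points_isPrimeTheory {T : Set Form} (hT : IsTheory T) :
    Points T {w | IsPrimeTheory T w} where
  complete := by
    intro A h
    by_contra hA
    obtain ⟨w, hw, hAw⟩ := exists_isPrimeTheory hT.axioms
      (fun d => hA (hT.of_deriv subset_rfl d))
    exact hAw (h w hw)
  prime h := h
  imp := by
    intro w hw A B h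
    by_contra hn
    have hax := hw.isTheory.axioms
    obtain ⟨u, hu, hB⟩ := exists_isPrimeTheory (S := insert A w)
      (hax.trans (Set.subset_insert _ _))
      (fun d => hn (hw.isTheory.of_deriv subset_rfl (d.deduction hax)))
    have hwu : w ⊆ u := (Set.subset_insert _ _).trans hu.subset
    exact hB (h u ⟨hu.isTheory, hw.subset.trans hwu, hu.bot, hu.or⟩ hwu
      (hu.subset (Set.mem_insert _ _)))

namespace IsTheory

variable {w : Set Form}

theorem and_iff (hw : IsTheory w) {A B : Form} : Form.and A B ∈ w ↔ A ∈ w ∧ B ∈ w :=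
  ⟨fun h => ⟨hw.mp (hw.axioms (.andL A B)) h, hw.mp (hw.axioms (.andR A B)) h⟩,
    fun h => hw.mp (hw.mp (hw.axioms (.andI A B)) h.1) h.2⟩

theorem top_mem (hw : IsTheory w) : Form.top ∈ w := hw.axioms (.exfalso _)

theorem conj_iff (hw : IsTheory w) : ∀ {l : List Form}, Form.conj l ∈ w ↔ ∀ A ∈ l, A ∈ w
  | [] => by simpa [Form.conj] using hw.top_mem
  | [A] => by simp [Form.conj]
  | A :: B :: l => by
    rw [Form.conj, hw.and_iff, hw.conj_iff (l := B :: l)]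
    simp

theorem imp_of_mem (hw : IsTheory w) {A B : Form} (h : B ∈ w) : imp A B ∈ w :=
  hw.mp (hw.axioms (.k B A)) h

theorem or_left (hw : IsTheory w) {A B : Form} (h : A ∈ w) : Form.or A B ∈ w :=
  hw.mp (hw.axioms (.orL A B)) h

theorem or_right (hw : IsTheory w) {A B : Form} (h : B ∈ w) : Form.or A B ∈ w :=
  hw.mp (hw.axioms (.orR A B)) h

end IsTheory

theorem IsPrimeTheory.or_iff {T w : Set Form} (hw : IsPrimeTheory T w) {A B : Form} :
    Form.or A B ∈ w ↔ A ∈ w ∨ B ∈ w :=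
  ⟨hw.or, fun h => h.elim hw.isTheory.or_left hw.isTheory.or_right⟩

theorem IsPrimeTheory.disj_iff {T w : Set Form} (hw : IsPrimeTheory T w) :
    ∀ {l : List Form}, Form.disj l ∈ w ↔ ∃ A ∈ l, A ∈ w
  | [] => by simpa [Form.disj] using hw.bot
  | [A] => by simp [Form.disj]
  | A :: B :: l => by
    rw [Form.disj, hw.or_iff, hw.disj_iff (l := B :: l)]
    simp

namespace Points

variable {T : Set Form} {P : Set (Set Form)}

theorem imp_iff (hP : Points T P) {w : Set Form} (hw : w ∈ P) {A B : Form} :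
    Form.imp A B ∈ w ↔ ∀ u ∈ P, w ⊆ u → A ∈ u → B ∈ u :=
  ⟨fun h _ hu hwu hA => (hP.prime hu).isTheory.mp (hwu h) hA, hP.imp hw⟩

theorem imp_mem_iff (hP : Points T P) {A B : Form} :
    Form.imp A B ∈ T ↔ ∀ w ∈ P, A ∈ w → B ∈ w :=
  ⟨fun h _ hw hA => (hP.prime hw).isTheory.mp ((hP.prime hw).subset h) hA,
    fun h => hP.complete fun _ hw => hP.imp hw fun u hu _ hA => h u hu hA⟩

end Points

theorem IsTheory.imp_mem_iff {T : Set Form} (hT : IsTheory T) {A B : Form} :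
    imp A B ∈ T ↔ ∀ w, IsPrimeTheory T w → A ∈ w → B ∈ w :=
  (points_isPrimeTheory hT).imp_mem_iff

/-! ### Gluing points below finitely many points -/

/-- `w₀` is obtained by gluing a point below the points in `ws`; it agrees with `w` on the members
of `atomb` in `Φ`. -/
structure Glued (Φ : List Form) (w : Set Form) (ws : List (Set Form)) (w₀ : Set Form) : Prop where
  base : ∀ A ∈ Φ, A ∈ atomb → (A ∈ w₀ ↔ A ∈ w)
  le : ∀ u ∈ ws, w₀ ⊆ u
  imp : ∀ {A B}, (∀ u ∈ ws, imp A B ∈ u) → (A ∈ w₀ → B ∈ w₀) → imp A B ∈ w₀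

/-- Gluing is possible below all points satisfying the relevant members of `atomb`. -/
def Gluing (P : Set (Set Form)) : Prop :=
  ∀ (Φ : List Form) (w : Set Form) (ws : List (Set Form)), w ∈ P → (∀ u ∈ ws, u ∈ P) →
    (∀ A ∈ Φ, A ∈ atomb → A ∈ w → ∀ u ∈ ws, A ∈ u) → ∃ w₀ ∈ P, Glued Φ w ws w₀

/-- The members of `atomb` occurring outside boxes. -/
def outer : Form → List Form
  | .bot => [.bot]
  | .atom a => [.atom a]
  | .and A B => outer A ++ outer B
  | .or A B => outer A ++ outer B
  | .imp A B => outer A ++ outer B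
  | .box A => [.box A]

theorem outer_of_atomb {A : Form} (h : A ∈ atomb) : outer A = [A] := by
  rcases h with rfl | ⟨a, rfl⟩ | ⟨B, rfl⟩ <;> rfl

section Gluing

variable {T : Set Form} {P : Set (Set Form)} {Φ : List Form} {w w₀ : Set Form}
  {ws : List (Set Form)}

theorem Glued.ni_iff (hg : Glued Φ w ws w₀) (hw : IsPrimeTheory T w) (hw₀ : IsPrimeTheory T w₀)
    {N : Form} (hN : NI N) (hΦ : outer N ⊆ Φ) : N ∈ w₀ ↔ N ∈ w := by
  induction hN with
  | base hA => exact hg.base _ (hΦ (by simp [outer_of_atomb hA])) hA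
  | and _ _ ih₁ ih₂ =>
    rw [outer, List.append_subset] at hΦ
    rw [hw₀.isTheory.and_iff, hw.isTheory.and_iff, ih₁ hΦ.1, ih₂ hΦ.2]
  | or _ _ ih₁ ih₂ =>
    rw [outer, List.append_subset] at hΦ
    rw [hw₀.or_iff, hw.or_iff, ih₁ hΦ.1, ih₂ hΦ.2]

/-- `NNIL` formulas are inherited by a glued point. -/
theorem Glued.nnil (hg : Glued Φ w ws w₀) (hw : IsPrimeTheory T w) (hw₀ : IsPrimeTheory T w₀)
    (hws : ∀ u ∈ ws, w ⊆ u) {E : Form} (hE : IsNNIL E) (hΦ : outer E ⊆ Φ) (h : E ∈ w) :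
    E ∈ w₀ := by
  induction hE with
  | base hA => exact (hg.base _ (hΦ (by simp [outer_of_atomb hA])) hA).2 h
  | and _ _ ih₁ ih₂ =>
    rw [outer, List.append_subset] at hΦ
    rw [hw.isTheory.and_iff] at h
    exact hw₀.isTheory.and_iff.2 ⟨ih₁ hΦ.1 h.1, ih₂ hΦ.2 h.2⟩
  | or _ _ ih₁ ih₂ =>
    rw [outer, List.append_subset] at hΦ
    exact hw₀.or_iff.2 ((hw.or h).imp (ih₁ hΦ.1) (ih₂ hΦ.2))
  | imp hN _ ih =>
    rw [outer, List.append_subset] at hΦ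
    -- The antecedent is in `NI`, so its truth at the glued point carries back to `w`, where the
    -- implication can be applied.
    exact hg.imp (fun u hu => hws u hu h) fun hN₀ =>
      ih hΦ.2 (hw.isTheory.mp h ((hg.ni_iff hw hw₀ hN hΦ.1).1 hN₀))

/-- The conclusion of Visser's rule for the implications `ps` and the disjuncts `cs`. -/
noncomputable def visserConcl (ps : List (Form × Form)) (cs : List Form) : Form :=
  Form.disj ((ps.map Prod.fst ++ cs).map
    (curly atomb (Form.conj (ps.map fun p => Form.imp p.1 p.2))))

/-- The premise of Visser's rule for the implications `ps` and the disjuncts `cs`. -/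
def visserPrem (ps : List (Form × Form)) (cs : List Form) : Form :=
  .imp (Form.conj (ps.map fun p => Form.imp p.1 p.2)) (Form.disj cs)

open Classical in
/-- Visser's rule preserves being implied by an `NNIL` formula. -/
theorem visser_sound (hP : Points T P) (hG : Gluing P) {E : Form} (hE : IsNNIL E)
    {ps : List (Form × Form)} {cs : List Form} (h : Form.imp E (visserPrem ps cs) ∈ T) :
    Form.imp E (visserConcl ps cs) ∈ T := by
  rw [hP.imp_mem_iff] at h ⊢
  intro w hw hEw
  by_contra hV
  have hwp := hP.prime hw
  rw [visserConcl, hwp.disj_iff] at hV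
  push Not at hV
  set B := Form.conj (ps.map fun p => Form.imp p.1 p.2) with hB
  set L := ps.map Prod.fst ++ cs with hL
  -- A disjunct in `atomb` fails at `w` itself; any other disjunct has the form `B → e` and is
  -- refuted at a point `f e` above `w`. Gluing below these points refutes all of `L` at once.
  have hbase : ∀ e ∈ L, e ∈ atomb → e ∉ w := by
    intro e he hea
    simpa [curly, hea] using hV _ (List.mem_map_of_mem he)
  have himp : ∀ e ∈ L, e ∉ atomb → ∃ u ∈ P, w ⊆ u ∧ B ∈ u ∧ e ∉ u := by
    intro e he hea
    have h1 := hV _ (List.mem_map_of_mem he)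
    simp only [curly, hea, if_false] at h1
    rw [hP.imp_iff hw] at h1
    push Not at h1
    exact h1
  choose! f hfP hwf hBf hef using himp
  set M := L.filter (fun e => e ∉ atomb) with hM
  have hM' : ∀ e, e ∈ M ↔ e ∈ L ∧ e ∉ atomb := by simp [hM]
  obtain ⟨w₀, hw₀, hg⟩ := hG (outer E ++ L) w (M.map f) hw
    (by
      intro u hu
      obtain ⟨e, he, rfl⟩ := List.mem_map.1 hu
      exact hfP e ((hM' e).1 he).1 ((hM' e).1 he).2)
    (by
      intro A _ _ hA u hu
      obtain ⟨e, he, rfl⟩ := List.mem_map.1 hu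
      exact hwf e ((hM' e).1 he).1 ((hM' e).1 he).2 hA)
  have hwp₀ := hP.prime hw₀
  have hE₀ : E ∈ w₀ := hg.nnil hwp hwp₀ (by
      intro u hu
      obtain ⟨e, he, rfl⟩ := List.mem_map.1 hu
      exact hwf e ((hM' e).1 he).1 ((hM' e).1 he).2) hE (by simp) hEw
  have hL₀ : ∀ e ∈ L, e ∉ w₀ := by
    intro e he
    by_cases hea : e ∈ atomb
    · rw [hg.base e (by simp [he]) hea]
      exact hbase e he hea
    · intro he₀
      exact hef e he hea (hg.le (f e) (List.mem_map_of_mem ((hM' e).2 ⟨he, hea⟩)) he₀)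
  -- Each `E_i → F_i` holds at the glued points, and its antecedent fails at `w₀`.
  have hB₀ : B ∈ w₀ := by
    rw [hB, hwp₀.isTheory.conj_iff]
    intro A hA
    obtain ⟨p, hp, rfl⟩ := List.mem_map.1 hA
    refine hg.imp ?_ fun h1 => absurd h1
      (hL₀ _ (List.mem_append_left cs (List.mem_map_of_mem hp)))
    intro u hu
    obtain ⟨e, he, rfl⟩ := List.mem_map.1 hu
    have he' := (hM' e).1 he
    exact (hP.prime (hfP e he'.1 he'.2)).isTheory.conj_iff.1 (hBf e he'.1 he'.2) _ hA
  obtain ⟨e, he, he₀⟩ := hwp₀.disj_iff.1 (hwp₀.isTheory.mp (h w₀ hw₀ hE₀) hB₀)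
  exact hL₀ e (by simp [hL, he]) he₀

/-! ### Decomposition into prime formulas -/

/-- `G` is inherited by points glued below points that satisfy it. -/
def Inherited (P : Set (Set Form)) (Φ : List Form) (w : Set Form) (G : Form) : Prop :=
  ∀ ws w₀, w₀ ∈ P → Glued Φ w ws w₀ → (∀ u ∈ ws, u ∈ P) → (∀ u ∈ ws, G ∈ u) → G ∈ w₀

theorem Inherited.and (hP : Points T P) {A B : Form} (hA : Inherited P Φ w A)
    (hB : Inherited P Φ w B) : Inherited P Φ w (.and A B) := by
  intro ws w₀ hw₀ hg hws h
  exact (hP.prime hw₀).isTheory.and_iff.2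
    ⟨hA ws w₀ hw₀ hg hws fun u hu => ((hP.prime (hws u hu)).isTheory.and_iff.1 (h u hu)).1,
     hB ws w₀ hw₀ hg hws fun u hu => ((hP.prime (hws u hu)).isTheory.and_iff.1 (h u hu)).2⟩

theorem Inherited.of_atomb {A : Form} (hA : A ∈ atomb) (hΦ : A ∈ Φ) (hw : A ∈ w) :
    Inherited P Φ w A :=
  fun _ _ _ hg _ _ => (hg.base A hΦ hA).2 hw

/-- The antecedent stays false at the glued point, so the implication there depends only on the
points above. -/
theorem Inherited.imp (hP : Points T P) (hw : w ∈ P) {N D : Form} (hN : NI N)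
    (hΦ : outer N ⊆ Φ) (hNw : N ∉ w) : Inherited P Φ w (.imp N D) :=
  fun _ _ hw₀ hg _ h => hg.imp h fun hN₀ =>
    absurd ((hg.ni_iff (hP.prime hw) (hP.prime hw₀) hN hΦ).1 hN₀) hNw

/-- Glue below a counterexample to each disjunct. These points need not lie above `w`; gluing is
allowed because `G` implies every relevant member of `atomb` true at `w`. -/
theorem Inherited.prime (hP : Points T P) (hG : Gluing P) (hw : w ∈ P) {G : Form}
    (hGi : Inherited P Φ w G)
    (hΦ : ∀ A ∈ Φ, A ∈ atomb → A ∈ w → Form.imp G A ∈ T) : G ∈ PrimeForm T := by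
  intro B C hBC
  by_contra! hn
  simp only [hP.imp_mem_iff] at hn hBC hΦ
  push Not at hn
  obtain ⟨⟨u, hu, hGu, hBu⟩, v, hv, hGv, hCv⟩ := hn
  have hws : ∀ x ∈ [u, v], x ∈ P := by simp [hu, hv]
  obtain ⟨w₀, hw₀, hg⟩ := hG Φ w [u, v] hw hws
    (by
      intro A hA hAa hAw
      simpa using ⟨hΦ A hA hAa hAw u hu hGu, hΦ A hA hAa hAw v hv hGv⟩)
  rcases (hP.prime hw₀).or (hBC w₀ hw₀ (hGi _ w₀ hw₀ hg hws (by simp [hGu, hGv]))) with h | h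
  · exact hBu (hg.le u (by simp) h)
  · exact hCv (hg.le v (by simp) h)

/-- If `E` has a lower bound in `Γ` that holds at `w` and is inherited, then it has a `T`-prime
lower bound in `Γ` that holds at `w`. -/
theorem exists_prime_of_inherited (hP : Points T P) (hG : Gluing P) {Γ : Set Form}
    (hand : ∀ A ∈ Γ, ∀ B ∈ Γ, Form.and A B ∈ Γ)
    (hatom : ∀ A ∈ atomb, ∃ A' ∈ Γ, ∀ u ∈ P, A' ∈ u ↔ A ∈ u) (hw : w ∈ P) {E : Form}
    (hE : ∃ G ∈ Γ, G ∈ w ∧ Form.imp G E ∈ T ∧ Inherited P Φ w G) :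
    ∃ G ∈ Γ, G ∈ w ∧ Form.imp G E ∈ T ∧ G ∈ PrimeForm T := by
  -- The members of `atomb` in `Φ` that hold at `w` are conjoined to `G` one at a time; a conjunct
  -- in `Γ` equivalent to such a member is inherited because gluing fixes its truth value.
  have key : ∀ L : List Form, L ⊆ Φ → ∃ G ∈ Γ, G ∈ w ∧ Form.imp G E ∈ T ∧ Inherited P Φ w G ∧
      ∀ A ∈ L, A ∈ atomb → A ∈ w → Form.imp G A ∈ T := by
    intro L
    induction L with
    | nil =>
      intro _
      obtain ⟨G, h1, h2, h3, h4⟩ := hE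
      exact ⟨G, h1, h2, h3, h4, by simp⟩
    | cons A L ih =>
      intro hL
      rw [List.cons_subset] at hL
      obtain ⟨G, h1, h2, h3, h4, h5⟩ := ih hL.2
      by_cases hA : A ∈ atomb ∧ A ∈ w
      · obtain ⟨A', hA', hiff⟩ := hatom A hA.1
        have hwt := (hP.prime hw).isTheory
        simp only [hP.imp_mem_iff] at h3 h5 ⊢
        have hl : ∀ u ∈ P, Form.and G A' ∈ u → G ∈ u := fun u hu h =>
          ((hP.prime hu).isTheory.and_iff.1 h).1
        have hr : ∀ u ∈ P, Form.and G A' ∈ u → A ∈ u := fun u hu h =>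
          (hiff u hu).1 ((hP.prime hu).isTheory.and_iff.1 h).2
        refine ⟨.and G A', hand _ h1 _ hA', hwt.and_iff.2 ⟨h2, (hiff w hw).2 hA.2⟩,
          fun u hu h => h3 u hu (hl u hu h), h4.and hP ?_, ?_⟩
        · intro ws w₀ hw₀ hg hws h
          exact (hiff w₀ hw₀).2 ((hg.base A hL.1 hA.1).2 hA.2)
        · intro C hC hCa hCw u hu h
          rcases List.mem_cons.1 hC with rfl | hC
          · exact hr u hu h
          · exact h5 C hC hCa hCw u hu (hl u hu h)
      · refine ⟨G, h1, h2, h3, h4, fun C hC hCa hCw => ?_⟩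
        rcases List.mem_cons.1 hC with rfl | hC
        · exact absurd ⟨hCa, hCw⟩ hA
        · exact h5 C hC hCa hCw
  obtain ⟨G, h1, h2, h3, h4, h5⟩ := key Φ (List.Subset.refl _)
  exact ⟨G, h1, h2, h3, h4.prime hP hG hw h5⟩

/-- Strip `E` down according to what is true at `w`: keep a true disjunct, replace an implication
with true antecedent by a lower bound of its consequent, and keep an implication with false
antecedent. -/
theorem exists_inherited_nnil (hP : Points T P) (hw : w ∈ P) {E : Form} (hE : IsNNIL E)
    (hΦ : outer E ⊆ Φ) (h : E ∈ w) :
    ∃ G ∈ NNIL, G ∈ w ∧ Form.imp G E ∈ T ∧ Inherited P Φ w G := by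
  have hwp := hP.prime hw
  simp only [hP.imp_mem_iff]
  induction hE with
  | @base A hA =>
    exact ⟨A, .base hA, h, fun _ _ h => h, .of_atomb hA (hΦ (by simp [outer_of_atomb hA])) h⟩
  | and _ _ ih₁ ih₂ =>
    rw [outer, List.append_subset] at hΦ
    rw [hwp.isTheory.and_iff] at h
    obtain ⟨G₁, a1, a2, a3, a4⟩ := ih₁ hΦ.1 h.1
    obtain ⟨G₂, b1, b2, b3, b4⟩ := ih₂ hΦ.2 h.2
    refine ⟨.and G₁ G₂, .and a1 b1, hwp.isTheory.and_iff.2 ⟨a2, b2⟩, fun u hu h => ?_, a4.and hP b4⟩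
    have hut := (hP.prime hu).isTheory
    rw [hut.and_iff] at h ⊢
    exact ⟨a3 u hu h.1, b3 u hu h.2⟩
  | or _ _ ih₁ ih₂ =>
    rw [outer, List.append_subset] at hΦ
    rcases hwp.or h with h | h
    · obtain ⟨G, a1, a2, a3, a4⟩ := ih₁ hΦ.1 h
      exact ⟨G, a1, a2, fun u hu h => (hP.prime hu).isTheory.or_left (a3 u hu h), a4⟩
    · obtain ⟨G, a1, a2, a3, a4⟩ := ih₂ hΦ.2 h
      exact ⟨G, a1, a2, fun u hu h => (hP.prime hu).isTheory.or_right (a3 u hu h), a4⟩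
  | @imp N D hN hD ih =>
    rw [outer, List.append_subset] at hΦ
    by_cases hNw : N ∈ w
    · obtain ⟨G, a1, a2, a3, a4⟩ := ih hΦ.2 (hwp.isTheory.mp h hNw)
      exact ⟨G, a1, a2, fun u hu h => (hP.prime hu).isTheory.imp_of_mem (a3 u hu h), a4⟩
    · exact ⟨.imp N D, .imp hN hD, h, fun _ _ h => h, .imp hP hw hN hΦ.1 hNw⟩

theorem exists_prime_nnil (hP : Points T P) (hG : Gluing P) (hw : w ∈ P) {E : Form}
    (hE : IsNNIL E) (h : E ∈ w) :
    ∃ G ∈ NNIL, G ∈ w ∧ Form.imp G E ∈ T ∧ G ∈ PrimeForm T :=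
  exists_prime_of_inherited hP hG (fun _ hA _ hB => .and hA hB)
    (fun A hA => ⟨A, .base hA, fun _ _ => Iff.rfl⟩) hw
    (exists_inherited_nnil hP hw hE (List.Subset.refl _) h)

/-- The rule for disjunctions preserves `Γ`-preservativity when the members of `Γ` decompose into
`T`-prime ones. -/
theorem pres_or (hP : Points T P) {Γ : Set Form}
    (hΓ : ∀ E ∈ Γ, ∀ w ∈ P, E ∈ w → ∃ G ∈ Γ, G ∈ w ∧ Form.imp G E ∈ T ∧ G ∈ PrimeForm T)
    {A B C : Form} (hB : Pres T Γ B A) (hC : Pres T Γ C A) : Pres T Γ (.or B C) A := by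
  intro E hE h
  rw [hP.imp_mem_iff]
  intro w hw hEw
  obtain ⟨G, hG, hGw, hGE, hGp⟩ := hΓ E hE w hw hEw
  have hor : Form.imp G (.or B C) ∈ T := by
    rw [hP.imp_mem_iff] at hGE h ⊢
    exact fun u hu hGu => h u hu (hGE u hu hGu)
  have hGA : Form.imp G A ∈ T := (hGp B C hor).elim (hB G hG) (hC G hG)
  exact hP.imp_mem_iff.1 hGA w hw hGw

end Gluing

/-! ### Gluing for `IPC`: the Aczel slash -/

/-- The Aczel slash with values `b` for atoms and boxed formulas, relative to the set `p`. -/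
def slash (b p : Set Form) : Form → Prop
  | .bot => False
  | .atom a => Form.atom a ∈ b
  | .and A B => slash b p A ∧ slash b p B
  | .or A B => slash b p A ∨ slash b p B
  | .imp A B => Form.imp A B ∈ p ∧ (slash b p A → slash b p B)
  | .box A => Form.box A ∈ b

theorem slash_mem {b p : Set Form} (hp : IsTheory p) (hbp : b ⊆ p) {A : Form}
    (h : slash b p A) : A ∈ p := by
  induction A with
  | bot => exact h.elim
  | atom a => exact hbp h
  | and A B ihA ihB => exact hp.and_iff.2 ⟨ihA h.1, ihB h.2⟩
  | or A B ihA ihB => exact h.elim (fun h => hp.or_left (ihA h)) (fun h => hp.or_right (ihB h))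
  | imp A B _ _ => exact h.1
  | box A _ => exact hbp h

/-- The slash behaves like forcing at a new node: `p` is what holds everywhere above it, and
implications additionally hold materially. Boxed formulas count as atoms. -/
theorem slash_of_IPC {b p : Set Form} (hp : IsTheory p) (hbp : b ⊆ p) {A : Form} (h : A ∈ IPC) :
    slash b p A := by
  have hm : ∀ {A}, slash b p A → A ∈ p := fun h => slash_mem hp hbp h
  have hax := hp.axioms
  induction h with
  | mp _ _ ih₁ ih₂ => exact ih₁.2 ih₂
  | ax h =>
    refine (fun (h₁ : slash b p _) => h₁) ?_
    cases h with
    | k A B => exact ⟨hax (.k A B), fun h => ⟨hp.imp_of_mem (hm h), fun _ => h⟩⟩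
    | s A B C =>
      refine ⟨hax (.s A B C), fun h => ⟨hp.mp (hax (.s A B C)) (hm h), fun h' =>
        ⟨hp.mp (hp.mp (hax (.s A B C)) (hm h)) (hm h'), fun hA => (h.2 hA).2 (h'.2 hA)⟩⟩⟩
    | andI A B =>
      exact ⟨hax (.andI A B), fun h => ⟨hp.mp (hax (.andI A B)) (hm h), fun h' => ⟨h, h'⟩⟩⟩
    | andL A B => exact ⟨hax (.andL A B), And.left⟩
    | andR A B => exact ⟨hax (.andR A B), And.right⟩
    | orE A B C =>
      exact ⟨hax (.orE A B C), fun h => ⟨hp.mp (hax (.orE A B C)) (hm h), fun h' =>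
        ⟨hp.mp (hp.mp (hax (.orE A B C)) (hm h)) (hm h'), fun hAB => hAB.elim h.2 h'.2⟩⟩⟩
    | orL A B => exact ⟨hax (.orL A B), Or.inl⟩
    | orR A B => exact ⟨hax (.orR A B), Or.inr⟩
    | exfalso A => exact ⟨hax (.exfalso A), False.elim⟩

/-- The new point is the set of slashed formulas, with `p` the common theory of `ws` and `b` the
part of `Φ` in `atomb` that is true at `w`. For empty `ws`, `p` contains all formulas and the slash
is classical evaluation. -/
theorem gluing_IPC : Gluing {w | IsPrimeTheory IPC w} := by
  intro Φ w ws hw hws hΦ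
  set p : Set Form := {A | ∀ u ∈ ws, A ∈ u} with hp
  set b : Set Form := {A | A ∈ Φ ∧ A ∈ atomb ∧ A ∈ w} with hb
  have hpt : IsTheory p :=
    ⟨fun A hA u hu => (hws u hu).isTheory.ipc hA,
      fun h₁ h₂ u hu => (hws u hu).isTheory.mp (h₁ u hu) (h₂ u hu)⟩
  have hbp : b ⊆ p := fun A hA => hΦ A hA.1 hA.2.1 hA.2.2
  have hs : IPC ⊆ {A | slash b p A} := fun A hA => slash_of_IPC hpt hbp hA
  refine ⟨{A | slash b p A}, ⟨⟨hs, fun h₁ h₂ => h₁.2 h₂⟩, hs, id, fun h => h⟩, ?_,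
    fun u hu A hA => slash_mem hpt hbp hA u hu, fun h₁ h₂ => ⟨h₁, h₂⟩⟩
  intro A hA hAa
  rcases hAa with rfl | ⟨a, rfl⟩ | ⟨B, rfl⟩
  · exact ⟨False.elim, fun h => hw.bot h⟩
  · exact ⟨fun h => h.2.2, fun h => ⟨hA, .inr (.inl ⟨a, rfl⟩), h⟩⟩
  · exact ⟨fun h => h.2.2, fun h => ⟨hA, .inr (.inr ⟨B, rfl⟩), h⟩⟩

/-! ### Theories of nodes of Kripke models -/

namespace KModel

theorem forces_mono (K : KModel) {A : Form} : ∀ {u v : K.W}, K.le u v → K.forces u A →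
    K.forces v A := by
  induction A with
  | bot => exact fun _ h => h
  | atom a => exact fun huv h => K.val_mono _ _ a huv h
  | and A B ihA ihB => exact fun huv h => ⟨ihA huv h.1, ihB huv h.2⟩
  | or A B ihA ihB => exact fun huv h => h.imp (ihA huv) (ihB huv)
  | imp A B _ _ => exact fun huv h x hx => h x (K.le_trans _ _ _ huv hx)
  | box A _ => exact fun huv h x hx => h x (K.le_rel _ _ _ huv hx)

theorem forces_ipc (K : KModel) {A : Form} (h : AxIPC A) : K.Valid A := by
  intro w
  cases h with
  | k A B => exact fun u _ hA v huv _ => K.forces_mono huv hA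
  | s A B C =>
    exact fun u _ h v huv h' x hvx hA =>
      h x (K.le_trans _ _ _ huv hvx) hA x (K.le_refl x) (h' x hvx hA)
  | andI A B => exact fun u _ hA v huv hB => ⟨K.forces_mono huv hA, hB⟩
  | andL A B => exact fun u _ h => h.1
  | andR A B => exact fun u _ h => h.2
  | orE A B C =>
    exact fun u _ h v huv h' x hvx hAB =>
      hAB.elim (h x (K.le_trans _ _ _ huv hvx)) (h' x hvx)
  | orL A B => exact fun u _ h => .inl h
  | orR A B => exact fun u _ h => .inr h
  | exfalso A => exact fun u _ h => h.elim

theorem valid_mp (K : KModel) {A B : Form} (h : K.Valid (.imp A B)) (hA : K.Valid A) :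
    K.Valid B := fun w => h w w (K.le_refl w) (hA w)

theorem valid_of_deriv (K : KModel) {S : Set Form} (h : ∀ A ∈ S, K.Valid A) {A : Form}
    (d : Deriv S A) : K.Valid A := by
  induction d with
  | ax hA => exact h _ hA
  | mp _ _ ih₁ ih₂ => exact K.valid_mp ih₁ ih₂

theorem gen_forces (K : KModel) (w : K.W) {A : Form} :
    ∀ {v : (K.gen w).W}, (K.gen w).forces v A ↔ K.forces v.1 A := by
  induction A with
  | bot => exact Iff.rfl
  | atom a => exact Iff.rfl
  | and A B ihA ihB => exact and_congr ihA ihB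
  | or A B ihA ihB => exact or_congr ihA ihB
  | imp A B ihA ihB =>
    intro v
    constructor
    · intro h u huv hA
      exact (ihB (v := ⟨u, v.2.tail (.inl huv)⟩)).1 (h ⟨u, v.2.tail (.inl huv)⟩ huv (ihA.2 hA))
    · intro h u huv hA
      exact ihB.2 (h u.1 huv (ihA.1 hA))
  | box A ihA =>
    intro v
    constructor
    · intro h u huv
      exact (ihA (v := ⟨u, v.2.tail (.inr huv)⟩)).1 (h ⟨u, v.2.tail (.inr huv)⟩ huv)
    · intro h u huv
      exact ihA.2 (h u.1 huv)

/-- The formulas forced at a node. -/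
def theoryAt (K : KModel) (x : K.W) : Set Form := {A | K.forces x A}

theorem isPrimeTheory_theoryAt (K : KModel) {T : Set Form} (h : ∀ A ∈ T, K.Valid A) (x : K.W) :
    IsPrimeTheory T (K.theoryAt x) where
  isTheory := ⟨fun _ hA => K.valid_of_deriv (fun _ h => K.forces_ipc h) hA x,
    fun h₁ h₂ => h₁ x (K.le_refl x) h₂⟩
  subset _ hA := h _ hA x
  bot h := h
  or h := h

theorem gen_theoryAt (K : KModel) (w : K.W) : (K.gen w).theoryAt (K.gen w).root = K.theoryAt w :=
  Set.ext fun _ => K.gen_forces w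

end KModel

/-! ### Forcing in sums of models. -/

section Sum

variable {m n : ℕ} {K : Fin m → PModel} {K' : Fin n → PModel} {v : Atom → Prop}
  {hv : ∀ a, v a → ∀ i, (K i).val (K i).root a}

theorem sumVariant_forces_left {i : Fin m} {A : Form} : ∀ {w : (K i).W},
    (sumVariant K K' v hv).forces (.left i w) A ↔ (K i).forces w A := by
  induction A with
  | bot => exact Iff.rfl
  | atom a => exact Iff.rfl
  | and A B ihA ihB => exact and_congr ihA ihB
  | or A B ihA ihB => exact or_congr ihA ihB
  | imp A B ihA ihB =>
    intro w
    constructor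
    · exact fun h u hwu hA => ihB.1 (h _ (.left i w u hwu) (ihA.2 hA))
    · intro h u hwu hA
      cases hwu with
      | left _ _ u hwu => exact ihB.2 (h u hwu (ihA.1 hA))
  | box A ihA =>
    intro w
    constructor
    · exact fun h u hwu => ihA.1 (h _ (.left i w u hwu))
    · intro h u hwu
      cases hwu with
      | left _ _ u hwu => exact ihA.2 (h u hwu)

theorem sumVariant_forces_right {j : Fin n} {A : Form} : ∀ {w : (K' j).W},
    (sumVariant K K' v hv).forces (.right j w) A ↔ (K' j).forces w A := by
  induction A with
  | bot => exact Iff.rfl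
  | atom a => exact Iff.rfl
  | and A B ihA ihB => exact and_congr ihA ihB
  | or A B ihA ihB => exact or_congr ihA ihB
  | imp A B ihA ihB =>
    intro w
    constructor
    · exact fun h u hwu hA => ihB.1 (h _ (.right j w u hwu) (ihA.2 hA))
    · intro h u hwu hA
      cases hwu with
      | right _ _ u hwu => exact ihB.2 (h u hwu (ihA.1 hA))
  | box A ihA =>
    intro w
    constructor
    · exact fun h u hwu => ihA.1 (h _ (.right j w u hwu))
    · intro h u hwu
      cases hwu with
      | right _ _ u hwu => exact ihA.2 (h u hwu)

theorem sumVariant_forces_box {A : Form} :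
    (sumVariant K K' v hv).forces .fresh (.box A) ↔
      (∀ i, (K i).forces (K i).root (.box A)) ∧
        ∀ j, (K' j).forces (K' j).root (.and A (.box A)) := by
  constructor
  · refine fun h => ⟨fun i u hu => sumVariant_forces_left.1 (h _ (.belowLeft i u hu)), fun j =>
      ⟨sumVariant_forces_right.1 (h _ (.belowRight j _ (.inl rfl))), fun u hu =>
        sumVariant_forces_right.1 (h _ (.belowRight j u (.inr hu)))⟩⟩
  · rintro ⟨h₁, h₂⟩ u hu
    cases hu with
    | belowLeft i u hu => exact sumVariant_forces_left.2 (h₁ i u hu)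
    | belowRight j u hu =>
      rcases hu with rfl | hu
      · exact sumVariant_forces_right.2 (h₂ j).1
      · exact sumVariant_forces_right.2 ((h₂ j).2 u hu)

theorem sumVariant_valid {A : Form} (h : ∀ i, (K i).Valid A) (h' : ∀ j, (K' j).Valid A)
    (hf : (sumVariant K K' v hv).forces .fresh A) : (sumVariant K K' v hv).Valid A := by
  rintro (_ | ⟨i, w⟩ | ⟨j, w⟩)
  · exact hf
  · exact sumVariant_forces_left.2 (h i w)
  · exact sumVariant_forces_right.2 (h' j w)

theorem sumVariant_forces_imp {A B : Form}
    (h : ∀ i, (K i).forces (K i).root (.imp A B))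
    (hf : (sumVariant K K' v hv).forces .fresh A → (sumVariant K K' v hv).forces .fresh B) :
    (sumVariant K K' v hv).forces .fresh (.imp A B) := by
  intro u hu hA
  cases hu with
  | fresh => exact hf hA
  | below i u hu => exact sumVariant_forces_left.2 (h i u hu (sumVariant_forces_left.1 hA))

end Sum

theorem TypeSigma.isTheory {T : Set Form} (hT : TypeSigma T) : IsTheory T where
  ipc _ h := hT.extends_iK4Ca (h.mono fun _ h => .inl (.inl h))
  mp := hT.mp _ _

theorem TypeSigma.k4ca {T : Set Form} (hT : TypeSigma T) {A : Form} (h : AxK4Ca A) : A ∈ T :=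
  hT.extends_iK4Ca (.ax (.inl (.inr h)))

/-- The theories of the nodes of the members of `M`. -/
def nodeTheories (M : Set PModel) : Set (Set Form) :=
  {w | ∃ K ∈ M, ∃ x : K.W, w = K.theoryAt x}

theorem points_nodeTheories {T : Set Form} {M : Set PModel} (h : SoundComplete T M) :
    Points T (nodeTheories M) where
  complete := fun {A} hA => (h A).2 fun K hK x => hA _ ⟨K, hK, x, rfl⟩
  prime := by
    rintro _ ⟨K, hK, x, rfl⟩
    exact K.isPrimeTheory_theoryAt (fun A hA => (h A).1 hA K hK) x
  imp := by
    rintro _ ⟨K, hK, x, rfl⟩ A B hAB y hxy hA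
    exact hAB _ ⟨K, hK, y, rfl⟩ (fun C hC => K.forces_mono hxy hC) hA

theorem gen_mem {M : Set PModel} (h : IntSubmodelProperty M) {K : PModel} (hK : K ∈ M)
    (x : K.W) : K.toKModel.gen x ∈ M :=
  h K hK K.le K.le_refl K.le_trans (fun _ _ h => h) x

open Classical in
-- The glued point is the fresh root of a sum: the left models realise `ws`, and the right models
-- refute the boxed formulas of `Φ` that fail at `x`. Only finitely many models may be summed, which
-- is why agreement is limited to the finite list `Φ`.
theorem gluing_nodeTheories {T : Set Form} {M : Set PModel} (hT : iK4Ca ⊆ T)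
    (h : SoundComplete T M) (hE : ExtensionProperty M) (hI : IntSubmodelProperty M) :
    Gluing (nodeTheories M) := by
  rintro Φ _ ws ⟨K, hK, x, rfl⟩ hws hΦ
  have hval : ∀ {A}, A ∈ T → ∀ K ∈ M, K.Valid A := fun hA K hK => (h _).1 hA K hK
  have hax : ∀ {A}, AxK4Ca A → A ∈ T := fun hA => hT (.ax (.inl (.inr hA)))
  have hleft : ∀ i : Fin ws.length, ∃ L ∈ M, L.theoryAt L.root = ws.get i := by
    intro i
    obtain ⟨L, hL, y, hy⟩ := hws _ (List.get_mem ws i)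
    exact ⟨L.gen y, gen_mem hI hL y, by rw [hy]; exact L.toKModel.gen_theoryAt y⟩
  choose Ls hLs hLsw using hleft
  -- The boxed formulas of `Φ` false at `x`; each needs a successor of the fresh root as a witness.
  set R := Φ.filter fun A => ∃ D, A = Form.box D ∧ ¬ K.forces x A with hR
  have hright : ∀ j : Fin R.length, ∃ L ∈ M, ∃ D u, R.get j = .box D ∧ K.rel x u ∧
      ¬ K.forces u D ∧ L.theoryAt L.root = K.theoryAt u := by
    intro j
    obtain ⟨D, hD, hn⟩ := of_decide_eq_true (List.mem_filter.1 (List.get_mem R j)).2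
    rw [hD] at hn
    simp only [KModel.forces] at hn
    push Not at hn
    obtain ⟨u, hxu, hu⟩ := hn
    exact ⟨K.gen u, gen_mem hI hK u, D, u, hD, hxu, hu, K.toKModel.gen_theoryAt u⟩
  choose Rs hRs D u hRD hxu hDu hRu using hright
  have hRforce : ∀ {A} j, (Rs j).forces (Rs j).root A ↔ K.forces (u j) A := fun {A} j =>
    Set.ext_iff.1 (hRu j) A
  have hLforce : ∀ {A} i, (Ls i).forces (Ls i).root A ↔ A ∈ ws.get i := fun {A} i =>
    Set.ext_iff.1 (hLsw i) A
  -- Atoms outside `Φ` are made false at the root, since nothing ensures that they hold at the roots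
  -- of the left models.
  set v : Atom → Prop := fun a => Form.atom a ∈ Φ ∧ K.val x a with hv
  have hvL : ∀ a, v a → ∀ i, (Ls i).val (Ls i).root a := fun a ha i =>
    (hLforce (A := .atom a) i).2
      (hΦ (.atom a) ha.1 (.inr (.inl ⟨a, rfl⟩)) ha.2 _ (List.get_mem ws i))
  have hca : ∀ a, ∀ L ∈ M, L.Valid (.imp (.atom a) (.box (.atom a))) := fun a L hL =>
    hval (hax (.ca a)) L hL
  -- The right models come from successors of `x`; the axiom `4` makes them inherit the box as well
  -- as the boxed formula.
  have hboxK : ∀ {A}, K.forces x (.box A) → ∀ j,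
      (Rs j).forces (Rs j).root (.and A (.box A)) := fun {A} hA j =>
    (hRforce j).2 ⟨hA _ (hxu j), hval (hax (.four A)) K hK x x (K.le_refl x) hA _ (hxu j)⟩
  have hmem : sumVariant Ls Rs v hvL ∈ M := by
    refine hE _ _ Ls Rs hLs hRs v hvL fun a => ?_
    refine sumVariant_valid (fun i => hca a _ (hLs i)) (fun j => hca a _ (hRs j)) ?_
    refine sumVariant_forces_imp (fun i => hca a _ (hLs i) _) fun ha => ?_
    have ha' : v a := ha
    refine sumVariant_forces_box.2 ⟨fun i => hca a _ (hLs i) _ _ ((Ls i).le_refl _) (hvL a ha' i),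
      hboxK (hca a K hK x x (K.le_refl x) ha'.2)⟩
  refine ⟨_, ⟨_, hmem, .fresh, rfl⟩, ?_, ?_, ?_⟩
  · intro A hA hAa
    change (sumVariant Ls Rs v hvL).forces .fresh A ↔ K.forces x A
    rcases hAa with rfl | ⟨a, rfl⟩ | ⟨C, rfl⟩
    · exact Iff.rfl
    · exact ⟨fun h => h.2, fun h => ⟨hA, h⟩⟩
    · refine sumVariant_forces_box.trans ⟨fun hC => ?_, fun hC => ?_⟩
      · by_contra hn
        obtain ⟨j, hj⟩ := List.get_of_mem
          (show Form.box C ∈ R from List.mem_filter.2 ⟨hA, decide_eq_true ⟨C, rfl, hn⟩⟩)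
        have hCD : C = D j := Form.box.inj (hj.symm.trans (hRD j))
        subst hCD
        exact hDu j ((hRforce j).1 (hC.2 j).1)
      · exact ⟨fun i => (hLforce i).2
          (hΦ _ hA (.inr (.inr ⟨C, rfl⟩)) hC _ (List.get_mem ws i)), hboxK hC⟩
  · intro w hw A hA
    obtain ⟨i, rfl⟩ := List.get_of_mem hw
    exact (hLforce i).1 (sumVariant_forces_left.1
      ((sumVariant Ls Rs v hvL).forces_mono
        (SumLe.below (K := Ls) (K' := Rs) i _ ((Ls i).le_refl _)) hA))
  · intro A B h₁ h₂
    exact sumVariant_forces_imp (fun i => (hLforce i).2 (h₁ _ (List.get_mem ws i))) h₂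

/-! ### The translation and `SNNIL` -/

@[simp] theorem bot_mem_atomb : Form.bot ∈ atomb := .inl rfl

@[simp] theorem atom_mem_atomb (a : Atom) : Form.atom a ∈ atomb := .inr (.inl ⟨a, rfl⟩)

@[simp] theorem box_mem_atomb (A : Form) : Form.box A ∈ atomb := .inr (.inr ⟨A, rfl⟩)

@[simp] theorem and_notMem_atomb (A B : Form) : Form.and A B ∉ atomb := by simp [atomb]

@[simp] theorem or_notMem_atomb (A B : Form) : Form.or A B ∉ atomb := by simp [atomb]

@[simp] theorem imp_notMem_atomb (A B : Form) : Form.imp A B ∉ atomb := by simp [atomb]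

theorem isNNIL_and_iff {A B : Form} : IsNNIL (.and A B) ↔ IsNNIL A ∧ IsNNIL B :=
  ⟨fun h => by
    cases h with
    | base h => simp at h
    | and hA hB => exact ⟨hA, hB⟩, fun h => .and h.1 h.2⟩

theorem isNNIL_or_iff {A B : Form} : IsNNIL (.or A B) ↔ IsNNIL A ∧ IsNNIL B :=
  ⟨fun h => by
    cases h with
    | base h => simp at h
    | or hA hB => exact ⟨hA, hB⟩, fun h => .or h.1 h.2⟩

theorem isNNIL_imp_iff {A B : Form} : IsNNIL (.imp A B) ↔ NI A ∧ IsNNIL B :=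
  ⟨fun h => by
    cases h with
    | base h => simp at h
    | imp hA hB => exact ⟨hA, hB⟩, fun h => .imp h.1 h.2⟩

theorem NI.boxTr {N : Form} (h : NI N) : NI (boxTr N) := by
  induction h with
  | base hA =>
    rcases hA with rfl | ⟨_ | _, rfl⟩ | ⟨B, rfl⟩
    · exact .base bot_mem_atomb
    · exact .and (.base (atom_mem_atomb _)) (.base (box_mem_atomb _))
    · exact .base (atom_mem_atomb _)
    · exact .base (box_mem_atomb _)
  | and _ _ ih₁ ih₂ => exact .and ih₁ ih₂
  | or _ _ ih₁ ih₂ => exact .or ih₁ ih₂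

theorem NI.isNNIL {N : Form} (h : NI N) : IsNNIL N := by
  induction h with
  | base hA => exact .base hA
  | and _ _ ih₁ ih₂ => exact .and ih₁ ih₂
  | or _ _ ih₁ ih₂ => exact .or ih₁ ih₂

theorem IsNNIL.boxTr {E : Form} (h : IsNNIL E) : IsNNIL (boxTr E) := by
  induction h with
  | base hA => exact (NI.boxTr (.base hA)).isNNIL
  | and _ _ ih₁ ih₂ => exact .and ih₁ ih₂
  | or _ _ ih₁ ih₂ => exact .or ih₁ ih₂
  | imp hN _ ih => exact .and (.imp hN.boxTr ih) (.base (by simp))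

theorem boxTr_mem_SNNIL {E : Form} (h : IsNNIL E) : boxTr E ∈ SNNIL := ⟨⟨E, rfl⟩, h.boxTr⟩

theorem SNNIL_and {A B : Form} (hA : A ∈ SNNIL) (hB : B ∈ SNNIL) : Form.and A B ∈ SNNIL := by
  obtain ⟨⟨A, rfl⟩, hA⟩ := hA
  obtain ⟨⟨B, rfl⟩, hB⟩ := hB
  exact ⟨⟨.and A B, rfl⟩, .and hA hB⟩

section

variable {T : Set Form} {P : Set (Set Form)} {Φ : List Form} {w : Set Form}

/-- As for `NNIL`, except that a translated implication carries a box. When its antecedent is true,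
the lower bound of the consequent is conjoined with that box, which is itself in `SNNIL`. -/
theorem exists_inherited_snnil (hP : Points T P) (hw : w ∈ P) {F : Form} (hF : IsNNIL (boxTr F))
    (hΦ : outer (boxTr F) ⊆ Φ) (h : boxTr F ∈ w) :
    ∃ G ∈ SNNIL, G ∈ w ∧ Form.imp G (boxTr F) ∈ T ∧ Inherited P Φ w G := by
  have hwp := hP.prime hw
  simp only [hP.imp_mem_iff]
  induction F with
  | bot => exact absurd h hwp.bot
  | atom a =>
    refine ⟨_, ⟨⟨_, rfl⟩, hF⟩, h, fun _ _ h => h, ?_⟩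
    cases a with
    | var n =>
      simp only [boxTr, boxdot, outer, List.cons_append, List.nil_append, List.cons_subset] at hΦ
      have h' := hwp.isTheory.and_iff.1 h
      exact (Inherited.of_atomb (by simp) hΦ.1 h'.1).and hP (.of_atomb (by simp) hΦ.2.1 h'.2)
    | par n => exact .of_atomb (by simp [boxTr]) (hΦ (by simp [boxTr, outer])) h
  | box A _ =>
    exact ⟨_, ⟨⟨.box A, rfl⟩, hF⟩, h, fun _ _ h => h,
      .of_atomb (by simp [boxTr]) (hΦ (by simp [boxTr, outer])) h⟩
  | and A B ihA ihB =>
    rw [boxTr, outer, List.append_subset] at hΦ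
    rw [boxTr, isNNIL_and_iff] at hF
    rw [boxTr, hwp.isTheory.and_iff] at h
    obtain ⟨G₁, a1, a2, a3, a4⟩ := ihA hF.1 hΦ.1 h.1
    obtain ⟨G₂, b1, b2, b3, b4⟩ := ihB hF.2 hΦ.2 h.2
    refine ⟨.and G₁ G₂, SNNIL_and a1 b1, hwp.isTheory.and_iff.2 ⟨a2, b2⟩, fun u hu h => ?_,
      a4.and hP b4⟩
    have hut := (hP.prime hu).isTheory
    rw [hut.and_iff] at h
    exact hut.and_iff.2 ⟨a3 u hu h.1, b3 u hu h.2⟩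
  | or A B ihA ihB =>
    rw [boxTr, outer, List.append_subset] at hΦ
    rw [boxTr, isNNIL_or_iff] at hF
    rcases hwp.or h with h | h
    · obtain ⟨G, a1, a2, a3, a4⟩ := ihA hF.1 hΦ.1 h
      exact ⟨G, a1, a2, fun u hu h => (hP.prime hu).isTheory.or_left (a3 u hu h), a4⟩
    · obtain ⟨G, a1, a2, a3, a4⟩ := ihB hF.2 hΦ.2 h
      exact ⟨G, a1, a2, fun u hu h => (hP.prime hu).isTheory.or_right (a3 u hu h), a4⟩
  | imp A B _ ihB =>
    have hF' := hF
    have h' := h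
    rw [boxTr, boxdot, outer, List.append_subset, outer, List.append_subset] at hΦ
    rw [boxTr, boxdot, isNNIL_and_iff, isNNIL_imp_iff] at hF'
    rw [boxTr, boxdot, hwp.isTheory.and_iff] at h'
    have hbox : Inherited P Φ w (.box (.imp (boxTr A) (boxTr B))) :=
      .of_atomb (by simp) (hΦ.2 (by simp [outer])) h'.2
    by_cases hA : boxTr A ∈ w
    · obtain ⟨G, a1, a2, a3, a4⟩ := ihB hF'.1.2 hΦ.1.2 (hwp.isTheory.mp h'.1 hA)
      refine ⟨.and G (.box (.imp (boxTr A) (boxTr B))),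
        SNNIL_and a1 ⟨⟨.box _, rfl⟩, .base (by simp)⟩, hwp.isTheory.and_iff.2 ⟨a2, h'.2⟩,
        fun u hu h => ?_, a4.and hP hbox⟩
      have hut := (hP.prime hu).isTheory
      rw [hut.and_iff] at h
      exact hut.and_iff.2 ⟨hut.imp_of_mem (a3 u hu h.1), h.2⟩
    · exact ⟨_, ⟨⟨.imp A B, rfl⟩, hF⟩, h, fun _ _ h => h,
        (Inherited.imp hP hw hF'.1.1 hΦ.1.1 hA).and hP hbox⟩

end

namespace TypeSigma

variable {T : Set Form}

theorem box_mp (hT : TypeSigma T) {w : Set Form} (hw : IsTheory w) (hTw : T ⊆ w) {A B : Form}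
    (h : imp A B ∈ T) (hA : box A ∈ w) : box B ∈ w :=
  hw.mp (hw.mp (hTw (hT.k4ca (.k A B))) (hTw (hT.nec _ h))) hA

theorem box_and (hT : TypeSigma T) {w : Set Form} (hw : IsTheory w) (hTw : T ⊆ w) {A B : Form}
    (hA : box A ∈ w) (hB : box B ∈ w) : box (.and A B) ∈ w :=
  hw.mp (hw.mp (hTw (hT.k4ca (.k B _)))
    (hT.box_mp hw hTw (hT.isTheory.axioms (.andI A B)) hA)) hB

theorem box_boxdot (hT : TypeSigma T) {w : Set Form} (hw : IsTheory w) (hTw : T ⊆ w) {A : Form}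
    (hA : box A ∈ w) : box (boxdot A) ∈ w :=
  hT.box_and hw hTw hA (hw.mp (hTw (hT.k4ca (.four A))) hA)

/-- Self-complete formulas imply their own boxes. -/
theorem box_boxTr (hT : TypeSigma T) {w : Set Form} (hw : IsPrimeTheory T w) {A : Form}
    (h : boxTr A ∈ w) : box (boxTr A) ∈ w := by
  have ht := hw.isTheory
  induction A with
  | bot => exact absurd h hw.bot
  | atom a =>
    cases a with
    | var n => exact hT.box_boxdot ht hw.subset (ht.and_iff.1 h).2
    | par n => exact ht.mp (hw.subset (hT.k4ca (.ca _))) h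
  | and A B ihA ihB =>
    have h := ht.and_iff.1 h
    exact hT.box_and ht hw.subset (ihA h.1) (ihB h.2)
  | or A B ihA ihB =>
    rcases hw.or h with h | h
    · exact hT.box_mp ht hw.subset (hT.isTheory.axioms (.orL _ _)) (ihA h)
    · exact hT.box_mp ht hw.subset (hT.isTheory.axioms (.orR _ _)) (ihB h)
  | imp A B _ _ => exact hT.box_boxdot ht hw.subset (ht.and_iff.1 h).2
  | box A _ => exact ht.mp (hw.subset (hT.k4ca (.four A))) h

/-- The only real case is a variable `x`, where the axiom `C_a` makes `x` and `⊡x` equivalent. -/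
theorem boxTr_iff_of_atomb (hT : TypeSigma T) {w : Set Form} (hw : IsPrimeTheory T w) {A : Form}
    (hA : A ∈ atomb) : boxTr A ∈ w ↔ A ∈ w := by
  rcases hA with rfl | ⟨_ | _, rfl⟩ | ⟨B, rfl⟩
  · exact Iff.rfl
  · refine hw.isTheory.and_iff.trans ⟨And.left, fun h => ⟨h, ?_⟩⟩
    exact hw.isTheory.mp (hw.subset (hT.k4ca (.ca _))) h
  · exact Iff.rfl
  · exact Iff.rfl

theorem boxTr_iff_of_ni (hT : TypeSigma T) {w : Set Form} (hw : IsPrimeTheory T w) {N : Form}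
    (hN : NI N) : boxTr N ∈ w ↔ N ∈ w := by
  induction hN with
  | base hA => exact hT.boxTr_iff_of_atomb hw hA
  | and _ _ ih₁ ih₂ => rw [boxTr, hw.isTheory.and_iff, hw.isTheory.and_iff, ih₁, ih₂]
  | or _ _ ih₁ ih₂ => rw [boxTr, hw.or_iff, hw.or_iff, ih₁, ih₂]

theorem of_boxTr_mem (hT : TypeSigma T) {E : Form} (hE : IsNNIL E) :
    ∀ {w : Set Form}, IsPrimeTheory T w → boxTr E ∈ w → E ∈ w := by
  induction hE with
  | base hA => exact fun hw h => (hT.boxTr_iff_of_atomb hw hA).1 h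
  | and _ _ ih₁ ih₂ =>
    intro w hw h
    rw [boxTr, hw.isTheory.and_iff] at h
    exact hw.isTheory.and_iff.2 ⟨ih₁ hw h.1, ih₂ hw h.2⟩
  | or _ _ ih₁ ih₂ =>
    intro w hw h
    exact hw.or_iff.2 ((hw.or h).imp (ih₁ hw) (ih₂ hw))
  | imp hN _ ih =>
    intro w hw h
    rw [boxTr, boxdot, hw.isTheory.and_iff] at h
    refine (points_isPrimeTheory hT.isTheory).imp hw fun u hu hwu hNu => ih hu ?_
    exact hu.isTheory.mp (hwu h.1) ((hT.boxTr_iff_of_ni hu hN).2 hNu)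

theorem imp_boxTr_self (hT : TypeSigma T) {E : Form} (hE : IsNNIL E) : imp (boxTr E) E ∈ T :=
  hT.isTheory.imp_mem_iff.2 fun _ hw h => hT.of_boxTr_mem hE hw h

theorem exists_points (hT : TypeSigma T) : ∃ P, Points T P ∧ Gluing P := by
  obtain ⟨M, -, hM, hE, hI⟩ := hT.exists_class
  exact ⟨_, points_nodeTheories hM, gluing_nodeTheories hT.extends_iK4Ca hM hE hI⟩

/-- A bare variable is not self-complete, so the true members of `atomb` are conjoined in translated
form. -/
theorem exists_prime_snnil (hT : TypeSigma T) {P : Set (Set Form)} (hP : Points T P)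
    (hG : Gluing P) {E : Form} (hE : E ∈ SNNIL) {w : Set Form} (hw : w ∈ P) (h : E ∈ w) :
    ∃ G ∈ SNNIL, G ∈ w ∧ imp G E ∈ T ∧ G ∈ PrimeForm T := by
  obtain ⟨⟨F, rfl⟩, hF⟩ := hE
  exact exists_prime_of_inherited hP hG (fun _ hA _ hB => SNNIL_and hA hB)
    (fun A hA => ⟨boxTr A, boxTr_mem_SNNIL (.base hA), fun u hu =>
      hT.boxTr_iff_of_atomb (hP.prime hu) hA⟩) hw
    (exists_inherited_snnil hP hw hF (List.Subset.refl _) h)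

/-- `AR⁺_T(atomb)` is sound for `SNNIL`-preservativity. -/
theorem pres_of_arPlus (hT : TypeSigma T) {A B : Form} (h : ARPlus T atomb A B) :
    Pres T SNNIL A B := by
  obtain ⟨P, hP, hG⟩ := hT.exists_points
  induction h with
  | ax h =>
    intro E _ hE
    rw [hP.imp_mem_iff] at *
    exact fun w hw hEw => h w hw (hE w hw hEw)
  | conj _ _ ih₁ ih₂ =>
    intro E hE h
    have h₁ := ih₁ E hE h
    have h₂ := ih₂ E hE h
    rw [hP.imp_mem_iff] at *
    exact fun w hw hEw => (hP.prime hw).isTheory.and_iff.2 ⟨h₁ w hw hEw, h₂ w hw hEw⟩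
  | cut _ _ ih₁ ih₂ => exact fun E hE h => ih₂ E hE (ih₁ E hE h)
  | disj _ _ ih₁ ih₂ =>
    exact pres_or hP (fun E hE w hw h => hT.exists_prime_snnil hP hG hE hw h) ih₁ ih₂
  | @mont A B C hC _ ih =>
    intro E hE h
    -- The premise `C` is moved into the test formula, in translated form so that the conjunction
    -- stays in `SNNIL`.
    have h₁ := ih (.and E (boxTr C)) (SNNIL_and hE (boxTr_mem_SNNIL (.base hC)))
    rw [hP.imp_mem_iff] at *
    rw [hP.imp_mem_iff] at h₁
    intro w hw hEw
    refine hP.imp hw fun u hu hwu hCu => h₁ ?_ u hu ((hP.prime hu).isTheory.and_iff.2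
      ⟨hwu hEw, (hT.boxTr_iff_of_atomb (hP.prime hu) hC).2 hCu⟩)
    intro x hx hEC
    rw [(hP.prime hx).isTheory.and_iff, hT.boxTr_iff_of_atomb (hP.prime hx) hC] at hEC
    exact (hP.prime hx).isTheory.mp (h x hx hEC.1) hEC.2
  | visser ps cs => exact fun E hE h => visser_sound hP hG hE.2 h
  | le A =>
    rintro _ ⟨⟨E, rfl⟩, -⟩ h
    rw [hP.imp_mem_iff]
    exact fun w hw hEw => hT.box_mp (hP.prime hw).isTheory (hP.prime hw).subset h
      (hT.box_boxTr (hP.prime hw) hEw)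

end TypeSigma

/-! ### From `NNIL` to `SNNIL` inside `AR⁺` -/

namespace ARPlus

variable {T : Set Form} {A B : Form}

theorem of_imp (hT : IsTheory T) (h : ∀ w, IsPrimeTheory T w → A ∈ w → B ∈ w) :
    ARPlus T atomb A B := .ax (hT.imp_mem_iff.2 h)

theorem and (hT : IsTheory T) {A' B' : Form} (h : ARPlus T atomb A A')
    (h' : ARPlus T atomb B B') : ARPlus T atomb (.and A B) (.and A' B') :=
  .conj (.cut (.ax (hT.axioms (.andL A B))) h) (.cut (.ax (hT.axioms (.andR A B))) h')

theorem or (hT : IsTheory T) {A' B' : Form} (h : ARPlus T atomb A A')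
    (h' : ARPlus T atomb B B') : ARPlus T atomb (.or A B) (.or A' B') :=
  .disj (.cut h (.ax (hT.axioms (.orL A' B')))) (.cut h' (.ax (hT.axioms (.orR A' B'))))

theorem refl (hT : IsTheory T) (A : Form) : ARPlus T atomb A A := of_imp hT fun _ _ h => h

/-- The rule for premises in `atomb` extends to `NI`: currying handles conjunctions, and splitting
into two implications handles disjunctions. -/
theorem mont_ni (hT : IsTheory T) {N : Form} (hN : NI N) (h : ARPlus T atomb A B) :
    ARPlus T atomb (.imp N A) (.imp N B) := by
  have hP := points_isPrimeTheory hT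
  induction hN generalizing A B with
  | base hN => exact .mont hN h
  | @and N₁ N₂ _ _ ih₁ ih₂ =>
    refine .cut (.cut (of_imp hT ?_) (ih₁ (ih₂ h))) (of_imp hT ?_)
    · intro w hw h
      refine hP.imp hw fun u hu hwu h₁ => hP.imp hu fun v hv huv h₂ => ?_
      exact hv.isTheory.mp (huv (hwu h)) (hv.isTheory.and_iff.2 ⟨huv h₁, h₂⟩)
    · intro w hw h
      refine hP.imp hw fun u hu hwu h₁ => ?_
      have h₂ := hu.isTheory.and_iff.1 h₁
      exact hu.isTheory.mp (hu.isTheory.mp (hwu h) h₂.1) h₂.2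
  | @or N₁ N₂ _ _ ih₁ ih₂ =>
    refine .cut (.cut (of_imp hT ?_) (.and hT (ih₁ h) (ih₂ h))) (of_imp hT ?_)
    · intro w hw h
      exact hw.isTheory.and_iff.2
        ⟨hP.imp hw fun u hu hwu h₁ => hu.isTheory.mp (hwu h) (hu.isTheory.or_left h₁),
          hP.imp hw fun u hu hwu h₁ => hu.isTheory.mp (hwu h) (hu.isTheory.or_right h₁)⟩
    · intro w hw h
      rw [hw.isTheory.and_iff] at h
      exact hP.imp hw fun u hu hwu h₁ => (hu.or h₁).elim
        (fun h₁ => hu.isTheory.mp (hwu h.1) h₁) (fun h₁ => hu.isTheory.mp (hwu h.2) h₁)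

/-- For an implication, the consequent is translated under an `NI` premise, the antecedent is
replaced by its equivalent translation, and the axiom `A ▷ □A` supplies the outer box. -/
theorem boxTr (hT : TypeSigma T) {E : Form} (hE : IsNNIL E) :
    ARPlus T atomb E (SNNILPres.boxTr E) := by
  have ht := hT.isTheory
  induction hE with
  | base hA => exact of_imp ht fun w hw => (hT.boxTr_iff_of_atomb hw hA).2
  | and _ _ ih₁ ih₂ => exact .and ht ih₁ ih₂
  | or _ _ ih₁ ih₂ => exact .or ht ih₁ ih₂
  | @imp N D hN _ ih =>
    refine .cut (mont_ni ht hN ih) (.cut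
      (of_imp (B := .imp (SNNILPres.boxTr N) (SNNILPres.boxTr D)) ht ?_)
      (.conj (.refl ht _) (.le _)))
    exact fun w hw h => (points_isPrimeTheory ht).imp hw fun u hu hwu h₁ =>
      hu.isTheory.mp (hwu h) ((hT.boxTr_iff_of_ni hu hN).1 h₁)

end ARPlus

/-! ### Visser's `NNIL` approximation -/

/-- `Approx A D`: the `NNIL` formula `D` is obtained from `A` by steps that preserve being a
greatest lower bound. -/
inductive Approx : Form → Form → Prop
  | base {A : Form} : A ∈ atomb → Approx A A
  | and {A B D E : Form} : Approx A D → Approx B E → Approx (.and A B) (.and D E)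
  | or {A B D E : Form} : Approx A D → Approx B E → Approx (.or A B) (.or D E)
  | imp {A D C : Form} : C ∈ atomb → Approx A D → Approx (.imp C A) (.imp C D)
  | congr {A A' D : Form} : Approx A D →
      Form.and (.imp A A') (.imp A' A) ∈ IPC → Approx A' D
  | visser {ps : List (Form × Form)} {cs : List Form} {D : Form} :
      Approx (.and (visserConcl ps cs) (visserPrem ps cs)) D → Approx (visserPrem ps cs) D

namespace Approx

theorem isNNIL {A D : Form} (h : Approx A D) : IsNNIL D := by
  induction h with
  | base h => exact .base h
  | and _ _ ih₁ ih₂ => exact .and ih₁ ih₂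
  | or _ _ ih₁ ih₂ => exact .or ih₁ ih₂
  | imp hC _ ih => exact .imp (.base hC) ih
  | congr _ _ ih => exact ih
  | visser _ ih => exact ih

theorem imp_mem {A D : Form} (h : Approx A D) : Form.imp D A ∈ IPC := by
  have hP := points_isPrimeTheory isTheory_IPC
  induction h with
  | base h => exact hP.imp_mem_iff.2 fun _ _ h => h
  | and _ _ ih₁ ih₂ =>
    rw [hP.imp_mem_iff] at *
    intro w hw h
    rw [hw.isTheory.and_iff] at *
    exact ⟨ih₁ w hw h.1, ih₂ w hw h.2⟩
  | or _ _ ih₁ ih₂ =>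
    rw [hP.imp_mem_iff] at *
    intro w hw h
    rw [hw.or_iff] at *
    exact h.imp (ih₁ w hw) (ih₂ w hw)
  | imp hC _ ih =>
    rw [hP.imp_mem_iff] at *
    intro w hw h
    exact hP.imp hw fun u hu hwu hCu => ih u hu (hu.isTheory.mp (hwu h) hCu)
  | congr _ h ih =>
    have h' := (isTheory_IPC.and_iff.1 h).1
    rw [hP.imp_mem_iff] at *
    exact fun w hw hD => h' w hw (ih w hw hD)
  | visser _ ih =>
    rw [hP.imp_mem_iff] at *
    exact fun w hw hD => (hw.isTheory.and_iff.1 (ih w hw hD)).2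

theorem arPlus {T : Set Form} (hT : IsTheory T) {A D : Form} (h : Approx A D) :
    ARPlus T atomb A D := by
  induction h with
  | base h => exact .refl hT _
  | and _ _ ih₁ ih₂ => exact .and hT ih₁ ih₂
  | or _ _ ih₁ ih₂ => exact .or hT ih₁ ih₂
  | imp hC _ ih => exact .mont hC ih
  | congr _ h ih => exact .cut (.ax (hT.ipc (isTheory_IPC.and_iff.1 h).2)) ih
  | visser _ ih => exact .cut (.conj (.visser _ _) (.refl hT _)) ih

/-- Soundness of `AR⁺` repeated with `IPC` and `NNIL` in place of `T` and `SNNIL`: the step for `or`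
uses prime lower bounds, the step for `imp` moves the premise into the test formula, and `visser`
uses gluing for `IPC`. -/
theorem pres {A D : Form} (h : Approx A D) : Pres IPC NNIL A D := by
  have hP := points_isPrimeTheory isTheory_IPC
  induction h with
  | base _ => exact fun _ _ h => h
  | and _ _ ih₁ ih₂ =>
    intro E hE h
    have h₁ := ih₁ E hE
    have h₂ := ih₂ E hE
    rw [hP.imp_mem_iff] at *
    rw [hP.imp_mem_iff] at h₁ h₂
    intro w hw hEw
    exact hw.isTheory.and_iff.2
      ⟨h₁ (fun u hu h' => (hu.isTheory.and_iff.1 (h u hu h')).1) w hw hEw,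
       h₂ (fun u hu h' => (hu.isTheory.and_iff.1 (h u hu h')).2) w hw hEw⟩
  | or _ _ ih₁ ih₂ =>
    refine pres_or hP (fun E hE w hw h => exists_prime_nnil hP gluing_IPC hw hE h) ?_ ?_
    · intro E hE h
      have := ih₁ E hE h
      rw [hP.imp_mem_iff] at *
      exact fun w hw h => hw.isTheory.or_left (this w hw h)
    · intro E hE h
      have := ih₂ E hE h
      rw [hP.imp_mem_iff] at *
      exact fun w hw h => hw.isTheory.or_right (this w hw h)
  | @imp A D C hC _ ih =>
    intro E hE h
    have h₁ := ih (.and E C) (.and hE (.base hC))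
    rw [hP.imp_mem_iff] at *
    rw [hP.imp_mem_iff] at h₁
    intro w hw hEw
    refine hP.imp hw fun u hu hwu hCu => h₁ ?_ u hu (hu.isTheory.and_iff.2 ⟨hwu hEw, hCu⟩)
    intro x hx hEC
    rw [hx.isTheory.and_iff] at hEC
    exact hx.isTheory.mp (h x hx hEC.1) hEC.2
  | congr _ h ih =>
    intro E hE h'
    refine ih E hE ?_
    have h₂ := (isTheory_IPC.and_iff.1 h).2
    rw [hP.imp_mem_iff] at *
    exact fun w hw hEw => h₂ w hw (h' w hw hEw)
  | visser _ ih =>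
    intro E hE h
    refine ih E hE ?_
    have h' := visser_sound hP gluing_IPC hE h
    rw [hP.imp_mem_iff] at *
    exact fun w hw hEw => hw.isTheory.and_iff.2 ⟨h' w hw hEw, h w hw hEw⟩

theorem isGlb {A D : Form} (h : Approx A D) : IsGlb NNIL IPC A D :=
  ⟨⟨h.isNNIL, h.imp_mem⟩, fun E hE hEA => h.pres E hE hEA⟩

end Approx

/-! ### Every formula has an approximation -/

/-- `A` has an approximation. -/
def HasApprox (A : Form) : Prop := ∃ D, Approx A D

theorem HasApprox.congr {A A' : Form} (h : HasApprox A)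
    (h' : ∀ w, IsPrimeTheory IPC w → (A ∈ w ↔ A' ∈ w)) : HasApprox A' := by
  obtain ⟨D, hD⟩ := h
  exact ⟨D, hD.congr (isTheory_IPC.and_iff.2
    ⟨isTheory_IPC.imp_mem_iff.2 fun w hw => (h' w hw).1,
     isTheory_IPC.imp_mem_iff.2 fun w hw => (h' w hw).2⟩)⟩

theorem HasApprox.and {A B : Form} (hA : HasApprox A) (hB : HasApprox B) :
    HasApprox (.and A B) := by
  obtain ⟨D, hD⟩ := hA
  obtain ⟨E, hE⟩ := hB
  exact ⟨_, hD.and hE⟩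

theorem HasApprox.or {A B : Form} (hA : HasApprox A) (hB : HasApprox B) :
    HasApprox (.or A B) := by
  obtain ⟨D, hD⟩ := hA
  obtain ⟨E, hE⟩ := hB
  exact ⟨_, hD.or hE⟩

theorem HasApprox.imp {A C : Form} (hC : C ∈ atomb) (hA : HasApprox A) :
    HasApprox (.imp C A) := by
  obtain ⟨D, hD⟩ := hA
  exact ⟨_, hD.imp hC⟩

theorem HasApprox.conj : ∀ {l : List Form}, (∀ A ∈ l, HasApprox A) → HasApprox (Form.conj l)
  | [], _ => .imp bot_mem_atomb ⟨_, .base bot_mem_atomb⟩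
  | [A], h => h A (List.mem_singleton_self A)
  | A :: B :: l, h => .and (h A List.mem_cons_self)
    (HasApprox.conj (l := B :: l) fun C hC => h C (List.mem_cons_of_mem _ hC))

theorem HasApprox.disj : ∀ {l : List Form}, (∀ A ∈ l, HasApprox A) → HasApprox (Form.disj l)
  | [], _ => ⟨_, .base bot_mem_atomb⟩
  | [A], h => h A (List.mem_singleton_self A)
  | A :: B :: l, h => .or (h A List.mem_cons_self)
    (HasApprox.disj (l := B :: l) fun C hC => h C (List.mem_cons_of_mem _ hC))

/-- The formula expressing the sequent `X ⇒ Y`. -/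
def seq (X Y : List Form) : Form := .imp (Form.conj X) (Form.disj Y)

/-- The sequent `X ⇒ Y` holds at `u`. -/
def SeqAt (u : Set Form) (X Y : List Form) : Prop := (∀ A ∈ X, A ∈ u) → ∃ B ∈ Y, B ∈ u

theorem seq_mem_iff {w : Set Form} (hw : IsPrimeTheory IPC w) {X Y : List Form} :
    seq X Y ∈ w ↔ ∀ u, IsPrimeTheory IPC u → w ⊆ u → SeqAt u X Y := by
  rw [seq, (points_isPrimeTheory isTheory_IPC).imp_iff hw]
  refine forall_congr' fun u => forall_congr' fun hu => forall_congr' fun _ => ?_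
  rw [hu.isTheory.conj_iff, hu.disj_iff, SeqAt]

theorem HasApprox.seq_congr {X Y X' Y' : List Form} (h : HasApprox (seq X Y))
    (h' : ∀ u, IsPrimeTheory IPC u → (SeqAt u X Y ↔ SeqAt u X' Y')) : HasApprox (seq X' Y') := by
  refine h.congr fun w hw => ?_
  rw [seq_mem_iff hw, seq_mem_iff hw]
  exact forall_congr' fun u => forall_congr' fun hu => imp_congr_right fun _ => h' u hu

theorem HasApprox.seq_congr₂ {X Y X₁ Y₁ X₂ Y₂ : List Form} (h₁ : HasApprox (seq X₁ Y₁))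
    (h₂ : HasApprox (seq X₂ Y₂))
    (h' : ∀ u, IsPrimeTheory IPC u → (SeqAt u X Y ↔ SeqAt u X₁ Y₁ ∧ SeqAt u X₂ Y₂)) :
    HasApprox (seq X Y) := by
  refine (h₁.and h₂).congr fun w hw => ?_
  rw [hw.isTheory.and_iff, seq_mem_iff hw, seq_mem_iff hw, seq_mem_iff hw]
  constructor
  · exact fun h u hu hwu => (h' u hu).2 ⟨h.1 u hu hwu, h.2 u hu hwu⟩
  · exact fun h => ⟨fun u hu hwu => ((h' u hu).1 (h u hu hwu)).1,
      fun u hu hwu => ((h' u hu).1 (h u hu hwu)).2⟩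

/-- The weight of a formula, with members of `atomb` as atoms. -/
def weight : Form → ℕ
  | .bot => 1
  | .atom _ => 1
  -- The larger increment for conjunction makes `(A ∧ B) → F` heavier than `A → (B → F)`.
  | .and A B => weight A + weight B + 2
  | .or A B => weight A + weight B + 1
  | .imp A B => weight A + weight B + 1
  | .box _ => 1

theorem weight_pos (A : Form) : 1 ≤ weight A := by
  cases A <;> simp [weight]

/-- A measure on lists that decreases when a formula is replaced by three lighter ones. -/
def listWeight (l : List Form) : ℕ := (l.map fun A => 4 ^ weight A).sum

@[simp] theorem listWeight_nil : listWeight [] = 0 := rfl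

@[simp] theorem listWeight_cons (A : Form) (l : List Form) :
    listWeight (A :: l) = 4 ^ weight A + listWeight l := by simp [listWeight]

@[simp] theorem listWeight_append (l l' : List Form) :
    listWeight (l ++ l') = listWeight l + listWeight l' := by simp [listWeight]

theorem listWeight_perm {l l' : List Form} (h : l.Perm l') : listWeight l = listWeight l' :=
  (h.map _).sum_eq

/-- Base `4` leaves room for three lighter formulas, the most that any step below needs. -/
theorem four_pow_add_lt {a b c d : ℕ} (ha : a < d) (hb : b < d) (hc : c < d) :
    4 ^ a + 4 ^ b + 4 ^ c < 4 ^ d ∧ 0 < 4 ^ a ∧ 0 < 4 ^ b ∧ 0 < 4 ^ c := by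
  refine ⟨?_, by positivity, by positivity, by positivity⟩
  obtain ⟨e, rfl⟩ : ∃ e, d = e + 1 := ⟨d - 1, by omega⟩
  have h : ∀ x, x < e + 1 → 4 ^ x ≤ 4 ^ e := fun x hx =>
    Nat.pow_le_pow_right (by norm_num) (by omega)
  have := h a ha
  have := h b hb
  have := h c hc
  have : 0 < 4 ^ e := by positivity
  rw [pow_succ]
  omega

theorem le_listWeight {A : Form} {l : List Form} (h : A ∈ l) : 4 ^ weight A ≤ listWeight l := by
  obtain ⟨s, t, rfl⟩ := List.append_of_mem h
  simp only [listWeight_append, listWeight_cons]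
  omega

/-! ### Reduction steps for sequents. -/

section Step

variable {X Y : List Form}

theorem hasApprox_of_left_and {s t : List Form} {A B : Form}
    (ih : ∀ X' Y', listWeight X' + listWeight Y' < listWeight (s ++ .and A B :: t) + listWeight Y →
      HasApprox (seq X' Y')) : HasApprox (seq (s ++ .and A B :: t) Y) := by
  have := four_pow_add_lt (a := weight A) (b := weight B) (c := weight B)
    (d := weight (.and A B)) (by rw [weight]; omega) (by rw [weight]; omega)
    (by rw [weight]; omega)
  refine (ih (A :: B :: (s ++ t)) Y ?_).seq_congr fun u hu => ?_
  · simp only [listWeight_append, listWeight_cons]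
    omega
  · simp only [SeqAt, List.mem_append, List.mem_cons, or_imp, forall_and, forall_eq,
      hu.isTheory.and_iff]
    tauto

theorem hasApprox_of_left_or {s t : List Form} {A B : Form}
    (ih : ∀ X' Y', listWeight X' + listWeight Y' < listWeight (s ++ .or A B :: t) + listWeight Y →
      HasApprox (seq X' Y')) : HasApprox (seq (s ++ .or A B :: t) Y) := by
  have := four_pow_add_lt (a := weight A) (b := weight B) (c := weight B)
    (d := weight (.or A B)) (by rw [weight]; omega) (by rw [weight]; omega)
    (by rw [weight]; omega)
  refine (ih (A :: (s ++ t)) Y ?_).seq_congr₂ (ih (B :: (s ++ t)) Y ?_) fun u hu => ?_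
  · simp only [listWeight_append, listWeight_cons]
    omega
  · simp only [listWeight_append, listWeight_cons]
    omega
  · simp only [SeqAt, List.mem_append, List.mem_cons, or_imp, forall_and, forall_eq,
      hu.or_iff]
    tauto

/-- A premise in `atomb` is exported as `A → (X ⇒ Y)`, which is exactly what the `imp` step of
`Approx` can treat. -/
theorem hasApprox_of_left_atomb {s t : List Form} {A : Form} (hA : A ∈ atomb)
    (ih : ∀ X' Y', listWeight X' + listWeight Y' < listWeight (s ++ A :: t) + listWeight Y →
      HasApprox (seq X' Y')) : HasApprox (seq (s ++ A :: t) Y) := by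
  refine (HasApprox.imp hA (ih (s ++ t) Y ?_)).congr fun w hw => ?_
  · simp only [listWeight_append, listWeight_cons]
    have : 0 < 4 ^ weight A := by positivity
    omega
  · rw [seq_mem_iff hw, (points_isPrimeTheory isTheory_IPC).imp_iff hw]
    constructor
    · intro h u hu hwu hX
      refine (seq_mem_iff hu).1 (h u hu hwu (hX A (by simp))) u hu subset_rfl fun B hB => hX B ?_
      simp only [List.mem_append, List.mem_cons] at hB ⊢
      tauto
    · intro h u hu hwu hAu
      refine (seq_mem_iff hu).2 fun v hv huv hX => h v hv (hwu.trans huv) fun B hB => ?_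
      simp only [List.mem_append, List.mem_cons] at hB hX
      rcases hB with hB | rfl | hB
      · exact hX B (.inl hB)
      · exact huv hAu
      · exact hX B (.inr hB)

theorem hasApprox_of_left_and_imp {s t : List Form} {A B F : Form}
    (ih : ∀ X' Y', listWeight X' + listWeight Y' <
      listWeight (s ++ .imp (.and A B) F :: t) + listWeight Y → HasApprox (seq X' Y')) :
    HasApprox (seq (s ++ .imp (.and A B) F :: t) Y) := by
  have : 4 ^ weight (.imp A (.imp B F)) < 4 ^ weight (.imp (.and A B) F) :=
    Nat.pow_lt_pow_right (by norm_num) (by simp only [weight]; omega)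
  refine (ih (.imp A (.imp B F) :: (s ++ t)) Y ?_).seq_congr fun u hu => ?_
  · simp only [listWeight_append, listWeight_cons]
    omega
  · have hiff : Form.imp (.and A B) F ∈ u ↔ Form.imp A (.imp B F) ∈ u := by
      have hP := points_isPrimeTheory isTheory_IPC
      constructor
      · exact fun h => hP.imp hu fun v hv huv hA => hP.imp hv fun z hz hvz hB =>
          hz.isTheory.mp (hvz (huv h)) (hz.isTheory.and_iff.2 ⟨hvz hA, hB⟩)
      · refine fun h => hP.imp hu fun v hv huv hAB => ?_
        have hAB := hv.isTheory.and_iff.1 hAB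
        exact hv.isTheory.mp (hv.isTheory.mp (huv h) hAB.1) hAB.2
    simp only [SeqAt, List.mem_append, List.mem_cons, or_imp, forall_and, forall_eq, hiff]
    tauto

theorem hasApprox_of_left_or_imp {s t : List Form} {A B F : Form}
    (ih : ∀ X' Y', listWeight X' + listWeight Y' <
      listWeight (s ++ .imp (.or A B) F :: t) + listWeight Y → HasApprox (seq X' Y')) :
    HasApprox (seq (s ++ .imp (.or A B) F :: t) Y) := by
  have := four_pow_add_lt (a := weight (.imp A F)) (b := weight (.imp B F)) (c := 0)
    (d := weight (.imp (.or A B) F)) (by have := weight_pos B; simp only [weight]; omega)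
    (by have := weight_pos A; simp only [weight]; omega) (by simp [weight])
  refine (ih (.imp A F :: .imp B F :: (s ++ t)) Y ?_).seq_congr fun u hu => ?_
  · simp only [listWeight_append, listWeight_cons]
    omega
  · have hiff : Form.imp (.or A B) F ∈ u ↔ Form.imp A F ∈ u ∧ Form.imp B F ∈ u := by
      have hP := points_isPrimeTheory isTheory_IPC
      constructor
      · exact fun h => ⟨hP.imp hu fun v hv huv hA =>
          hv.isTheory.mp (huv h) (hv.isTheory.or_left hA), hP.imp hu fun v hv huv hA =>
          hv.isTheory.mp (huv h) (hv.isTheory.or_right hA)⟩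
      · exact fun h => hP.imp hu fun v hv huv hAB => (hv.or hAB).elim
          (hv.isTheory.mp (huv h.1)) (hv.isTheory.mp (huv h.2))
    simp only [SeqAt, List.mem_append, List.mem_cons, or_imp, forall_and, forall_eq, hiff]
    tauto

theorem hasApprox_of_right_and {s t : List Form} {A B : Form}
    (ih : ∀ X' Y', listWeight X' + listWeight Y' < listWeight X + listWeight (s ++ .and A B :: t) →
      HasApprox (seq X' Y')) : HasApprox (seq X (s ++ .and A B :: t)) := by
  have := four_pow_add_lt (a := weight A) (b := weight B) (c := weight B)
    (d := weight (.and A B)) (by rw [weight]; omega) (by rw [weight]; omega)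
    (by rw [weight]; omega)
  refine (ih X (A :: (s ++ t)) ?_).seq_congr₂ (ih X (B :: (s ++ t)) ?_) fun u hu => ?_
  · simp only [listWeight_append, listWeight_cons]
    omega
  · simp only [listWeight_append, listWeight_cons]
    omega
  · simp only [SeqAt, List.mem_append, List.mem_cons, or_and_right, exists_or, exists_eq_left,
      hu.isTheory.and_iff]
    rw [← imp_and]
    refine imp_congr_right fun _ => ?_
    generalize (∃ x ∈ s, x ∈ u) = p, (∃ x ∈ t, x ∈ u) = q
    tauto

theorem hasApprox_of_right_or {s t : List Form} {A B : Form}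
    (ih : ∀ X' Y', listWeight X' + listWeight Y' < listWeight X + listWeight (s ++ .or A B :: t) →
      HasApprox (seq X' Y')) : HasApprox (seq X (s ++ .or A B :: t)) := by
  have := four_pow_add_lt (a := weight A) (b := weight B) (c := weight B)
    (d := weight (.or A B)) (by rw [weight]; omega) (by rw [weight]; omega)
    (by rw [weight]; omega)
  refine (ih X (A :: B :: (s ++ t)) ?_).seq_congr fun u hu => ?_
  · simp only [listWeight_append, listWeight_cons]
    omega
  · simp only [SeqAt, List.mem_append, List.mem_cons, or_and_right, exists_or, exists_eq_left,
      hu.or_iff]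
    refine imp_congr_right fun _ => ?_
    generalize (∃ x ∈ s, x ∈ u) = p, (∃ x ∈ t, x ∈ u) = q
    tauto

/-- By currying, this is the sequent `G, X ⇒ H`, which is lighter because `G → H` occurs in `Y`. -/
theorem hasApprox_imp_right {G H : Form} (hY : Form.imp G H ∈ Y)
    (ih : ∀ X' Y', listWeight X' + listWeight Y' < listWeight X + listWeight Y →
      HasApprox (seq X' Y')) : HasApprox (.imp (Form.conj X) (.imp G H)) := by
  have h₁ := four_pow_add_lt (a := weight G) (b := weight H) (c := weight H)
    (d := weight (.imp G H)) (by rw [weight]; omega) (by rw [weight]; omega)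
    (by rw [weight]; omega)
  have h₂ := le_listWeight hY
  have hP := points_isPrimeTheory isTheory_IPC
  refine (ih (G :: X) [H] ?_).congr fun w hw => ?_
  · simp only [listWeight_cons, listWeight_nil]
    omega
  · rw [seq_mem_iff hw, hP.imp_iff hw]
    simp only [SeqAt, List.mem_cons, forall_eq_or_imp, List.not_mem_nil, or_false,
      exists_eq_left]
    constructor
    · intro h u hu hwu hX
      refine hP.imp hu fun v hv huv hG => h v hv (hwu.trans huv) ⟨hG, fun A hA => ?_⟩
      exact huv (hu.isTheory.conj_iff.1 hX A hA)
    · intro h u hu hwu hX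
      exact hu.isTheory.mp (h u hu hwu (hu.isTheory.conj_iff.2 hX.2)) hX.1

open Classical in
-- The reduction of contraction-free sequent calculi: in the presence of `H`, `G → H` is true and so
-- `(G → H) → F` yields `F`; conversely, given `G`, `H → F` yields `(G → H) → F`. Hence that premise
-- can be traded for `G` and `H → F`, both lighter, when proving `H`.
theorem hasApprox_imp_left {G H F : Form} (hX : Form.imp (.imp G H) F ∈ X)
    (ih : ∀ X' Y', listWeight X' + listWeight Y' < listWeight X + listWeight Y →
      HasApprox (seq X' Y')) : HasApprox (.imp (Form.conj X) (.imp G H)) := by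
  have h₁ := four_pow_add_lt (a := weight (.imp H F)) (b := weight G) (c := weight H)
    (d := weight (.imp (.imp G H) F)) (by have := weight_pos G; simp only [weight]; omega)
    (by simp only [weight]; omega) (by simp only [weight]; omega)
  have h₂ := listWeight_perm (List.perm_cons_erase hX)
  rw [listWeight_cons] at h₂
  have hP := points_isPrimeTheory isTheory_IPC
  refine (ih (.imp H F :: G :: X.erase (.imp (.imp G H) F)) [H] ?_).congr fun w hw => ?_
  · simp only [listWeight_cons, listWeight_nil]
    omega
  · rw [seq_mem_iff hw, hP.imp_iff hw]
    simp only [SeqAt, List.mem_cons, forall_eq_or_imp, List.not_mem_nil, or_false,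
      exists_eq_left]
    constructor
    · intro h u hu hwu hXu
      rw [hu.isTheory.conj_iff] at hXu
      refine hP.imp hu fun v hv huv hG => h v hv (hwu.trans huv) ⟨?_, hG, fun A hA => ?_⟩
      · exact hP.imp hv fun z hz hvz hH =>
          hz.isTheory.mp (hvz (huv (hXu _ hX))) (hz.isTheory.imp_of_mem hH)
      · exact huv (hXu A (List.mem_of_mem_erase hA))
    · rintro h u hu hwu ⟨hHF, hG, hXu⟩
      refine hu.isTheory.mp (h u hu hwu (hu.isTheory.conj_iff.2 fun A hA => ?_)) hG
      by_cases hA' : A = .imp (.imp G H) F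
      · subst hA'
        exact hP.imp hu fun v hv huv hGH =>
          hv.isTheory.mp (huv hHF) (hv.isTheory.mp hGH (huv hG))
      · exact hXu A ((List.mem_erase_of_ne hA').2 hA)

open Classical in
/-- The step of the construction that uses Visser's rule. -/
theorem hasApprox_of_visser {ps : List (Form × Form)}
    (hps : ∀ p ∈ ps, p.1 ∈ atomb ∨ ∃ G H, p.1 = .imp G H)
    (hY : ∀ A ∈ Y, A ∈ atomb ∨ ∃ G H, A = .imp G H)
    (ih : ∀ X' Y', listWeight X' + listWeight Y' <
      listWeight (ps.map fun p => Form.imp p.1 p.2) + listWeight Y → HasApprox (seq X' Y')) :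
    HasApprox (seq (ps.map fun p => Form.imp p.1 p.2) Y) := by
  set X := ps.map fun p => Form.imp p.1 p.2 with hX
  have hpX : ∀ p ∈ ps, Form.imp p.1 p.2 ∈ X := fun p hp => List.mem_map_of_mem hp
  have hV : HasApprox (visserConcl ps Y) := by
    refine HasApprox.disj fun A hA => ?_
    obtain ⟨e, he, rfl⟩ := List.mem_map.1 hA
    by_cases hea : e ∈ atomb
    · simp only [curly, hea, if_true]
      exact ⟨e, .base hea⟩
    · simp only [curly, hea, if_false]
      rcases List.mem_append.1 he with he | he
      · obtain ⟨p, hp, rfl⟩ := List.mem_map.1 he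
        obtain ⟨G, H, hGH⟩ := (hps p hp).resolve_left hea
        rw [hGH]
        exact hasApprox_imp_left (hGH ▸ hpX p hp) ih
      · obtain ⟨G, H, rfl⟩ := (hY e he).resolve_left hea
        exact hasApprox_imp_right he ih
  -- One lighter sequent for each `i`, in which `E_i → F_i` is replaced by `F_i`.
  have hL : HasApprox (Form.conj (ps.map fun p => seq (p.2 :: X.erase (.imp p.1 p.2)) Y)) := by
    refine HasApprox.conj fun A hA => ?_
    obtain ⟨p, hp, rfl⟩ := List.mem_map.1 hA
    refine ih _ _ ?_
    have h₁ := listWeight_perm (List.perm_cons_erase (hpX p hp))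
    have h₂ : 4 ^ weight p.2 < 4 ^ weight (.imp p.1 p.2) :=
      Nat.pow_lt_pow_right (by norm_num) (by simp only [weight]; omega)
    rw [listWeight_cons] at h₁ ⊢
    omega
  -- Given the conclusion of Visser's rule, the sequent is equivalent to the conjunction in `hL`: if
  -- all of `X` holds, some `E_i` or some member of `Y` is true, and a true `E_i` yields `F_i`.
  -- Conversely, `F_i` implies `E_i → F_i`.
  have hVA : HasApprox (.and (visserConcl ps Y) (visserPrem ps Y)) := by
    refine (hV.and hL).congr fun w hw => ?_
    change _ ↔ Form.and _ (seq X Y) ∈ w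
    rw [hw.isTheory.and_iff, hw.isTheory.and_iff, and_congr_right_iff]
    intro hVw
    rw [hw.isTheory.conj_iff, seq_mem_iff hw]
    constructor
    · intro h u hu hwu hXu
      obtain ⟨A, hA, hAu⟩ := hu.disj_iff.1 (hwu hVw)
      obtain ⟨e, he, rfl⟩ := List.mem_map.1 hA
      have heu : e ∈ u := by
        by_cases hea : e ∈ atomb
        · simpa [curly, hea] using hAu
        · simp only [curly, hea, if_false] at hAu
          exact hu.isTheory.mp hAu (hu.isTheory.conj_iff.2 hXu)
      rcases List.mem_append.1 he with he | he
      · obtain ⟨p, hp, rfl⟩ := List.mem_map.1 he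
        refine (seq_mem_iff hw).1 (h _ (List.mem_map_of_mem hp)) u hu hwu fun B hB => ?_
        rcases List.mem_cons.1 hB with rfl | hB
        · exact hu.isTheory.mp (hXu _ (hpX p hp)) heu
        · exact hXu B (List.mem_of_mem_erase hB)
      · exact ⟨e, he, heu⟩
    · intro h A hA
      obtain ⟨p, hp, rfl⟩ := List.mem_map.1 hA
      refine (seq_mem_iff hw).2 fun u hu hwu hXu => h u hu hwu fun B hB => ?_
      by_cases hB' : B = .imp p.1 p.2
      · rw [hB']
        exact hu.isTheory.imp_of_mem (hXu _ (by simp))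
      · exact hXu B (List.mem_cons_of_mem _ ((List.mem_erase_of_ne hB').2 hB))
  obtain ⟨D, hD⟩ := hVA
  exact ⟨D, hD.visser⟩

end Step

/-- Formulas that the invertible steps on the left do not apply to. -/
def LeftNormal (A : Form) : Prop :=
  ∃ p : Form × Form, A = .imp p.1 p.2 ∧ (p.1 ∈ atomb ∨ ∃ G H, p.1 = .imp G H)

/-- Apply a reducing step while one is available. The remaining sequents have on the left only
implications whose antecedents are implications or in `atomb`, and on the right only implications or
members of `atomb`; these fall to Visser's rule. -/
theorem hasApprox_seq (n : ℕ) : ∀ X Y, listWeight X + listWeight Y = n → HasApprox (seq X Y) := by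
  induction n using Nat.strong_induction_on with
  | _ n ih =>
  rintro X Y rfl
  replace ih : ∀ X' Y', listWeight X' + listWeight Y' < listWeight X + listWeight Y →
      HasApprox (seq X' Y') := fun X' Y' h => ih _ h X' Y' rfl
  by_cases hX : ∀ A ∈ X, LeftNormal A
  · by_cases hY : ∀ A ∈ Y, A ∈ atomb ∨ ∃ G H, A = .imp G H
    · obtain ⟨ps, hps, rfl⟩ : ∃ ps : List (Form × Form),
          (∀ p ∈ ps, p.1 ∈ atomb ∨ ∃ G H, p.1 = .imp G H) ∧
            X = ps.map fun p => Form.imp p.1 p.2 := by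
        clear ih
        induction X with
        | nil => exact ⟨[], by simp, rfl⟩
        | cons A X ihX =>
          obtain ⟨p, rfl, hp⟩ := hX A (by simp)
          obtain ⟨ps, hps, rfl⟩ := ihX fun A hA => hX A (List.mem_cons_of_mem _ hA)
          exact ⟨p :: ps, List.forall_mem_cons.2 ⟨hp, hps⟩, rfl⟩
      exact hasApprox_of_visser hps hY ih
    · push Not at hY
      obtain ⟨A, hA, hn, hn'⟩ := hY
      obtain ⟨s, t, rfl⟩ := List.append_of_mem hA
      cases A with
      | bot => simp at hn
      | atom a => simp at hn
      | box A => simp at hn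
      | imp G H => exact absurd rfl (hn' G H)
      | and A B => exact hasApprox_of_right_and ih
      | or A B => exact hasApprox_of_right_or ih
  · push Not at hX
    obtain ⟨A, hA, hn⟩ := hX
    obtain ⟨s, t, rfl⟩ := List.append_of_mem hA
    cases A with
    | bot => exact hasApprox_of_left_atomb (by simp) ih
    | atom a => exact hasApprox_of_left_atomb (by simp) ih
    | box A => exact hasApprox_of_left_atomb (by simp) ih
    | and A B => exact hasApprox_of_left_and ih
    | or A B => exact hasApprox_of_left_or ih
    | imp E F =>
      cases E with
      | bot => exact absurd ⟨(_, _), rfl, .inl (by simp)⟩ hn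
      | atom a => exact absurd ⟨(_, _), rfl, .inl (by simp)⟩ hn
      | box A => exact absurd ⟨(_, _), rfl, .inl (by simp)⟩ hn
      | imp G H => exact absurd ⟨(_, _), rfl, .inr ⟨G, H, rfl⟩⟩ hn
      | and A B => exact hasApprox_of_left_and_imp ih
      | or A B => exact hasApprox_of_left_or_imp ih

theorem hasApprox (A : Form) : HasApprox A := by
  refine (hasApprox_seq _ [] [A] rfl).congr fun w hw => ?_
  rw [seq_mem_iff hw]
  simp only [SeqAt, List.not_mem_nil, false_imp_iff, implies_true, true_imp_iff,
    List.mem_singleton, exists_eq_left]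
  exact ⟨fun h => h w hw subset_rfl, fun h u _ hwu => hwu h⟩

/-! ### The standard examples are of type `σ` -/

section Logics

variable {Ax : Form → Prop}

theorem logicOf_mp {A B : Form} (h : imp A B ∈ logicOf Ax) (hA : A ∈ logicOf Ax) :
    B ∈ logicOf Ax := Deriv.mp h hA

/-- Necessitation is not a primitive rule. Axioms come with their boxes, `4` supplies the second
box, and `K` passes through modus ponens. -/
theorem logicOf_nec (h : ∀ A, AxK4Ca A → Ax A) {A : Form} (hA : A ∈ logicOf Ax) :
    box A ∈ logicOf Ax := by
  induction hA with
  | @ax A hA =>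
    rcases hA with hA | ⟨C, hC, rfl⟩
    · exact .ax (.inr ⟨A, hA, rfl⟩)
    · exact .mp (.ax (.inl (h _ (.four C)))) (.ax (.inr ⟨C, hC, rfl⟩))
  | mp _ _ ih₁ ih₂ => exact .mp (.mp (.ax (.inl (h _ (.k _ _)))) ih₁) ih₂

theorem logicOf_isTheory (h : ∀ A, AxIPC A → Ax A) : IsTheory (logicOf Ax) :=
  ⟨fun _ d => d.mono fun A hA => .inl (h A hA), logicOf_mp⟩

theorem iK4Ca_subset (h : ∀ A, AxIPC A → Ax A) (h' : ∀ A, AxK4Ca A → Ax A) :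
    iK4Ca ⊆ logicOf Ax := fun _ d => d.mono (by
  rintro A (hA | ⟨C, hC, rfl⟩)
  · exact .inl (hA.elim (h A) (h' A))
  · exact .inr ⟨C, hC.elim (h C) (h' C), rfl⟩)

theorem valid_of_mem_logicOf {K : KModel} (h : ∀ A, Ax A → K.Valid A) {A : Form}
    (hA : A ∈ logicOf Ax) : K.Valid A :=
  K.valid_of_deriv (by
    rintro B (hB | ⟨C, hC, rfl⟩)
    · exact h B hB
    · exact fun _ u _ => h C hC u) hA

end Logics

/-- Transitivity of the modal relation and persistence of atoms along it. -/
structure KModel.IsK4Ca (K : KModel) : Prop where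
  trans : ∀ u v w, K.rel u v → K.rel v w → K.rel u w
  val_rel : ∀ u v a, K.rel u v → K.val u a → K.val v a

theorem KModel.IsK4Ca.valid {K : KModel} (h : K.IsK4Ca) {A : Form} (hA : AxK4Ca A) :
    K.Valid A := by
  intro w
  cases hA with
  | k A B =>
    exact fun u _ hAB v huv hA x hvx =>
      hAB x (K.le_rel _ _ _ huv hvx) x (K.le_refl x) (hA x hvx)
  | four A => exact fun u _ hA v huv x hvx => hA x (h.trans _ _ _ huv hvx)
  | ca a => exact fun u _ ha v huv => h.val_rel _ _ a huv ha

theorem KModel.IsK4Ca.gen_isRoot {K : KModel} (h : K.IsK4Ca) (w : K.W) :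
    (K.gen w).IsRoot (K.gen w).root := by
  rintro ⟨v, hv⟩
  induction hv with
  | refl => exact ⟨(K.gen w).root, .inl rfl, K.le_refl w⟩
  | @tail x y hx hxy ih =>
    obtain ⟨u, hu, hux⟩ := ih
    rcases hxy with hxy | hxy
    · exact ⟨u, hu, K.le_trans _ _ _ hux hxy⟩
    · have hu' : K.rel u.1 y := K.le_rel _ _ _ hux hxy
      refine ⟨⟨y, hx.tail (.inr hxy)⟩, .inr ?_, K.le_refl y⟩
      rcases hu with rfl | hu
      · exact hu'
      · exact h.trans _ _ _ hu hu'

theorem KModel.IsK4Ca.gen {K : KModel} (h : K.IsK4Ca) (w : K.W) : (K.gen w).IsK4Ca :=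
  ⟨fun _ _ _ => h.trans _ _ _, fun _ _ a => h.val_rel _ _ a⟩

theorem sumVariant_isK4Ca {m n : ℕ} {K : Fin m → PModel} {K' : Fin n → PModel}
    {v : Atom → Prop} {hv : ∀ a, v a → ∀ i, (K i).val (K i).root a}
    (h : ∀ i, (K i).IsK4Ca) (h' : ∀ j, (K' j).IsK4Ca)
    (hc : ∀ a, (sumVariant K K' v hv).Valid (imp (atom a) (box (atom a)))) :
    (sumVariant K K' v hv).IsK4Ca where
  trans := by
    intro x y z hxy hyz
    cases hxy with
    | belowLeft i w hw =>
      cases hyz with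
      | left _ _ u hu => exact .belowLeft i u ((h i).trans _ _ _ hw hu)
    | belowRight j w hw =>
      cases hyz with
      | right _ _ u hu =>
        rcases hw with rfl | hw
        · exact .belowRight j u (.inr hu)
        · exact .belowRight j u (.inr ((h' j).trans _ _ _ hw hu))
    | left i w u hu =>
      cases hyz with
      | left _ _ y hy => exact .left i w y ((h i).trans _ _ _ hu hy)
    | right j w u hu =>
      cases hyz with
      | right _ _ y hy => exact .right j w y ((h' j).trans _ _ _ hu hy)
  val_rel x y a hxy hx := hc a x x ((sumVariant K K' v hv).le_refl x) hx y hxy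

theorem sumVariant_isRoot {m n : ℕ} {K : Fin m → PModel} {K' : Fin n → PModel}
    {v : Atom → Prop} {hv : ∀ a, v a → ∀ i, (K i).val (K i).root a}
    (h : ∀ i, (K i).IsRoot (K i).root) (h' : ∀ j, (K' j).IsRoot (K' j).root) :
    (sumVariant K K' v hv).IsRoot (sumVariant K K' v hv).root := by
  rintro (_ | ⟨i, w⟩ | ⟨j, w⟩)
  · exact ⟨.fresh, .inl rfl, .fresh⟩
  · obtain ⟨u, rfl | hu, huw⟩ := h i w
    · exact ⟨.fresh, .inl rfl, .below i w huw⟩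
    · exact ⟨.left i u, .inr (.belowLeft i u hu), .left i u w huw⟩
  · obtain ⟨u, hu, huw⟩ := h' j w
    exact ⟨.right j u, .inr (.belowRight j u hu), .right j u w huw⟩

/-- There is no infinite ascending chain for the modal relation. -/
def KModel.ConvWF (K : KModel) : Prop := WellFounded fun x y => K.rel y x

theorem KModel.ConvWF.gen {K : KModel} (h : K.ConvWF) (w : K.W) : (K.gen w).ConvWF :=
  InvImage.wf (r := fun x y => K.rel y x) Subtype.val h

theorem sumVariant_convWF {m n : ℕ} {K : Fin m → PModel} {K' : Fin n → PModel}
    {v : Atom → Prop} {hv : ∀ a, v a → ∀ i, (K i).val (K i).root a}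
    (h : ∀ i, (K i).ConvWF) (h' : ∀ j, (K' j).ConvWF) : (sumVariant K K' v hv).ConvWF := by
  have hl : ∀ i w, Acc (fun x y => SumRel K K' y x) (.left i w) := by
    intro i w
    induction w using (h i).induction with
    | _ w ih =>
      refine ⟨_, fun y hy => ?_⟩
      cases hy with
      | left _ _ u hu => exact ih u hu
  have hr : ∀ j w, Acc (fun x y => SumRel K K' y x) (.right j w) := by
    intro j w
    induction w using (h' j).induction with
    | _ w ih =>
      refine ⟨_, fun y hy => ?_⟩
      cases hy with
      | right _ _ u hu => exact ih u hu
  refine ⟨?_⟩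
  rintro (_ | ⟨i, w⟩ | ⟨j, w⟩)
  · refine ⟨_, fun y hy => ?_⟩
    cases hy with
    | belowLeft i w _ => exact hl i w
    | belowRight j w _ => exact hr j w
  · exact hl i w
  · exact hr j w

theorem KModel.ConvWF.valid {K : KModel} (h : K.ConvWF) (hK : K.IsK4Ca) {A : Form}
    (hA : AxL A) : K.Valid A := by
  intro w
  cases hA with
  | lob A =>
    intro u _ hu x
    induction x using h.induction with
    | _ x ih =>
      intro hux
      exact hu x hux x (K.le_refl x) fun y hxy => ih y hxy (hK.trans _ _ _ hux hxy)

/-- The canonical model of `T`, whose modal relation is restricted by `Q`. -/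
def canonical (T : Set Form) (Q : Set Form → Set Form → Prop)
    (hQ : ∀ u v w, u ⊆ v → Q v w → Q u w) (hne : ∃ w, IsPrimeTheory T w) : KModel where
  W := {w : Set Form // IsPrimeTheory T w}
  le u v := u.1 ⊆ v.1
  rel u v := (∀ A, box A ∈ u.1 → A ∈ v.1) ∧ Q u.1 v.1
  val w a := atom a ∈ w.1
  nonempty := hne.elim fun w hw => ⟨⟨w, hw⟩⟩
  le_refl _ := subset_rfl
  le_trans _ _ _ := subset_trans
  le_antisymm _ _ h h' := Subtype.ext (h.antisymm h')
  val_mono _ _ _ h ha := h ha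
  le_rel _ _ _ h h' := ⟨fun A hA => h'.1 A (h hA), hQ _ _ _ h h'.2⟩

section Canonical

variable {T : Set Form} {Q : Set Form → Set Form → Prop}
  {hQ : ∀ u v w, u ⊆ v → Q v w → Q u w} {hne : ∃ w, IsPrimeTheory T w}

/-- The formulas whose boxes occur in a formula, at any depth. -/
def boxed : Form → Set Form
  | .bot => ∅
  | .atom _ => ∅
  | .and A B => boxed A ∪ boxed B
  | .or A B => boxed A ∪ boxed B
  | .imp A B => boxed A ∪ boxed B
  | .box A => insert A (boxed A)

theorem boxed_finite (A : Form) : (boxed A).Finite := by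
  induction A with
  | bot => exact Set.finite_empty
  | atom _ => exact Set.finite_empty
  | and _ _ ih₁ ih₂ => exact ih₁.union ih₂
  | or _ _ ih₁ ih₂ => exact ih₁.union ih₂
  | imp _ _ ih₁ ih₂ => exact ih₁.union ih₂
  | box A ih => exact ih.insert A

/-- Successor witnesses are required only for the boxed subformulas of `A`, so `Q` may be chosen to
suit one formula. -/
theorem canonical_forces (hT : IsTheory T) {A : Form}
    (h : ∀ B ∈ boxed A, ∀ w, IsPrimeTheory T w → box B ∉ w →
      ∃ u, IsPrimeTheory T u ∧ (∀ A, box A ∈ w → A ∈ u) ∧ Q w u ∧ B ∉ u) :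
    ∀ {w : (canonical T Q hQ hne).W}, (canonical T Q hQ hne).forces w A ↔ A ∈ w.1 := by
  induction A with
  | bot => exact fun {w} => ⟨False.elim, w.2.bot⟩
  | atom a => exact Iff.rfl
  | and A B ihA ihB =>
    intro w
    rw [w.2.isTheory.and_iff, ← ihA fun C hC => h C (.inl hC), ← ihB fun C hC => h C (.inr hC)]
    rfl
  | or A B ihA ihB =>
    intro w
    rw [w.2.or_iff, ← ihA fun C hC => h C (.inl hC), ← ihB fun C hC => h C (.inr hC)]
    rfl
  | imp A B ihA ihB =>
    intro w
    have ihA := @ihA fun C hC => h C (.inl hC)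
    have ihB := @ihB fun C hC => h C (.inr hC)
    rw [(points_isPrimeTheory hT).imp_iff w.2]
    exact ⟨fun h u hu hwu hA => (ihB (w := ⟨u, hu⟩)).1 (h ⟨u, hu⟩ hwu (ihA.2 hA)),
      fun h u hwu hA => ihB.2 (h u.1 u.2 hwu (ihA.1 hA))⟩
  | box A ihA =>
    intro w
    have ihA := @ihA fun C hC => h C (.inr hC)
    constructor
    · intro hw
      by_contra hA
      obtain ⟨u, hu, h₁, h₂, h₃⟩ := h A (.inl rfl) w.1 w.2 hA
      exact h₃ ((ihA (w := ⟨u, hu⟩)).1 (hw ⟨u, hu⟩ ⟨h₁, h₂⟩))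
    · exact fun hA u hu => ihA.2 (hu.1 A hA)

theorem canonical_isK4Ca (hT : ∀ A, AxK4Ca A → A ∈ T)
    (hQt : ∀ u v w, IsPrimeTheory T v → Q u v → (∀ A, box A ∈ v → box A ∈ w) → Q u w) :
    (canonical T Q hQ hne).IsK4Ca where
  trans u v w huv hvw := by
    have h4 : ∀ x : (canonical T Q hQ hne).W, ∀ A, box A ∈ x.1 → box (box A) ∈ x.1 :=
      fun x A hA => x.2.isTheory.mp (x.2.subset (hT _ (.four A))) hA
    exact ⟨fun A hA => hvw.1 A (huv.1 _ (h4 u A hA)),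
      hQt _ _ _ v.2 huv.2 fun A hA => hvw.1 _ (h4 v A hA)⟩
  val_rel u v a huv ha :=
    huv.1 _ (u.2.isTheory.mp (u.2.subset (hT _ (.ca a))) ha)

/-- Derivations from the formulas boxed in `w` can be boxed in `w`. -/
theorem box_mem_of_deriv (hk : ∀ A, AxK4Ca A → A ∈ T) (hnec : ∀ {A}, A ∈ T → box A ∈ T)
    {w : Set Form} (hw : IsPrimeTheory T w) {B : Form}
    (d : Deriv (T ∪ {A | box A ∈ w}) B) : box B ∈ w := by
  induction d with
  | ax hA => exact hA.elim (fun h => hw.subset (hnec h)) id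
  | mp _ _ ih₁ ih₂ =>
    exact hw.isTheory.mp (hw.isTheory.mp (hw.subset (hk _ (.k _ _))) ih₁) ih₂

end Canonical

theorem typeSigma_of_class {T : Set Form} {M : Set PModel} (h₁ : iK4Ca ⊆ T)
    (h₂ : ∀ A B, imp A B ∈ T → A ∈ T → B ∈ T) (h₃ : ∀ A, A ∈ T → box A ∈ T)
    (hM : ∀ K ∈ M, K.IsRoot K.root) (hs : ∀ A ∈ T, ∀ K ∈ M, K.Valid A)
    (hc : ∀ A ∉ T, ∃ K : KModel, ∃ w, K.gen w ∈ M ∧ ¬ K.forces w A)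
    (hE : ExtensionProperty M) (hI : IntSubmodelProperty M) : TypeSigma T := by
  refine ⟨h₁, h₂, h₃, M, hM, fun A => ⟨hs A, fun h => ?_⟩, hE, hI⟩
  by_contra hA
  obtain ⟨K, w, hK, hn⟩ := hc A hA
  exact hn ((K.gen_forces w).1 (h _ hK (K.gen w).root))

theorem typeSigma_iK4Ca : TypeSigma iK4Ca := by
  have hT : IsTheory iK4Ca := logicOf_isTheory fun _ h => .inl h
  have hk : ∀ A, AxK4Ca A → A ∈ iK4Ca := fun A h => .ax (.inl (.inr h))
  have hnec : ∀ {A}, A ∈ iK4Ca → box A ∈ iK4Ca := fun h => logicOf_nec (fun _ h => .inr h) h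
  refine typeSigma_of_class (M := {K | K.IsRoot K.root ∧ K.IsK4Ca}) subset_rfl
    (fun _ _ => logicOf_mp) (fun _ => hnec) (fun K hK => hK.1) ?_ ?_ ?_ ?_
  · exact fun A hA K hK => valid_of_mem_logicOf
      (fun B hB => hB.elim K.forces_ipc hK.2.valid) hA
  · intro A hA
    obtain ⟨w, hw, hAw⟩ := exists_isPrimeTheory hT.axioms
      (fun d => hA (hT.of_deriv subset_rfl d))
    have hK := canonical_isK4Ca (Q := fun _ _ => True) (hQ := fun _ _ _ _ h => h)
      (hne := ⟨w, hw⟩) hk fun _ _ _ _ h _ => h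
    refine ⟨canonical iK4Ca (fun _ _ => True) (fun _ _ _ _ h => h) ⟨w, hw⟩, ⟨w, hw⟩,
      ⟨hK.gen_isRoot _, hK.gen _⟩, fun hf => hAw ?_⟩
    refine (canonical_forces hT ?_).1 hf
    intro B _ x hx hB
    obtain ⟨u, hu, hBu⟩ := exists_isPrimeTheory (S := iK4Ca ∪ {A | box A ∈ x})
      (hT.axioms.trans Set.subset_union_left) (fun d => hB (box_mem_of_deriv hk hnec hx d))
    exact ⟨u, ⟨hu.isTheory, Set.subset_union_left.trans hu.subset, hu.bot, hu.or⟩,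
      fun C hC => hu.subset (.inr hC), trivial, hBu⟩
  · exact fun m n K K' hK hK' v hv hc =>
      ⟨sumVariant_isRoot (fun i => (hK i).1) fun j => (hK' j).1,
        sumVariant_isK4Ca (fun i => (hK i).2) (fun j => (hK' j).2) hc⟩
  · intro K hK le' hr ht hs w
    have h : (K.toKModel.withOrder le' hr ht hs).IsK4Ca := ⟨hK.2.trans, hK.2.val_rel⟩
    exact ⟨h.gen_isRoot w, h.gen w⟩

/-- Strict growth of the set of boxed formulas from `Φ`. -/
def BoxGrows (Φ : Set Form) (u v : Set Form) : Prop := ∃ B ∈ Φ, box B ∈ v ∧ box B ∉ u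

/-- Along the full canonical relation there may be infinite chains. For a given non-theorem `A`, one
requires each step to add a box over a formula of the finite set `boxed A`. -/
theorem typeSigma_iGLCa : TypeSigma iGLCa := by
  have hT : IsTheory iGLCa := logicOf_isTheory fun _ h => .inl h
  have hk : ∀ A, AxK4Ca A → A ∈ iGLCa := fun A h => .ax (.inl (.inr (.inl h)))
  have hlob : ∀ A, AxL A → A ∈ iGLCa := fun A h => .ax (.inl (.inr (.inr h)))
  have hnec : ∀ {A}, A ∈ iGLCa → box A ∈ iGLCa :=
    fun h => logicOf_nec (fun _ h => .inr (.inl h)) h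
  refine typeSigma_of_class (M := {K | K.IsRoot K.root ∧ K.IsK4Ca ∧ K.ConvWF})
    (iK4Ca_subset (fun _ h => .inl h) fun _ h => .inr (.inl h))
    (fun _ _ => logicOf_mp) (fun _ => hnec) (fun K hK => hK.1) ?_ ?_ ?_ ?_
  · exact fun A hA K hK => valid_of_mem_logicOf
      (fun B hB => hB.elim K.forces_ipc fun hB => hB.elim hK.2.1.valid (hK.2.2.valid hK.2.1)) hA
  · intro A hA
    obtain ⟨w, hw, hAw⟩ := exists_isPrimeTheory hT.axioms
      (fun d => hA (hT.of_deriv subset_rfl d))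
    have hQ : ∀ u v x, u ⊆ v → BoxGrows (boxed A) v x → BoxGrows (boxed A) u x :=
      fun u v x huv ⟨B, hB, h₁, h₂⟩ => ⟨B, hB, h₁, fun h => h₂ (huv h)⟩
    have hK := canonical_isK4Ca (T := iGLCa) (Q := BoxGrows (boxed A)) (hQ := hQ)
      (hne := ⟨w, hw⟩) hk fun u v x _ ⟨B, hB, h₁, h₂⟩ h => ⟨B, hB, h B h₁, h₂⟩
    have hwf : (canonical iGLCa (BoxGrows (boxed A)) hQ ⟨w, hw⟩).ConvWF := by
      -- The number of formulas of `boxed A` not yet boxed drops at each modal step: `4` preserves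
      -- old boxes and `BoxGrows` adds a new one.
      refine Subrelation.wf (r := InvImage (· < ·) fun x => (boxed A \ {B | box B ∈ x.1}).ncard)
        ?_ (InvImage.wf _ wellFounded_lt)
      rintro y x ⟨hxy, B, hB, h₁, h₂⟩
      refine Set.ncard_lt_ncard ⟨fun C hC => ⟨hC.1, fun h => hC.2 ?_⟩, fun h => ?_⟩
        ((boxed_finite A).subset Set.sdiff_subset)
      · exact hxy _ (x.2.isTheory.mp (x.2.subset (hk _ (.four C))) h)
      · exact (h (⟨hB, h₂⟩ : B ∈ boxed A \ {B | box B ∈ x.1})).2 h₁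
    refine ⟨canonical iGLCa (BoxGrows (boxed A)) hQ ⟨w, hw⟩, ⟨w, hw⟩,
      ⟨hK.gen_isRoot _, hK.gen _, hwf.gen _⟩, fun hf => hAw ?_⟩
    refine (canonical_forces hT ?_).1 hf
    intro B hBA x hx hB
    -- The successor is asked to satisfy `□B` while refuting `B`, so that `B` itself witnesses
    -- growth. Were this inconsistent, `□(□B → B)` would hold at `x` and Löb's axiom would give
    -- `□B`.
    obtain ⟨u, hu, hBu⟩ := exists_isPrimeTheory (S := insert (box B) (iGLCa ∪ {A | box A ∈ x}))
      (hT.axioms.trans (Set.subset_union_left.trans (Set.subset_insert _ _))) (A := B) (by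
        intro d
        have d' := d.deduction (hT.axioms.trans Set.subset_union_left)
        exact hB (hx.isTheory.mp (hx.subset (hlob _ (.lob B))) (box_mem_of_deriv hk hnec hx d')))
    refine ⟨u, ⟨hu.isTheory, Set.subset_union_left.trans ((Set.subset_insert _ _).trans hu.subset),
      hu.bot, hu.or⟩, fun C hC => hu.subset (.inr (.inr hC)),
      ⟨B, hBA, hu.subset (.inl rfl), hB⟩, hBu⟩
  · exact fun m n K K' hK hK' v hv hc =>
      ⟨sumVariant_isRoot (fun i => (hK i).1) fun j => (hK' j).1,
        sumVariant_isK4Ca (fun i => (hK i).2.1) (fun j => (hK' j).2.1) hc,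
        sumVariant_convWF (fun i => (hK i).2.2) fun j => (hK' j).2.2⟩
  · intro K hK le' hr ht hs w
    have h : (K.toKModel.withOrder le' hr ht hs).IsK4Ca := ⟨hK.2.1.trans, hK.2.1.val_rel⟩
    exact ⟨h.gen_isRoot w, h.gen w, KModel.ConvWF.gen (K := K.toKModel.withOrder le' hr ht hs) hK.2.2 w⟩

/-! ### Enumerating inductively generated sets -/

section Enumeration

variable {α β γ : Type}

/-- The rule with index `n` in a list, and the constant `d` beyond the end of the list. -/
def pick (d : α) : List (β → α) → ℕ → β → α
  | [], _, _ => d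
  | r :: rs, n, b => n.casesOn (r b) fun m => pick d rs m b

theorem exists_pick_eq (d : α) {rs : List (β → α)} {r : β → α} (h : r ∈ rs) :
    ∃ n, pick d rs n = r := by
  induction rs with
  | nil => simp at h
  | cons r' rs ih =>
    rcases List.mem_cons.1 h with rfl | h
    · exact ⟨0, rfl⟩
    · obtain ⟨n, hn⟩ := ih h
      exact ⟨n + 1, hn⟩

theorem pick_mem (d : α) (rs : List (β → α)) (n : ℕ) :
    (∀ b, pick d rs n b = d) ∨ ∃ r ∈ rs, pick d rs n = r := by
  induction rs generalizing n with
  | nil => exact .inl fun _ => rfl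
  | cons r rs ih =>
    cases n with
    | zero => exact .inr ⟨r, by simp, rfl⟩
    | succ n =>
      rcases ih n with h | ⟨r', hr', h⟩
      · exact .inl h
      · exact .inr ⟨r', by simp [hr'], h⟩

/-- The enumeration of the set generated from `d` by the binary operations `g k`. -/
def enumerate (d : α) (g : ℕ → α → α → α) : ℕ → α
  | 0 => d
  | n + 1 =>
    have _h₁ : n.unpair.2.unpair.1 < n + 1 :=
      Nat.lt_succ_of_le ((Nat.unpair_left_le _).trans (Nat.unpair_right_le _))
    have _h₂ : n.unpair.2.unpair.2 < n + 1 :=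
      Nat.lt_succ_of_le ((Nat.unpair_right_le _).trans (Nat.unpair_right_le _))
    g n.unpair.1 (enumerate d g n.unpair.2.unpair.1) (enumerate d g n.unpair.2.unpair.2)
decreasing_by
  · exact _h₁
  · exact _h₂

variable [Primcodable α] [Primcodable β] [Primcodable γ]

theorem primrec_pick (d : α) {rs : List (β → α)} (h : ∀ r ∈ rs, Primrec r) :
    Primrec₂ (pick d rs) := by
  induction rs with
  | nil => exact Primrec.const d
  | cons r rs ih =>
    rw [List.forall_mem_cons] at h
    exact Primrec.nat_casesOn Primrec.fst (h.1.comp Primrec.snd)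
      ((ih h.2).comp Primrec.snd (Primrec.snd.comp Primrec.fst))

theorem primrec_enumerate (d : α) {g : ℕ → α → α → α}
    (hg : Primrec fun p : ℕ × α × α => g p.1 p.2.1 p.2.2) : Primrec (enumerate d g) := by
  have hu : Primrec fun p : (Unit × List α) × ℕ => p.2.unpair := Primrec.unpair.comp Primrec.snd
  have hu₂ : Primrec fun p : (Unit × List α) × ℕ => p.2.unpair.2.unpair :=
    Primrec.unpair.comp (Primrec.snd.comp hu)
  have hl : Primrec fun p : (Unit × List α) × ℕ => p.1.2 := Primrec.snd.comp Primrec.fst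
  have h : Primrec₂ fun (_ : Unit) (n : ℕ) => enumerate d g n := by
    refine Primrec.nat_strong_rec _
      (g := fun _ l => some (l.length.casesOn d fun n => g n.unpair.1
        (l.getD n.unpair.2.unpair.1 d) (l.getD n.unpair.2.unpair.2 d))) ?_ ?_
    · refine Primrec.option_some.comp (Primrec.nat_casesOn
        (Primrec.list_length.comp Primrec.snd) (Primrec.const d) ?_)
      exact hg.comp ((Primrec.fst.comp hu).pair
        (((Primrec.list_getD d).comp hl (Primrec.fst.comp hu₂)).pair
          ((Primrec.list_getD d).comp hl (Primrec.snd.comp hu₂))))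
    · intro _ n
      cases n with
      | zero => simp [enumerate]
      | succ n =>
        have h₁ : n.unpair.2.unpair.1 < n + 1 :=
          Nat.lt_succ_of_le ((Nat.unpair_left_le _).trans (Nat.unpair_right_le _))
        have h₂ : n.unpair.2.unpair.2 < n + 1 :=
          Nat.lt_succ_of_le ((Nat.unpair_right_le _).trans (Nat.unpair_right_le _))
        simp [enumerate, List.getD_eq_getElem?_getD, h₁, h₂]
  exact h.comp (Primrec.const ()) Primrec.id

/-- The set generated from `d` by finitely many primitive recursive rules with two premises and a
parameter has a primitive recursive enumeration. -/
theorem exists_enumeration [Inhabited γ] (d : α) {rs : List (γ × α × α → α)}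
    (h : ∀ r ∈ rs, Primrec r) : ∃ e : ℕ → α, Primrec e ∧
      (∀ r ∈ rs, ∀ c i j, ∃ n, e n = r (c, e i, e j)) ∧
      ∀ good : α → Prop, good d → (∀ r ∈ rs, ∀ c x y, good x → good y → good (r (c, x, y))) →
        ∀ n, good (e n) := by
  set g : ℕ → α → α → α := fun k x y =>
    pick d rs k.unpair.1 ((Encodable.decode (α := γ) k.unpair.2).getD default, x, y) with hg
  have hgp : Primrec fun p : ℕ × α × α => g p.1 p.2.1 p.2.2 := by
    have hu : Primrec fun p : ℕ × α × α => p.1.unpair := Primrec.unpair.comp Primrec.fst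
    exact (primrec_pick d h).comp (Primrec.fst.comp hu)
      ((Primrec.option_getD.comp (Primrec.decode.comp (Primrec.snd.comp hu))
        (Primrec.const default)).pair Primrec.snd)
  refine ⟨enumerate d g, primrec_enumerate d hgp, ?_, ?_⟩
  · intro r hr c i j
    obtain ⟨k, rfl⟩ := exists_pick_eq d hr
    -- An index codes the rule, its parameter and the indices of the two premises; the shift by one
    -- leaves index `0` to `d`.
    refine ⟨Nat.pair (Nat.pair k (Encodable.encode c)) (Nat.pair i j) + 1, ?_⟩
    rw [enumerate]
    simp [hg]
  · intro good hd hrs n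
    induction n using Nat.strong_induction_on with
    | _ n ih =>
    cases n with
    | zero => rwa [enumerate]
    | succ n =>
      rw [enumerate]
      have h₁ := ih _ (Nat.lt_succ_of_le ((n.unpair.2.unpair_left_le).trans n.unpair_right_le))
      have h₂ := ih _ (Nat.lt_succ_of_le ((n.unpair.2.unpair_right_le).trans n.unpair_right_le))
      simp only [hg]
      rcases pick_mem d rs n.unpair.1.unpair.1 with h | ⟨r, hr, h⟩
      · rwa [h]
      · rw [h]
        exact hrs r hr _ _ _ h₁ h₂

open Classical in
/-- A function whose graph is contained in the range of an enumeration can be found by search. -/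
theorem exists_computable {e : ℕ → ℕ × β × γ} (he : Primrec e) (t : ℕ)
    (h : ∀ b, ∃ n c, e n = (t, b, c)) :
    ∃ f : β → γ, Computable f ∧ ∀ b, ∃ n, e n = (t, b, f b) := by
  set F : β → ℕ → Option γ := fun b n =>
    if (e n).1 = t ∧ (e n).2.1 = b then some (e n).2.2 else none with hF
  have hFc : Computable₂ F := by
    have hen : Primrec fun p : β × ℕ => e p.2 := he.comp Primrec.snd
    exact (Primrec.ite ((Primrec.eq.comp (Primrec.fst.comp hen) (Primrec.const t)).and
      (Primrec.eq.comp (Primrec.fst.comp (Primrec.snd.comp hen)) Primrec.fst))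
      (Primrec.option_some.comp (Primrec.snd.comp (Primrec.snd.comp hen)))
      (Primrec.const none)).to_comp
  have hdom : ∀ b, (Nat.rfindOpt (F b)).Dom := by
    intro b
    obtain ⟨n, c, hn⟩ := h b
    exact Nat.rfindOpt_dom.2 ⟨n, c, by simp [hF, hn]⟩
  refine ⟨fun b => (Nat.rfindOpt (F b)).get (hdom b),
    (Partrec.rfindOpt hFc).of_eq_tot fun b => Part.get_mem _, fun b => ?_⟩
  obtain ⟨n, hn⟩ := Nat.rfindOpt_spec (Part.get_mem (hdom b))
  refine ⟨n, ?_⟩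
  simp only [hF, Option.mem_def, Option.ite_none_right_eq_some, Option.some.injEq] at hn
  exact Prod.ext hn.1.1 (Prod.ext hn.1.2 hn.2)

end Enumeration

/-! ### Primitive recursive operations on formulas -/

instance : Inhabited Form := ⟨.bot⟩

theorem primrec_toNat : Primrec Form.toNat := Primrec.encode

theorem primrec_ofNat : Primrec Form.ofNat := Primrec.ofNat Form

/-- Connectives are arithmetic on codes, by the choice of the Gödel numbering. -/
theorem primrec_binary {f : Form → Form → Form} (i : ℕ)
    (h : ∀ A B, toNat (f A B) = 6 * Nat.pair (toNat A) (toNat B) + i) : Primrec₂ f := by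
  have h' : Primrec fun p : Form × Form => 6 * Nat.pair (toNat p.1) (toNat p.2) + i :=
    Primrec.nat_add.comp (Primrec.nat_mul.comp (Primrec.const 6)
      (Primrec₂.natPair.comp (primrec_toNat.comp Primrec.fst) (primrec_toNat.comp Primrec.snd)))
      (Primrec.const i)
  exact (primrec_ofNat.comp h').of_eq fun p => by rw [← h, ofNat_toNat]

theorem primrec_and : Primrec₂ Form.and := primrec_binary 3 fun _ _ => rfl

theorem primrec_or : Primrec₂ Form.or := primrec_binary 4 fun _ _ => rfl

theorem primrec_imp : Primrec₂ Form.imp := primrec_binary 5 fun _ _ => rfl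

theorem primrec_box : Primrec Form.box := by
  have h : Primrec fun A : Form => 6 * toNat A + 6 :=
    Primrec.nat_add.comp (Primrec.nat_mul.comp (Primrec.const 6) primrec_toNat) (Primrec.const 6)
  exact (primrec_ofNat.comp h).of_eq fun A => ofNat_toNat (.box A)

theorem primrec_var : Primrec fun n => Form.atom (.var n) := by
  have h : Primrec fun n => 6 * n + 1 :=
    Primrec.nat_add.comp (Primrec.nat_mul.comp (Primrec.const 6) Primrec.id) (Primrec.const 1)
  exact (primrec_ofNat.comp h).of_eq fun n => ofNat_toNat (.atom (.var n))

theorem primrec_par : Primrec fun n => Form.atom (.par n) := by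
  have h : Primrec fun n => 6 * n + 2 :=
    Primrec.nat_add.comp (Primrec.nat_mul.comp (Primrec.const 6) Primrec.id) (Primrec.const 2)
  exact (primrec_ofNat.comp h).of_eq fun n => ofNat_toNat (.atom (.par n))

theorem primrec_boxdot : Primrec Form.boxdot := primrec_and.comp Primrec.id primrec_box

theorem mem_atomb_iff (A : Form) : A ∈ atomb ↔ toNat A % 6 < 3 := by
  cases A with
  | bot => simp [Form.toNat]
  | atom a => cases a <;> simp [Form.toNat, Nat.add_mod]
  | box A => simp [Form.toNat]
  | and A B => simp [Form.toNat, Nat.add_mod]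
  | or A B => simp [Form.toNat, Nat.add_mod]
  | imp A B => simp [Form.toNat, Nat.add_mod]

theorem primrec_atomb : PrimrecPred fun A : Form => A ∈ atomb :=
  (Primrec.nat_lt.comp (Primrec.nat_mod.comp primrec_toNat (Primrec.const 6))
    (Primrec.const 3)).of_eq fun A => (mem_atomb_iff A).symm

/-- The singleton case differs from the general one, so the recursion also tests whether the tail is
empty. -/
theorem primrec_list_op {op : Form → Form → Form} (hop : Primrec₂ op) {f : List Form → Form}
    (h₁ : ∀ A, f [A] = A) (h₂ : ∀ A B l, f (A :: B :: l) = op A (f (B :: l))) : Primrec f := by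
  have h : Primrec fun l : List Form => (l.recOn (f []) fun A l IH =>
      if l = [] then A else op A IH : Form) := by
    refine Primrec.list_rec (h := fun _ p => if p.2.1 = [] then p.1 else op p.1 p.2.2)
      Primrec.id (Primrec.const _) ?_
    have hp : Primrec fun p : List Form × Form × List Form × Form => p.2 := Primrec.snd
    exact Primrec.ite (Primrec.eq.comp (Primrec.fst.comp (Primrec.snd.comp hp)) (Primrec.const []))
      (Primrec.fst.comp hp)
      (hop.comp (Primrec.fst.comp hp) (Primrec.snd.comp (Primrec.snd.comp hp)))
  refine h.of_eq fun l => ?_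
  induction l with
  | nil => rfl
  | cons A l ih =>
    cases l with
    | nil => exact (h₁ A).symm
    | cons B l =>
      rw [h₂, ← ih]
      rfl

theorem primrec_conj : Primrec Form.conj :=
  primrec_list_op primrec_and (fun _ => rfl) fun _ _ _ => rfl

theorem primrec_disj : Primrec Form.disj :=
  primrec_list_op primrec_or (fun _ => rfl) fun _ _ _ => rfl

open Classical in
theorem primrec_curly : Primrec₂ (curly atomb) := by
  have h : PrimrecPred fun p : Form × Form => p.2 ∈ atomb := primrec_atomb.comp Primrec.snd
  exact Primrec.ite h Primrec.snd primrec_imp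

theorem primrec_imps : Primrec fun ps : List (Form × Form) =>
    Form.conj (ps.map fun p => Form.imp p.1 p.2) :=
  primrec_conj.comp (Primrec.list_map Primrec.id
    (primrec_imp.comp (Primrec.fst.comp Primrec.snd) (Primrec.snd.comp Primrec.snd)))

theorem primrec_visserPrem : Primrec₂ visserPrem :=
  primrec_imp.comp (primrec_imps.comp Primrec.fst) (primrec_disj.comp Primrec.snd)

theorem primrec_visserConcl : Primrec₂ visserConcl :=
  primrec_disj.comp (Primrec.list_map
    (Primrec.list_append.comp (Primrec.list_map Primrec.fst (Primrec.fst.comp Primrec.snd))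
      Primrec.snd)
    (primrec_curly.comp (primrec_imps.comp (Primrec.fst.comp Primrec.fst)) Primrec.snd))

/-! ### Computability of the approximation and of the translation -/

/-- Tagged pairs of formulas. -/
abbrev Judgement : Type := ℕ × Form × Form

/-- Parameters of rules. -/
abbrev RuleParam : Type := (Form × Form × Form) × List (Form × Form) × List Form

/-- The parameter and the premises of a rule. -/
abbrev RuleArg : Type := RuleParam × Judgement × Judgement

/-- The judgement produced by a rule that is not applicable. -/
def trivialJudgement : Judgement := (0, .bot, .bot)

section Rules

theorem primrec_param₁ : Primrec fun t : RuleArg => t.1.1.1 :=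
  Primrec.fst.comp (Primrec.fst.comp Primrec.fst)

theorem primrec_params : Primrec fun t : RuleArg => t.1.1 := Primrec.fst.comp Primrec.fst

theorem primrec_lists : Primrec fun t : RuleArg => t.1.2 := Primrec.snd.comp Primrec.fst

theorem primrec_left : Primrec fun t : RuleArg => t.2.1 := Primrec.fst.comp Primrec.snd

theorem primrec_right : Primrec fun t : RuleArg => t.2.2 := Primrec.snd.comp Primrec.snd

theorem primrec_left₁ : Primrec fun t : RuleArg => t.2.1.2.1 :=
  Primrec.fst.comp (Primrec.snd.comp primrec_left)

theorem primrec_left₂ : Primrec fun t : RuleArg => t.2.1.2.2 :=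
  Primrec.snd.comp (Primrec.snd.comp primrec_left)

theorem primrec_right₁ : Primrec fun t : RuleArg => t.2.2.2.1 :=
  Primrec.fst.comp (Primrec.snd.comp primrec_right)

theorem primrec_right₂ : Primrec fun t : RuleArg => t.2.2.2.2 :=
  Primrec.snd.comp (Primrec.snd.comp primrec_right)

theorem primrec_left_tag (n : ℕ) : PrimrecPred fun t : RuleArg => t.2.1.1 = n :=
  Primrec.eq.comp (Primrec.fst.comp primrec_left) (Primrec.const n)

theorem primrec_right_tag (n : ℕ) : PrimrecPred fun t : RuleArg => t.2.2.1 = n :=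
  Primrec.eq.comp (Primrec.fst.comp primrec_right) (Primrec.const n)

open Classical in
/-- The rule with side condition `c` and conclusion `f` tagged by `n`. -/
noncomputable def mkRule (n : ℕ) (c : RuleArg → Prop) (f : RuleArg → Form × Form) (t : RuleArg) :
    Judgement := if c t then (n, f t) else trivialJudgement

theorem mkRule_of {n : ℕ} {c : RuleArg → Prop} {f : RuleArg → Form × Form} {t : RuleArg}
    (h : c t) : mkRule n c f t = (n, f t) := if_pos h

theorem primrec_mkRule (n : ℕ) {c : RuleArg → Prop} {f : RuleArg → Form × Form}
    (hc : PrimrecPred c) (hf : Primrec f) : Primrec (mkRule n c f) := by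
  classical
  exact Primrec.ite hc ((Primrec.const n).pair hf) (Primrec.const _)

theorem mkRule_induction {good : Judgement → Prop} (hd : good trivialJudgement) {n : ℕ}
    {c : RuleArg → Prop} {f : RuleArg → Form × Form} {t : RuleArg} (h : c t → good (n, f t)) :
    good (mkRule n c f t) := by
  unfold mkRule
  split_ifs with ht
  · exact h ht
  · exact hd

end Rules

/-- The axiom schemes of `IPC`. -/
def ipcSchemes : List (Form → Form → Form → Form) :=
  [fun A B _ => imp A (imp B A),
    fun A B C => imp (imp A (imp B C)) (imp (imp A B) (imp A C)),
    fun A B _ => imp A (imp B (.and A B)),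
    fun A B _ => imp (.and A B) A,
    fun A B _ => imp (.and A B) B,
    fun A B C => imp (imp A C) (imp (imp B C) (imp (.or A B) C)),
    fun A B _ => imp A (.or A B),
    fun A B _ => imp B (.or A B),
    fun A _ _ => imp .bot A]

theorem axIPC_iff {F : Form} : AxIPC F ↔ ∃ f ∈ ipcSchemes, ∃ A B C, F = f A B C := by
  constructor
  · intro h
    cases h with
    | k A B => exact ⟨_, .head _, A, B, B, rfl⟩
    | s A B C => exact ⟨_, .tail _ (.head _), A, B, C, rfl⟩
    | andI A B => exact ⟨_, .tail _ (.tail _ (.head _)), A, B, B, rfl⟩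
    | andL A B => exact ⟨_, .tail _ (.tail _ (.tail _ (.head _))), A, B, B, rfl⟩
    | andR A B => exact ⟨_, .tail _ (.tail _ (.tail _ (.tail _ (.head _)))), A, B, B, rfl⟩
    | orE A B C =>
      exact ⟨_, .tail _ (.tail _ (.tail _ (.tail _ (.tail _ (.head _))))), A, B, C, rfl⟩
    | orL A B =>
      exact ⟨_, .tail _ (.tail _ (.tail _ (.tail _ (.tail _ (.tail _ (.head _)))))), A, B, B, rfl⟩
    | orR A B =>
      exact ⟨_, .tail _ (.tail _ (.tail _ (.tail _ (.tail _ (.tail _ (.tail _ (.head _))))))),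
        A, B, B, rfl⟩
    | exfalso A =>
      exact ⟨_, .tail _ (.tail _ (.tail _ (.tail _ (.tail _ (.tail _ (.tail _ (.tail _
        (.head _)))))))), A, A, A, rfl⟩
  · rintro ⟨f, hf, A, B, C, rfl⟩
    simp only [ipcSchemes, List.mem_cons, List.not_mem_nil, or_false] at hf
    rcases hf with rfl | rfl | rfl | rfl | rfl | rfl | rfl | rfl | rfl
    exacts [.k A B, .s A B C, .andI A B, .andL A B, .andR A B, .orE A B C, .orL A B, .orR A B,
      .exfalso A]

theorem primrec_of_mem_ipcSchemes {f : Form → Form → Form → Form} (hf : f ∈ ipcSchemes) :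
    Primrec fun p : Form × Form × Form => f p.1 p.2.1 p.2.2 := by
  have hA : Primrec fun p : Form × Form × Form => p.1 := Primrec.fst
  have hB : Primrec fun p : Form × Form × Form => p.2.1 := Primrec.fst.comp Primrec.snd
  have hC : Primrec fun p : Form × Form × Form => p.2.2 := Primrec.snd.comp Primrec.snd
  have hi {g h : Form × Form × Form → Form} (hg : Primrec g) (hh : Primrec h) :
      Primrec fun p => imp (g p) (h p) := primrec_imp.comp hg hh
  have hand := primrec_and.comp hA hB
  have hor := primrec_or.comp hA hB
  simp only [ipcSchemes, List.mem_cons, List.not_mem_nil, or_false] at hf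
  rcases hf with rfl | rfl | rfl | rfl | rfl | rfl | rfl | rfl | rfl
  exacts [hi hA (hi hB hA), hi (hi hA (hi hB hC)) (hi (hi hA hB) (hi hA hC)), hi hA (hi hB hand),
    hi hand hA, hi hand hB, hi (hi hA hC) (hi (hi hB hC) (hi hor hC)), hi hA hor, hi hB hor,
    hi (Primrec.const _) hA]

/-- The rules that generate the theorems of `IPC` (with tag `1`) and the relation `Approx`
(with tag `2`). -/
noncomputable def approxRules : List (RuleArg → Judgement) :=
  ipcSchemes.map (fun f => mkRule 1 (fun _ => True)
    fun t => (f t.1.1.1 t.1.1.2.1 t.1.1.2.2, .bot)) ++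
  [mkRule 1 (fun t => (t.2.1.1 = 1 ∧ t.2.2.1 = 1) ∧ t.2.1.2.1 = imp t.2.2.2.1 t.1.1.1)
      fun t => (t.1.1.1, .bot),
    mkRule 2 (fun t => t.1.1.1 ∈ atomb) fun t => (t.1.1.1, t.1.1.1),
    mkRule 2 (fun t => t.2.1.1 = 2 ∧ t.2.2.1 = 2)
      fun t => (.and t.2.1.2.1 t.2.2.2.1, .and t.2.1.2.2 t.2.2.2.2),
    mkRule 2 (fun t => t.2.1.1 = 2 ∧ t.2.2.1 = 2)
      fun t => (.or t.2.1.2.1 t.2.2.2.1, .or t.2.1.2.2 t.2.2.2.2),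
    mkRule 2 (fun t => t.2.1.1 = 2 ∧ t.1.1.1 ∈ atomb)
      fun t => (imp t.1.1.1 t.2.1.2.1, imp t.1.1.1 t.2.1.2.2),
    mkRule 2 (fun t => (t.2.1.1 = 2 ∧ t.2.2.1 = 1) ∧
        t.2.2.2.1 = .and (imp t.2.1.2.1 t.1.1.1) (imp t.1.1.1 t.2.1.2.1))
      fun t => (t.1.1.1, t.2.1.2.2),
    mkRule 2 (fun t => t.2.1.1 = 2 ∧
        t.2.1.2.1 = .and (visserConcl t.1.2.1 t.1.2.2) (visserPrem t.1.2.1 t.1.2.2))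
      fun t => (visserPrem t.1.2.1 t.1.2.2, t.2.1.2.2)]

theorem primrec_of_mem_approxRules : ∀ r ∈ approxRules, Primrec r := by
  have hV := primrec_visserPrem.comp (Primrec.fst.comp primrec_lists)
    (Primrec.snd.comp primrec_lists)
  have hV' := primrec_visserConcl.comp (Primrec.fst.comp primrec_lists)
    (Primrec.snd.comp primrec_lists)
  have htags (m n : ℕ) := (primrec_left_tag m).and (primrec_right_tag n)
  have hatomb := primrec_atomb.comp primrec_param₁
  simp only [approxRules, List.forall_mem_append, List.forall_mem_map, List.forall_mem_cons]
  refine ⟨fun f hf => ?_, ?_, ?_, ?_, ?_, ?_, ?_, ?_, by simp⟩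
  · exact primrec_mkRule _ ((Primrec.eq.comp (Primrec.const 0) (Primrec.const 0)).of_eq
      fun _ => by simp) (((primrec_of_mem_ipcSchemes hf).comp primrec_params).pair
        (Primrec.const _))
  · exact primrec_mkRule _ ((htags 1 1).and (Primrec.eq.comp primrec_left₁
      (primrec_imp.comp primrec_right₁ primrec_param₁))) (primrec_param₁.pair (Primrec.const _))
  · exact primrec_mkRule _ hatomb (primrec_param₁.pair primrec_param₁)
  · exact primrec_mkRule _ (htags 2 2) ((primrec_and.comp primrec_left₁ primrec_right₁).pair
      (primrec_and.comp primrec_left₂ primrec_right₂))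
  · exact primrec_mkRule _ (htags 2 2) ((primrec_or.comp primrec_left₁ primrec_right₁).pair
      (primrec_or.comp primrec_left₂ primrec_right₂))
  · exact primrec_mkRule _ ((primrec_left_tag 2).and hatomb)
      ((primrec_imp.comp primrec_param₁ primrec_left₁).pair
        (primrec_imp.comp primrec_param₁ primrec_left₂))
  · exact primrec_mkRule _ ((htags 2 1).and (Primrec.eq.comp primrec_right₁ (primrec_and.comp
      (primrec_imp.comp primrec_left₁ primrec_param₁)
      (primrec_imp.comp primrec_param₁ primrec_left₁)))) (primrec_param₁.pair primrec_left₂)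
  · exact primrec_mkRule _ ((primrec_left_tag 2).and
      (Primrec.eq.comp primrec_left₁ (primrec_and.comp hV' hV))) (hV.pair primrec_left₂)

/-- Visser's approximation is computable. -/
theorem exists_computable_approx : ∃ star : Form → Form, Computable star ∧
    ∀ A, Approx A (star A) := by
  obtain ⟨e, he, hcl, hind⟩ := exists_enumeration trivialJudgement primrec_of_mem_approxRules
  have hcl' := hcl
  simp only [approxRules, List.forall_mem_append, List.forall_mem_map,
    List.forall_mem_cons] at hcl'
  obtain ⟨hax, hmp, hbase, hand, hor, himp, hcongr, hvisser, -⟩ := hcl'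
  have hIPC : ∀ A ∈ IPC, ∃ n, e n = (1, A, .bot) := by
    intro A hA
    induction hA with
    | ax h =>
      obtain ⟨f, hf, A, B, C, rfl⟩ := axIPC_iff.1 h
      obtain ⟨n, hn⟩ := hax f hf ((A, B, C), [], []) 0 0
      exact ⟨n, hn.trans (mkRule_of trivial)⟩
    | @mp A B _ _ ih₁ ih₂ =>
      obtain ⟨i, hi⟩ := ih₁
      obtain ⟨j, hj⟩ := ih₂
      obtain ⟨n, hn⟩ := hmp ((B, B, B), [], []) i j
      exact ⟨n, hn.trans (mkRule_of (by simp [hi, hj]))⟩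
  have happrox : ∀ {A D}, Approx A D → ∃ n, e n = (2, A, D) := by
    intro A D h
    induction h with
    | @base A h =>
      -- Index `0` and the repeated parameters are placeholders for arguments the rule ignores.
      obtain ⟨n, hn⟩ := hbase ((A, A, A), [], []) 0 0
      exact ⟨n, hn.trans (mkRule_of h)⟩
    | and _ _ ih₁ ih₂ =>
      obtain ⟨i, hi⟩ := ih₁
      obtain ⟨j, hj⟩ := ih₂
      obtain ⟨n, hn⟩ := hand default i j
      exact ⟨n, hn.trans ((mkRule_of (by simp [hi, hj])).trans (by simp [hi, hj]))⟩
    | or _ _ ih₁ ih₂ =>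
      obtain ⟨i, hi⟩ := ih₁
      obtain ⟨j, hj⟩ := ih₂
      obtain ⟨n, hn⟩ := hor default i j
      exact ⟨n, hn.trans ((mkRule_of (by simp [hi, hj])).trans (by simp [hi, hj]))⟩
    | @imp A D C hC _ ih =>
      obtain ⟨i, hi⟩ := ih
      obtain ⟨n, hn⟩ := himp ((C, C, C), [], []) i 0
      exact ⟨n, hn.trans ((mkRule_of (by simp [hi, hC])).trans (by simp [hi]))⟩
    | @congr A A' D _ h ih =>
      obtain ⟨i, hi⟩ := ih
      obtain ⟨j, hj⟩ := hIPC _ h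
      obtain ⟨n, hn⟩ := hcongr ((A', A', A'), [], []) i j
      exact ⟨n, hn.trans ((mkRule_of (by simp [hi, hj])).trans (by simp [hi]))⟩
    | @visser ps cs D _ ih =>
      obtain ⟨i, hi⟩ := ih
      obtain ⟨n, hn⟩ := hvisser ((.bot, .bot, .bot), ps, cs) i 0
      exact ⟨n, hn.trans ((mkRule_of (by simp [hi])).trans (by simp [hi]))⟩
  have hsound := hind
    (fun x => (x.1 = 1 → x.2.1 ∈ IPC) ∧ (x.1 = 2 → Approx x.2.1 x.2.2)) (by simp [trivialJudgement])
    (by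
      have hd : (trivialJudgement.1 = 1 → trivialJudgement.2.1 ∈ IPC) ∧
        (trivialJudgement.1 = 2 → Approx trivialJudgement.2.1 trivialJudgement.2.2) := by
        simp [trivialJudgement]
      simp only [approxRules, List.forall_mem_append, List.forall_mem_map, List.forall_mem_cons]
      refine ⟨fun f hf c x y hx hy => ?_, fun c x y hx hy => ?_, fun c x y hx hy => ?_,
        fun c x y hx hy => ?_, fun c x y hx hy => ?_, fun c x y hx hy => ?_,
        fun c x y hx hy => ?_, fun c x y hx hy => ?_, by simp⟩ <;>
      refine mkRule_induction (good := fun x => (x.1 = 1 → x.2.1 ∈ IPC) ∧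
        (x.1 = 2 → Approx x.2.1 x.2.2)) hd fun h => ⟨fun h1 => ?_, fun h2 => ?_⟩ <;>
      -- The tags `1` and `2` keep the two generated relations apart, so one half of each goal is
      -- vacuous.
      first
        | exact absurd h1 (by decide : ¬ (2 : ℕ) = 1)
        | exact absurd h2 (by decide : ¬ (1 : ℕ) = 2)
        | skip
      · exact .ax (axIPC_iff.2 ⟨f, hf, _, _, _, rfl⟩)
      · exact Deriv.mp (h.2 ▸ hx.1 h.1.1 : imp _ _ ∈ IPC) (hy.1 h.1.2)
      · exact .base h
      · exact (hx.2 h.1).and (hy.2 h.2)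
      · exact (hx.2 h.1).or (hy.2 h.2)
      · exact (hx.2 h.1).imp h.2
      · exact (hx.2 h.1.1).congr (h.2 ▸ hy.1 h.1.2)
      · exact .visser (h.2 ▸ hx.2 h.1))
  obtain ⟨star, hstar, hs⟩ := exists_computable he 2 fun A => by
    obtain ⟨D, hD⟩ := hasApprox A
    obtain ⟨n, hn⟩ := happrox hD
    exact ⟨n, D, hn⟩
  refine ⟨star, hstar, fun A => ?_⟩
  obtain ⟨n, hn⟩ := hs A
  have := (hsound n).2
  rw [hn] at this
  exact this rfl

/-- The rules that generate the graph of the translation (with tag `1`). -/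
noncomputable def boxTrRules : List (RuleArg → Judgement) :=
  [mkRule 1 (fun _ => True) fun _ => (.bot, .bot),
    mkRule 1 (fun _ => True) fun t =>
      (.atom (.var (toNat t.1.1.1)), boxdot (.atom (.var (toNat t.1.1.1)))),
    mkRule 1 (fun _ => True) fun t =>
      (.atom (.par (toNat t.1.1.1)), .atom (.par (toNat t.1.1.1))),
    mkRule 1 (fun _ => True) fun t => (box t.1.1.1, box t.1.1.1),
    mkRule 1 (fun t => t.2.1.1 = 1 ∧ t.2.2.1 = 1)
      fun t => (.and t.2.1.2.1 t.2.2.2.1, .and t.2.1.2.2 t.2.2.2.2),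
    mkRule 1 (fun t => t.2.1.1 = 1 ∧ t.2.2.1 = 1)
      fun t => (.or t.2.1.2.1 t.2.2.2.1, .or t.2.1.2.2 t.2.2.2.2),
    mkRule 1 (fun t => t.2.1.1 = 1 ∧ t.2.2.1 = 1)
      fun t => (imp t.2.1.2.1 t.2.2.2.1, boxdot (imp t.2.1.2.2 t.2.2.2.2))]

theorem primrec_of_mem_boxTrRules : ∀ r ∈ boxTrRules, Primrec r := by
  have htrue : PrimrecPred fun _ : RuleArg => True :=
    (Primrec.eq.comp (Primrec.const 0) (Primrec.const 0)).of_eq fun _ => by simp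
  have htags := (primrec_left_tag 1).and (primrec_right_tag 1)
  have hn := primrec_toNat.comp primrec_param₁
  simp only [boxTrRules, List.forall_mem_cons]
  refine ⟨?_, ?_, ?_, ?_, ?_, ?_, ?_, by simp⟩
  · exact primrec_mkRule _ htrue (Primrec.const _)
  · exact primrec_mkRule _ htrue
      ((primrec_var.comp hn).pair (primrec_boxdot.comp (primrec_var.comp hn)))
  · exact primrec_mkRule _ htrue ((primrec_par.comp hn).pair (primrec_par.comp hn))
  · exact primrec_mkRule _ htrue
      ((primrec_box.comp primrec_param₁).pair (primrec_box.comp primrec_param₁))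
  · exact primrec_mkRule _ htags ((primrec_and.comp primrec_left₁ primrec_right₁).pair
      (primrec_and.comp primrec_left₂ primrec_right₂))
  · exact primrec_mkRule _ htags ((primrec_or.comp primrec_left₁ primrec_right₁).pair
      (primrec_or.comp primrec_left₂ primrec_right₂))
  · exact primrec_mkRule _ htags ((primrec_imp.comp primrec_left₁ primrec_right₁).pair
      (primrec_boxdot.comp (primrec_imp.comp primrec_left₂ primrec_right₂)))

/-- The graph of the translation is generated by rules following its recursion, so its values can be
found by search. -/
theorem computable_boxTr : Computable boxTr := by
  obtain ⟨e, he, hcl, hind⟩ := exists_enumeration trivialJudgement primrec_of_mem_boxTrRules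
  have hcl' := hcl
  simp only [boxTrRules, List.forall_mem_cons] at hcl'
  obtain ⟨hbot, hvar, hpar, hbox, hand, hor, himp, -⟩ := hcl'
  have hgraph : ∀ A, ∃ n, e n = (1, A, boxTr A) := by
    intro A
    induction A with
    | bot =>
      obtain ⟨n, hn⟩ := hbot default 0 0
      exact ⟨n, hn.trans (mkRule_of trivial)⟩
    | atom a =>
      cases a with
      | var k =>
        obtain ⟨n, hn⟩ := hvar ((ofNat k, .bot, .bot), [], []) 0 0
        exact ⟨n, hn.trans ((mkRule_of trivial).trans (by simp [toNat_ofNat, boxTr]))⟩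
      | par k =>
        obtain ⟨n, hn⟩ := hpar ((ofNat k, .bot, .bot), [], []) 0 0
        exact ⟨n, hn.trans ((mkRule_of trivial).trans (by simp [toNat_ofNat, boxTr]))⟩
    | box A _ =>
      obtain ⟨n, hn⟩ := hbox ((A, .bot, .bot), [], []) 0 0
      exact ⟨n, hn.trans (mkRule_of trivial)⟩
    | and A B ih₁ ih₂ =>
      obtain ⟨i, hi⟩ := ih₁
      obtain ⟨j, hj⟩ := ih₂
      obtain ⟨n, hn⟩ := hand default i j
      exact ⟨n, hn.trans ((mkRule_of (by simp [hi, hj])).trans (by simp [hi, hj, boxTr]))⟩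
    | or A B ih₁ ih₂ =>
      obtain ⟨i, hi⟩ := ih₁
      obtain ⟨j, hj⟩ := ih₂
      obtain ⟨n, hn⟩ := hor default i j
      exact ⟨n, hn.trans ((mkRule_of (by simp [hi, hj])).trans (by simp [hi, hj, boxTr]))⟩
    | imp A B ih₁ ih₂ =>
      obtain ⟨i, hi⟩ := ih₁
      obtain ⟨j, hj⟩ := ih₂
      obtain ⟨n, hn⟩ := himp default i j
      exact ⟨n, hn.trans ((mkRule_of (by simp [hi, hj])).trans (by simp [hi, hj, boxTr]))⟩
  have hsound := hind (fun x => x.1 = 1 → x.2.2 = boxTr x.2.1) (by simp [trivialJudgement])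
    (by
      simp only [boxTrRules, List.forall_mem_cons]
      refine ⟨fun c x y hx hy => ?_, fun c x y hx hy => ?_, fun c x y hx hy => ?_,
        fun c x y hx hy => ?_, fun c x y hx hy => ?_, fun c x y hx hy => ?_,
        fun c x y hx hy => ?_, by simp⟩ <;>
      refine mkRule_induction (good := fun x => x.1 = 1 → x.2.2 = boxTr x.2.1)
        (by simp [trivialJudgement]) fun h _ => ?_
      · rfl
      · rfl
      · rfl
      · rfl
      all_goals simp only [boxTr, hx h.1, hy h.2])
  obtain ⟨f, hf, hfe⟩ := exists_computable he 1 fun A => by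
    obtain ⟨n, hn⟩ := hgraph A
    exact ⟨n, _, hn⟩
  refine hf.of_eq fun A => ?_
  obtain ⟨n, hn⟩ := hfe A
  have := hsound n
  rw [hn] at this
  exact this rfl

/-! ### The main theorem -/

section Main

variable {T : Set Form}

/-- A disjunction implies `A` exactly when each of its disjuncts does; nothing about `Γ` matters. -/
theorem pres_vee (hT : IsTheory T) (Γ : Set Form) : Pres T (vee Γ) = Pres T Γ := by
  funext A B
  refine propext ⟨fun h E hE => ?_, fun h E hE hEA => ?_⟩
  · exact h E ⟨[E], by simp, by simpa using hE, rfl⟩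
  · obtain ⟨l, -, hl, rfl⟩ := hE
    rw [hT.imp_mem_iff] at hEA ⊢
    intro w hw hlw
    obtain ⟨E, hE, hEw⟩ := hw.disj_iff.1 hlw
    refine hT.imp_mem_iff.1 (h E (hl E hE) (hT.imp_mem_iff.2 fun u hu hEu => ?_)) w hw hEw
    exact hEA u hu (hu.disj_iff.2 ⟨E, hE, hEu⟩)

theorem TypeSigma.pres_SPN (hT : TypeSigma T) : Pres T SNNIL = Pres T (SPN T) := by
  funext A B
  refine propext ⟨fun h E hE => h E ⟨hE.1.1, hE.2⟩, fun h E hE hEA => ?_⟩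
  obtain ⟨P, hP, hG⟩ := hT.exists_points
  rw [hP.imp_mem_iff] at hEA ⊢
  intro w hw hEw
  obtain ⟨G, hG, hGw, hGE, hGp⟩ := hT.exists_prime_snnil hP hG hE hw hEw
  rw [hP.imp_mem_iff] at hGE
  exact hP.imp_mem_iff.1 (h G ⟨⟨hG.1, hGp⟩, hG.2⟩
    (hP.imp_mem_iff.2 fun u hu hGu => hEA u hu (hGE u hu hGu))) w hw hGw

theorem TypeSigma.imp_trans (hT : TypeSigma T) {A B C : Form} (h : imp A B ∈ T)
    (h' : imp B C ∈ T) : imp A C ∈ T := by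
  have ht := hT.isTheory
  rw [ht.imp_mem_iff] at *
  exact fun w hw hA => h' w hw (h w hw hA)

/-- Forwards, `D^□` is an `SNNIL` formula implying `A`, hence a test case; backwards, `A ▷ D ▷ D^□ ▷
B` and soundness applies. -/
theorem TypeSigma.pres_iff_of_approx (hT : TypeSigma T) {A B D : Form} (hD : Approx A D) :
    Pres T SNNIL A B ↔ imp (boxTr D) B ∈ T := by
  constructor
  · exact fun h => h _ (boxTr_mem_SNNIL hD.isNNIL)
      (hT.imp_trans (hT.imp_boxTr_self hD.isNNIL) (hT.isTheory.ipc hD.imp_mem))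
  · exact fun h => hT.pres_of_arPlus
      (.cut (hD.arPlus hT.isTheory) (.cut (.boxTr hT hD.isNNIL) (.ax h)))

theorem TypeSigma.arPlus_iff_pres (hT : TypeSigma T) (A B : Form) :
    ARPlus T atomb A B ↔ Pres T SNNIL A B := by
  refine ⟨hT.pres_of_arPlus, fun h => ?_⟩
  obtain ⟨D, hD⟩ := hasApprox A
  exact .cut (hD.arPlus hT.isTheory)
    (.cut (.boxTr hT hD.isNNIL) (.ax ((hT.pres_iff_of_approx hD).1 h)))

theorem TypeSigma.isGlb_boxTr (hT : TypeSigma T) {A D : Form} (hD : IsGlb NNIL IPC A D) :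
    IsGlb SNNIL T A (boxTr D) := by
  have hDn : IsNNIL D := hD.1.1
  refine ⟨⟨boxTr_mem_SNNIL hDn, hT.imp_trans (hT.imp_boxTr_self hDn)
    (hT.isTheory.ipc hD.1.2)⟩, fun E hE hEA => ?_⟩
  -- The given `D` need not come from `Approx`, but being greatest it lies above a `D'` that does,
  -- so `A ▷ D' ▷ D ▷ D^□`.
  obtain ⟨D', hD'⟩ := hasApprox A
  have h : ARPlus T atomb A (boxTr D) := .cut (hD'.arPlus hT.isTheory)
    (.cut (.ax (hT.isTheory.ipc (hD.2 D' hD'.isNNIL hD'.imp_mem))) (.boxTr hT hDn))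
  exact hT.pres_of_arPlus h E hE hEA

theorem TypeSigma.computablePred_pres (hT : TypeSigma T)
    (hdec : ComputablePred fun A : Form => A ∈ T) :
    ComputablePred fun p : Form × Form => Pres T SNNIL p.1 p.2 := by
  obtain ⟨star, hstar, hs⟩ := exists_computable_approx
  obtain ⟨_, hc⟩ := hdec
  have h : Computable fun p : Form × Form => imp (boxTr (star p.1)) p.2 :=
    primrec_imp.to_comp.comp (computable_boxTr.comp (hstar.comp Computable.fst)) Computable.snd
  exact ComputablePred.of_eq ⟨inferInstance, hc.comp h⟩
    fun p => (hT.pres_iff_of_approx (hs p.1)).symm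

end Main

end SNNILPres

theorem mainTheorem10 :
    -- the two standard examples are of type σ
    (TypeSigma iK4Ca ∧ TypeSigma iGLCa) ∧
    -- Visser's approximation `A*`, the best NNIL lower bound in IPC, exists and is computable
    (∃ star : Form → Form, Computable star ∧ Computable (fun A => boxTr (star A)) ∧
      ∀ A, IsGlb NNIL IPC A (star A)) ∧
    ∀ T : Set Form, TypeSigma T →
      -- soundness and completeness for SNNIL-preservativity
      (∀ A B, ARPlus T atomb A B ↔ Pres T SNNIL A B) ∧
      -- equality with the variants
      (ARPlus T atomb = Pres T SNNIL ∧
        Pres T SNNIL = Pres T (vee SNNIL) ∧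
        Pres T (vee SNNIL) = Pres T (SPN T) ∧
        Pres T (SPN T) = Pres T (vee (SPN T))) ∧
      -- `(A*)^□` is the greatest lower bound of `A`
      (∀ A D, IsGlb NNIL IPC A D → IsGlb SNNIL T A (boxTr D)) ∧
      -- decidability
      (ComputablePred (fun A : Form => A ∈ T) →
        ∀ R ∈ ({ARPlus T atomb, Pres T SNNIL, Pres T (vee SNNIL), Pres T (SPN T),
            Pres T (vee (SPN T))} : Set (Form → Form → Prop)),
          ComputablePred (fun p : Form × Form => R p.1 p.2)) := by
  obtain ⟨star, hstar, hs⟩ := exists_computable_approx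
  refine ⟨⟨typeSigma_iK4Ca, typeSigma_iGLCa⟩,
    ⟨star, hstar, computable_boxTr.comp hstar, fun A => (hs A).isGlb⟩, fun T hT => ?_⟩
  have h₁ : ARPlus T atomb = Pres T SNNIL := by
    funext A B
    exact propext (hT.arPlus_iff_pres A B)
  have h₂ := pres_vee hT.isTheory SNNIL
  have h₃ := hT.pres_SPN
  have h₄ := pres_vee hT.isTheory (SPN T)
  refine ⟨hT.arPlus_iff_pres, ⟨h₁, h₂.symm, h₂.trans h₃, h₄.symm⟩,
    fun A D hD => hT.isGlb_boxTr hD, fun hdec R hR => ?_⟩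
  have hR' : R = Pres T SNNIL := by
    rw [h₁, h₂, h₄, ← h₃] at hR
    simpa using hR
  rw [hR']
  exact hT.computablePred_pres hdec
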